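/- Coflow scheduling. A switch has $m$ input ports and $m$ output ports. An instance consists of finitely many coflows $j=1,\dots,n$, numbered in order of arrival; coflow $j$ has a demand matrix $(d^j_{io})_{i,o\in[m]}$ of non-negative integers ($d^j_{io}$ is the amount of data to be sent from input port $i$ to output port $o$), a rational weight $w_j\ge 0$ and a rational release time $r_j\ge 0$. A feasible schedule is given by measurable rates $x^j_{io}(s)\ge 0$ at times $s$ such that $x^j_{io}(s)=0$ for $s<r_j$, each input port $i$ satisfies $\sum_{j,o}x^j_{io}(s)\le 1$, each output port $o$ satisfies $\sum_{j,i}x^j_{io}(s)\le 1$ for all $s$, and every coflow is eventually completed. The completion time $C_j$ is the least $t\ge r_j$ with $\int_0^t x^j_{io}(s)\,ds\ge d^j_{io}$ for all $i,o$, and the cost of the schedule is $\sum_j w_jC_j$. A (deterministic) online algorithm decides at each integer time $t\ge 0$, knowing only $m$, $t$ and the coflows with $r_j\le t$, a set of triples $(j,i,o)$; during $[t,t+1)$ one unit of data of coflow $j$ is sent from $i$ to $o$ for each chosen triple. It is $\rho$-competitive if on every instance it produces a feasible schedule whose cost is at most $\rho$ times the cost of every feasible schedule of that instance. It runs in exponential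 time if there are a program (in the standard WHILE language on binary trees, where each elementary operation counts as one step) that computes its decisions and a constant $c$ such that, on every instance, the decision at time $t$ takes at most $2^{cN_t}$ steps, where $N_t$ is the size of the binary encoding of $t$, $m$ and the coflows released by time $t$, and such that for some time $T$ by which all coflows are completed the total number of steps for the decisions at times $t<T$ is at most $2^{cN}$, where $N$ is the size of the binary encoding of the instance. **Theorem.** There exists an exponential-time $6$-competitive deterministic online algorithm for coflow scheduling. -/

import Mathlib

noncomputable section

namespace CoflowScheduling

/-! ### Coflows, schedules and their cost -/

/-- A coflow on a non-blocking switch with `m` input ports and `m` output ports: the amount of data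
to be transferred from each input port to each output port, a weight and a release time. -/
structure Coflow (m : ℕ) where
  demand : Fin m → Fin m → ℕ
  weight : ℚ≥0
  release : ℚ≥0

/-- An instance: the number of ports on each side, and the coflows, numbered in order of arrival. -/
structure Instance where
  m : ℕ
  coflows : List (Coflow m)
  sorted : coflows.Pairwise fun a b => a.release ≤ b.release

namespace Instance

variable (I : Instance)

/-- Indices of the coflows. -/
abbrev Job : Type := Fin I.coflows.length

def demand (j : I.Job) : Fin I.m → Fin I.m → ℕ := (I.coflows.get j).demand

def weight (j : I.Job) : ℝ := ((I.coflows.get j).weight : ℝ)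

def release (j : I.Job) : ℝ := ((I.coflows.get j).release : ℝ)

/-- What an online algorithm knows at time `t`: the coflows released up to time `t`. -/
def revealed (t : ℕ) : Instance where
  m := I.m
  coflows := I.coflows.filter fun a => decide (a.release ≤ (t : ℚ≥0))
  sorted := I.sorted.filter _

/-- The revealed coflows form an initial segment, so they keep their numbers. -/
theorem revealed_prefix (t : ℕ) : (I.revealed t).coflows <+: I.coflows := by
  have key : ∀ l : List (Coflow I.m), l.Pairwise (fun a b => a.release ≤ b.release) →
      l.filter (fun a => decide (a.release ≤ (t : ℚ≥0))) <+: l := by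
    intro l hl
    induction l with
    | nil => simp
    | cons a l ih =>
      rw [List.pairwise_cons] at hl
      by_cases h : a.release ≤ (t : ℚ≥0)
      · rw [List.filter_cons_of_pos (by simpa using h)]
        exact (List.prefix_cons_inj a).2 (ih hl.2)
      · have : (a :: l).filter (fun a => decide (a.release ≤ (t : ℚ≥0))) = [] := by
          rw [List.filter_eq_nil_iff]
          intro b hb
          rcases List.mem_cons.1 hb with rfl | hb
          · simpa using h
          · simpa using lt_of_lt_of_le (not_le.1 h) (hl.1 b hb)
        rw [this]
        exact List.nil_prefix
  exact key I.coflows I.sorted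

/-- A (preemptive) schedule: `x j i o s` is the rate at which, at time `s`, data of coflow `j` is
transferred from input port `i` to output port `o`. -/
abbrev Schedule : Type := I.Job → Fin I.m → Fin I.m → ℝ → ℝ

/-- All the data of coflow `j` has been transferred by time `t`. -/
def DoneBy (x : I.Schedule) (j : I.Job) (t : ℝ) : Prop :=
  ∀ i o, (I.demand j i o : ℝ) ≤ ∫ s in (0 : ℝ)..t, x j i o s

/-- Feasible schedules: nothing is transferred before its release time, each port handles at most
one unit of data per time unit, and every coflow is completed eventually. -/
structure Feasible (x : I.Schedule) : Prop where
  measurable : ∀ j i o, Measurable (x j i o)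
  nonneg : ∀ j i o s, 0 ≤ x j i o s
  released : ∀ j i o s, s < I.release j → x j i o s = 0
  input_capacity : ∀ i s, ∑ j, ∑ o, x j i o s ≤ 1
  output_capacity : ∀ o s, ∑ j, ∑ i, x j i o s ≤ 1
  completes : ∀ j, ∃ t, I.release j ≤ t ∧ I.DoneBy x j t

/-- The earliest time, not before its release, at which coflow `j` is completed. -/
def completionTime (x : I.Schedule) (j : I.Job) : ℝ :=
  sInf {t | I.release j ≤ t ∧ I.DoneBy x j t}

/-- The total weighted completion time. -/
def cost (x : I.Schedule) : ℝ := ∑ j, I.weight j * I.completionTime x j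

end Instance

/-! ### A machine model with a step count

Programs transform binary trees by elementary pointer operations, each of which costs one step.
This is the usual WHILE language with a single tree variable; its running times agree with those of
Turing machines up to a polynomial. -/

/-- Binary trees. -/
inductive Data where
  | nil : Data
  | cons : Data → Data → Data

/-- The number of nodes of a tree. -/
def Data.size : Data → ℕ
  | .nil => 1
  | .cons a b => a.size + b.size + 1

inductive Prog where
  | skip : Prog
  | nil : Prog
  | hd : Prog
  | tl : Prog
  | cons : Prog → Prog → Prog
  | seq : Prog → Prog → Prog
  | ite : Prog → Prog → Prog → Prog
  | loop : Prog → Prog → Prog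

/-- `Eval p a b s`: on input `a`, the program `p` halts with output `b` after `s` steps. Tests
succeed when they return a tree other than `nil`; `loop c p` repeats `p` as long as the test `c`
succeeds. -/
inductive Eval : Prog → Data → Data → ℕ → Prop where
  | skip (a : Data) : Eval .skip a a 1
  | nil (a : Data) : Eval .nil a .nil 1
  | hd_nil : Eval .hd .nil .nil 1
  | hd_cons (a b : Data) : Eval .hd (.cons a b) a 1
  | tl_nil : Eval .tl .nil .nil 1
  | tl_cons (a b : Data) : Eval .tl (.cons a b) b 1
  | cons {p q : Prog} {a b c : Data} {s t : ℕ} :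
      Eval p a b s → Eval q a c t → Eval (.cons p q) a (.cons b c) (s + t + 1)
  | seq {p q : Prog} {a b c : Data} {s t : ℕ} :
      Eval p a b s → Eval q b c t → Eval (.seq p q) a c (s + t + 1)
  | ite_true {c p q : Prog} {a u v b : Data} {s t : ℕ} :
      Eval c a (.cons u v) s → Eval p a b t → Eval (.ite c p q) a b (s + t + 1)
  | ite_false {c p q : Prog} {a b : Data} {s t : ℕ} :
      Eval c a .nil s → Eval q a b t → Eval (.ite c p q) a b (s + t + 1)
  | loop_stop {c p : Prog} {a : Data} {s : ℕ} :
      Eval c a .nil s → Eval (.loop c p) a a (s + 1)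
  | loop_step {c p : Prog} {a u v b d : Data} {s t r : ℕ} :
      Eval c a (.cons u v) s → Eval p a b t → Eval (.loop c p) b d r →
      Eval (.loop c p) a d (s + t + r + 1)

/-! ### Encodings, with numbers in binary -/

def encodeList {α : Type} (f : α → Data) : List α → Data
  | [] => .nil
  | a :: l => .cons (f a) (encodeList f l)

def encodeBool : Bool → Data
  | false => .nil
  | true => .cons .nil .nil

/-- Binary digits, least significant first. -/
def encodeNat (n : ℕ) : Data := encodeList encodeBool n.bits

def encodeNNRat (q : ℚ≥0) : Data := .cons (encodeNat q.num) (encodeNat q.den)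

def Coflow.encode {m : ℕ} (a : Coflow m) : Data :=
  .cons (encodeList (encodeList encodeNat) (List.ofFn fun i => List.ofFn fun o => a.demand i o))
    (.cons (encodeNNRat a.weight) (encodeNNRat a.release))

def Instance.encode (I : Instance) : Data :=
  .cons (encodeNat I.m) (encodeList Coflow.encode I.coflows)

/-- A decision for one time slot: a list of triples (coflow, input port, output port), each meaning
that one unit of data of that coflow is sent from that input port to that output port. -/
abbrev Decision : Type := List (ℕ × ℕ × ℕ)

def Decision.encode (d : Decision) : Data :=
  encodeList (fun e => .cons (encodeNat e.1) (.cons (encodeNat e.2.1) (encodeNat e.2.2))) d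

/-- The input on which the decision for the slot `[t, t + 1)` is computed. -/
def Instance.onlineInput (I : Instance) (t : ℕ) : Data :=
  .cons (encodeNat t) (I.revealed t).encode

/-! ### Online algorithms -/

/-- A deterministic online algorithm: at each time `t = 0, 1, 2, …` it decides what is sent in the
slot `[t, t + 1)` from `t` and the coflows released up to time `t` (which also determine all its
earlier decisions). -/
def OnlineAlgorithm : Type := ℕ → Instance → Decision

namespace OnlineAlgorithm

variable (A : OnlineAlgorithm)

/-- The decision for the slot `[t, t + 1)` when `A` is run on `I`. -/
def decisionAt (I : Instance) (t : ℕ) : Decision := A t (I.revealed t)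

open Classical in
/-- The schedule that `A` produces on `I`. -/
def schedule (I : Instance) : I.Schedule := fun j i o s =>
  if 0 ≤ s ∧ ((j : ℕ), (i : ℕ), (o : ℕ)) ∈ A.decisionAt I ⌊s⌋₊ then 1 else 0

/-- `A` always produces a feasible schedule, whose cost is at most `ρ` times that of any feasible
schedule, even one that knows the whole instance in advance. -/
def IsCompetitive (ρ : ℝ) : Prop :=
  ∀ I : Instance, I.Feasible (A.schedule I) ∧
    ∀ x : I.Schedule, I.Feasible x → I.cost (A.schedule I) ≤ ρ * I.cost x

/-- A single program computes the decisions of `A`. Each decision takes a number of steps at most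
exponential in the size of the information available at that time, and the total number of steps
up to a time `T` by which all coflows are completed is at most exponential in the size of the
instance. -/
def RunsInExponentialTime : Prop :=
  ∃ (P : Prog) (c : ℕ), ∀ I : Instance, ∃ steps : ℕ → ℕ,
    (∀ t, Eval P (I.onlineInput t) (A.decisionAt I t).encode (steps t)) ∧
    (∀ t, steps t ≤ 2 ^ (c * (I.onlineInput t).size)) ∧
    ∃ T : ℕ, (∀ j, I.release j ≤ T ∧ I.DoneBy (A.schedule I) j T) ∧
      ∑ t ∈ Finset.range T, steps t ≤ 2 ^ (c * I.encode.size)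

end OnlineAlgorithm

end CoflowScheduling

end

/-! Time is divided into phases `[d, 2d)` with `d = 2^k`. Phase `k` takes a set `B k` of maximum
weight among the sets of coflows that are released by time `d` and put load at most `d` on every
port, and it transfers `B k` in its `d` slots. Coflows completed earlier are not excluded, so `B k`
depends only on `d` and on the coflows released by `d`. Each decision can therefore recompute its
whole phase from the current input.

The `d` slots suffice by König's argument. A bipartite multigraph of maximum degree at most `d` has
a matching that covers all vertices of degree `d` (`exists_matching`: pad to a regular matrix and
apply Hall's theorem). Sending one unit along each edge of the matching leaves loads at most `d -
1`, and the next slot repeats this.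

For the ratio, consider any feasible schedule with completion times `c j`. The coflows with `c j ≤
2^k` are released by `2^k` and load each port by at most `2^k`, because a port handles one unit per
time unit. They are thus admissible in phase `k`, and `B k` weighs at least as much
(`exists_batch`). If `k` is the first phase with `j ∈ B k`, the algorithm completes `j` by
`2^(k+1)`, which is `2` plus the sum of `2^(l+1)` over the phases `l < k`, all of which miss `j`.
After exchanging sums, the condition `j ∉ B l` may be replaced by `c j > 2^l` without decreasing the
weighted total, and then a geometric sum is at most `4 * c j` when `c j ≥ 1` (`sum_weight_mul_le`).
Coflows with some demand satisfy `c j ≥ 1`; those without demand are complete at their release. This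
gives ratio 4, and hence 6.

Sets and matchings are found by exhaustive search with unary arithmetic. Running times are handled
by the calculus `Comp D μ f`, which bounds time and output size polynomially in `μ`. Taking the
input size for `μ` gives polynomial time, and taking `2` to the input size gives exponential time.
If the instance has size `N`, all releases and all port loads are at most `2^N`, so phase `N`
processes everything and the total over all slots before `2^(N+1)` is still exponential. -/

namespace CoflowScheduling

/-! ### Programs on encoded data -/

/-- Types whose elements are represented by binary trees. -/
class Enc (α : Type) where
  enc : α → Data

open Enc (enc)

/-- Numbers in unary. -/
def encodeUnary : ℕ → Data
  | 0 => .nil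
  | n + 1 => .cons .nil (encodeUnary n)

instance : Enc Unit := ⟨fun _ => .nil⟩
instance : Enc Bool := ⟨encodeBool⟩
instance : Enc ℕ := ⟨encodeUnary⟩
instance {α : Type} [Enc α] : Enc (List α) := ⟨encodeList enc⟩
instance {α β : Type} [Enc α] [Enc β] : Enc (α × β) := ⟨fun p => .cons (enc p.1) (enc p.2)⟩

/-! ### Sizes of encodings -/

variable {α β γ δ : Type} [Enc α] [Enc β] [Enc γ] [Enc δ]

/-- The number of nodes of the encoding. -/
def sz (x : α) : ℕ := (enc x).size

theorem Data.size_pos (d : Data) : 0 < d.size := by cases d <;> simp [Data.size]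

theorem sz_pos (x : α) : 0 < sz x := Data.size_pos _

@[simp] theorem sz_pair (p : α × β) : sz p = sz p.1 + sz p.2 + 1 := rfl
@[simp] theorem sz_nil : sz ([] : List α) = 1 := rfl
@[simp] theorem sz_cons (a : α) (l : List α) : sz (a :: l) = sz a + sz l + 1 := rfl
@[simp] theorem sz_nat (n : ℕ) : sz n = 2 * n + 1 := by
  induction n with
  | zero => rfl
  | succ n ih =>
    change 1 + sz n + 1 = _
    omega

theorem sz_bool_le (b : Bool) : sz b ≤ 3 := by cases b <;> decide

theorem sz_append (l₁ l₂ : List α) : sz (l₁ ++ l₂) + 1 = sz l₁ + sz l₂ := by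
  induction l₁ with
  | nil => simp [add_comm]
  | cons a l ih => simp only [List.cons_append, sz_cons]; omega

theorem sz_reverse (l : List α) : sz l.reverse = sz l := by
  induction l with
  | nil => rfl
  | cons a l ih =>
    have := sz_append l.reverse [a]
    simp only [List.reverse_cons, sz_cons, sz_nil] at *
    omega

theorem sz_mem_lt {l : List α} {a : α} (h : a ∈ l) : sz a < sz l := by
  induction l with
  | nil => simp at h
  | cons b l ih =>
    rcases List.mem_cons.1 h with rfl | h
    · simp only [sz_cons]; omega
    · have := ih h
      simp only [sz_cons]; omega

theorem length_lt_sz (l : List α) : l.length < sz l := by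
  induction l with
  | nil => simp
  | cons b l ih => have := sz_pos b; simp only [List.length_cons, sz_cons]; omega

theorem sz_list_le {l : List α} {B : ℕ} (h : ∀ a ∈ l, sz a ≤ B) : sz l ≤ l.length * (B + 1) + 1 := by
  induction l with
  | nil => simp
  | cons b l ih =>
    have h1 := h b (by simp)
    have h2 := ih fun a ha => h a (by simp [ha])
    simp only [List.length_cons, sz_cons, Nat.add_mul]
    omega

theorem sz_prefix_le {l₁ l₂ : List α} (h : l₁ <+: l₂) : sz l₁ ≤ sz l₂ := by
  obtain ⟨r, rfl⟩ := h
  have := sz_append l₁ r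
  have := sz_pos r
  omega

theorem sz_suffix_le {l₁ l₂ : List α} (h : l₁ <:+ l₂) : sz l₁ ≤ sz l₂ := by
  obtain ⟨r, rfl⟩ := h
  have := sz_append r l₁
  have := sz_pos r
  omega

/-- `g` is bounded on `D` by a polynomial in `μ`. -/
def Bdd {α : Type} (D : Set α) (μ g : α → ℕ) : Prop := ∃ k : ℕ, ∀ x ∈ D, g x ≤ (μ x + 2) ^ k

/-! ### Closure properties of polynomial bounds -/

section Bdd

variable {α β : Type} {D : Set α} {μ f g : α → ℕ}

/-- The summand `2` in the definition makes the base at least 2, so that constants, sums and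
products are all absorbed into the exponent. -/
theorem Bdd.const (c : ℕ) : Bdd D μ fun _ => c :=
  ⟨c, fun x _ => (Nat.lt_two_pow_self (n := c)).le.trans (Nat.pow_le_pow_left (by omega) c)⟩

theorem Bdd.mono (hf : Bdd D μ f) (h : ∀ x ∈ D, g x ≤ f x) : Bdd D μ g := by
  obtain ⟨k, hk⟩ := hf
  exact ⟨k, fun x hx => (h x hx).trans (hk x hx)⟩

theorem Bdd.self : Bdd D μ μ := ⟨1, fun x _ => by simp⟩

theorem Bdd.mul (hf : Bdd D μ f) (hg : Bdd D μ g) : Bdd D μ fun x => f x * g x := by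
  obtain ⟨k, hk⟩ := hf
  obtain ⟨l, hl⟩ := hg
  exact ⟨k + l, fun x hx => by rw [pow_add]; exact Nat.mul_le_mul (hk x hx) (hl x hx)⟩

theorem Bdd.add (hf : Bdd D μ f) (hg : Bdd D μ g) : Bdd D μ fun x => f x + g x := by
  obtain ⟨k, hk⟩ := hf
  obtain ⟨l, hl⟩ := hg
  refine ⟨k + l + 1, fun x hx => ?_⟩
  have h1 : (μ x + 2) ^ k ≤ (μ x + 2) ^ (k + l) := Nat.pow_le_pow_right (by omega) (by omega)
  have h2 : (μ x + 2) ^ l ≤ (μ x + 2) ^ (k + l) := Nat.pow_le_pow_right (by omega) (by omega)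
  have h3 : (μ x + 2) ^ (k + l) * 2 ≤ (μ x + 2) ^ (k + l + 1) := by
    rw [pow_succ]; exact Nat.mul_le_mul_left _ (by omega)
  have := hk x hx
  have := hl x hx
  beta_reduce
  omega

theorem Bdd.pow (hf : Bdd D μ f) (n : ℕ) : Bdd D μ fun x => f x ^ n := by
  obtain ⟨k, hk⟩ := hf
  exact ⟨k * n, fun x hx => by rw [pow_mul]; exact Nat.pow_le_pow_left (hk x hx) n⟩

theorem Bdd.comp {E : Set β} {ν g : β → ℕ} {f : α → β} (hg : Bdd E ν g) (hf : ∀ x ∈ D, f x ∈ E)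
    (hν : Bdd D μ fun x => ν (f x)) : Bdd D μ fun x => g (f x) := by
  obtain ⟨k, hk⟩ := hg
  exact ((hν.add (Bdd.const 2)).pow k).mono fun x hx => hk _ (hf x hx)

end Bdd

/-- On inputs from `D`, the function `f` is computed by a program whose running time is bounded by
a polynomial in `μ`, and so is the size of its value. -/
def Comp (D : Set α) (μ : α → ℕ) (f : α → β) : Prop :=
  ∃ (P : Prog) (T : α → ℕ), Bdd D μ T ∧ Bdd D μ (fun x => sz (f x)) ∧
    ∀ x ∈ D, ∃ s ≤ T x, Eval P (enc x) (enc (f x)) s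

/-- Polynomial-time computable functions. -/
def Poly (f : α → β) : Prop := Comp Set.univ sz f

variable {D : Set α} {μ : α → ℕ}

/-! ### Closure of computability under elementary operations -/

namespace Comp

theorem bdd {f : α → β} (hf : Comp D μ f) : Bdd D μ fun x => sz (f x) := hf.choose_spec.choose_spec.2.1

theorem congr {f g : α → β} (hf : Comp D μ f) (h : ∀ x ∈ D, f x = g x) : Comp D μ g := by
  obtain ⟨P, T, hT, hs, hP⟩ := hf
  exact ⟨P, T, hT, hs.mono fun x hx => by rw [h x hx], fun x hx => by
    rw [← h x hx]; exact hP x hx⟩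

/-- Values of different types with the same tree are interchangeable at no cost: a nonempty list is
a pair, and a unary number is a list of units. -/
theorem recode {f : α → β} {g : α → γ} (hf : Comp D μ f) (h : ∀ x ∈ D, enc (f x) = enc (g x)) :
    Comp D μ g := by
  obtain ⟨P, T, hT, hs, hP⟩ := hf
  exact ⟨P, T, hT, hs.mono fun x hx => by simp only [sz, h x hx, le_refl], fun x hx => by
    rw [← h x hx]; exact hP x hx⟩

theorem mono_dom {E : Set α} {f : α → β} (hf : Comp D μ f) (h : E ⊆ D) : Comp E μ f := by
  obtain ⟨P, T, ⟨k, hk⟩, ⟨l, hl⟩, hP⟩ := hf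
  exact ⟨P, T, ⟨k, fun x hx => hk x (h hx)⟩, ⟨l, fun x hx => hl x (h hx)⟩, fun x hx => hP x (h hx)⟩

/-- Since `Comp` also bounds output sizes and `μ` is arbitrary, even the identity needs a size
bound. Computability of the identity serves as access to the input: its projections act as the
variables of a program. -/
theorem id_of_bdd (h : Bdd D μ sz) : Comp D μ (fun x => x) :=
  ⟨.skip, fun _ => 1, Bdd.const 1, h, fun _ _ => ⟨1, le_rfl, .skip _⟩⟩

theorem comp {E : Set β} {ν : β → ℕ} {g : β → γ} {f : α → β} (hg : Comp E ν g) (hf : Comp D μ f)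
    (h : ∀ x ∈ D, f x ∈ E) (hν : Bdd D μ fun x => ν (f x)) : Comp D μ fun x => g (f x) := by
  obtain ⟨P, T, hT, hs, hP⟩ := hg
  obtain ⟨Q, S, hS, -, hQ⟩ := hf
  refine ⟨.seq Q P, fun x => S x + T (f x) + 1, (hS.add (hT.comp h hν)).add (Bdd.const 1),
    hs.comp h hν, fun x hx => ?_⟩
  obtain ⟨s, h1, h2⟩ := hQ x hx
  obtain ⟨t, h3, h4⟩ := hP _ (h x hx)
  exact ⟨s + t + 1, by beta_reduce; omega, .seq h2 h4⟩

/-- Composition works because `Comp` includes a bound on the size of `f x`, the quantity that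
governs the running time of `g`. -/
theorem poly {g : β → γ} {f : α → β} (hf : Comp D μ f) (hg : Poly g) : Comp D μ fun x => g (f x) :=
  hg.comp hf (fun _ _ => Set.mem_univ _) hf.bdd

theorem pair {f : α → β} {g : α → γ} (hf : Comp D μ f) (hg : Comp D μ g) :
    Comp D μ fun x => (f x, g x) := by
  have hb := (hf.bdd.add hg.bdd).add (Bdd.const 1)
  obtain ⟨P, T, hT, -, hP⟩ := hf
  obtain ⟨Q, S, hS, -, hQ⟩ := hg
  refine ⟨.cons P Q, fun x => T x + S x + 1, (hT.add hS).add (Bdd.const 1), hb, fun x hx => ?_⟩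
  obtain ⟨s, h1, h2⟩ := hP x hx
  obtain ⟨t, h3, h4⟩ := hQ x hx
  exact ⟨s + t + 1, by beta_reduce; omega, .cons h2 h4⟩

theorem poly₂ {g : β → γ → δ} {f₁ : α → β} {f₂ : α → γ} (hg : Poly fun p : β × γ => g p.1 p.2)
    (h₁ : Comp D μ f₁) (h₂ : Comp D μ f₂) : Comp D μ fun x => g (f₁ x) (f₂ x) :=
  (h₁.pair h₂).poly hg

theorem fst {f : α → β × γ} (hf : Comp D μ f) : Comp D μ fun x => (f x).1 := by
  have hb := hf.bdd
  obtain ⟨P, T, hT, -, hP⟩ := hf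
  refine ⟨.seq P .hd, fun x => T x + 2, hT.add (Bdd.const 2), hb.mono fun x _ => ?_, fun x hx => ?_⟩
  · simp only [sz_pair]; omega
  · obtain ⟨s, h1, h2⟩ := hP x hx
    exact ⟨s + 1 + 1, by beta_reduce; omega, .seq h2 (.hd_cons _ _)⟩

theorem snd {f : α → β × γ} (hf : Comp D μ f) : Comp D μ fun x => (f x).2 := by
  have hb := hf.bdd
  obtain ⟨P, T, hT, -, hP⟩ := hf
  refine ⟨.seq P .tl, fun x => T x + 2, hT.add (Bdd.const 2), hb.mono fun x _ => ?_, fun x hx => ?_⟩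
  · simp only [sz_pair]; omega
  · obtain ⟨s, h1, h2⟩ := hP x hx
    exact ⟨s + 1 + 1, by beta_reduce; omega, .seq h2 (.tl_cons _ _)⟩

theorem const (c : β) : Comp D μ fun _ => c := by
  have key : ∀ d : Data, ∃ P s, ∀ a, Eval P a d s := by
    intro d
    induction d with
    | nil => exact ⟨.nil, 1, fun a => .nil a⟩
    | cons u v hu hv =>
      obtain ⟨P, s, hP⟩ := hu
      obtain ⟨Q, t, hQ⟩ := hv
      exact ⟨.cons P Q, s + t + 1, fun a => .cons (hP a) (hQ a)⟩
  obtain ⟨P, s, hP⟩ := key (enc c)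
  exact ⟨P, fun _ => s, Bdd.const s, Bdd.const _, fun x _ => ⟨s, le_rfl, hP _⟩⟩

theorem ite {c : α → Bool} {f g : α → β} (hc : Comp D μ c) (hf : Comp D μ f) (hg : Comp D μ g) :
    Comp D μ fun x => if c x = true then f x else g x := by
  have hb := hf.bdd.add hg.bdd
  obtain ⟨R, U, hU, -, hR⟩ := hc
  obtain ⟨P, T, hT, -, hP⟩ := hf
  obtain ⟨Q, S, hS, -, hQ⟩ := hg
  refine ⟨.ite R P Q, fun x => U x + (T x + S x) + 1, (hU.add (hT.add hS)).add (Bdd.const 1),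
    hb.mono fun x _ => by beta_reduce; split <;> omega, fun x hx => ?_⟩
  obtain ⟨u, h1, h2⟩ := hR x hx
  cases hcx : c x
  · obtain ⟨t, h3, h4⟩ := hQ x hx
    rw [hcx] at h2
    exact ⟨u + t + 1, by beta_reduce; omega, by
      beta_reduce; rw [hcx]; exact Eval.ite_false h2 h4⟩
  · obtain ⟨t, h3, h4⟩ := hP x hx
    rw [hcx] at h2
    exact ⟨u + t + 1, by beta_reduce; omega, by
      beta_reduce; rw [hcx]; exact Eval.ite_true h2 h4⟩

theorem cons {f : α → β} {g : α → List β} (hf : Comp D μ f) (hg : Comp D μ g) :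
    Comp D μ fun x => f x :: g x :=
  (hf.pair hg).recode fun _ _ => rfl

theorem succ {f : α → ℕ} (hf : Comp D μ f) : Comp D μ fun x => f x + 1 :=
  ((const ()).pair hf).recode fun _ _ => rfl

/-- A number as a list, to iterate over. -/
theorem ticks {f : α → ℕ} (hf : Comp D μ f) : Comp D μ fun x => List.replicate (f x) () := by
  refine hf.recode fun x _ => ?_
  generalize f x = n
  induction n with
  | zero => rfl
  | succ n ih => rw [List.replicate_succ]; exact congrArg (Data.cons .nil) ih

theorem pred {f : α → ℕ} (hf : Comp D μ f) : Comp D μ fun x => f x - 1 := by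
  have hb := hf.bdd
  obtain ⟨P, T, hT, -, hP⟩ := hf
  refine ⟨.seq P .tl, fun x => T x + 2, hT.add (Bdd.const 2), hb.mono fun x _ => ?_, fun x hx => ?_⟩
  · simp only [sz_nat]; omega
  · obtain ⟨s, h1, h2⟩ := hP x hx
    refine ⟨s + 1 + 1, by beta_reduce; omega, .seq h2 ?_⟩
    beta_reduce
    cases f x with
    | zero => exact .tl_nil
    | succ n => exact .tl_cons _ _

theorem tail {f : α → List β} (hf : Comp D μ f) : Comp D μ fun x => (f x).tail := by
  have hb := hf.bdd
  obtain ⟨P, T, hT, -, hP⟩ := hf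
  refine ⟨.seq P .tl, fun x => T x + 2, hT.add (Bdd.const 2), hb.mono fun x _ => ?_, fun x hx => ?_⟩
  · exact sz_suffix_le (List.tail_suffix _)
  · obtain ⟨s, h1, h2⟩ := hP x hx
    refine ⟨s + 1 + 1, by beta_reduce; omega, .seq h2 ?_⟩
    beta_reduce
    cases f x with
    | nil => exact .tl_nil
    | cons a l => exact .tl_cons _ _

theorem isZero {f : α → ℕ} (hf : Comp D μ f) : Comp D μ fun x => decide (f x = 0) := by
  obtain ⟨P, T, hT, -, hP⟩ := hf
  refine ⟨.seq P (.ite .skip .nil (.cons .nil .nil)), fun x => T x + 6, hT.add (Bdd.const 6),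
    (Bdd.const 3).mono fun x _ => sz_bool_le _, fun x hx => ?_⟩
  obtain ⟨s, h1, h2⟩ := hP x hx
  beta_reduce
  cases hn : f x with
  | zero =>
    rw [hn] at h2
    exact ⟨s + (1 + (1 + 1 + 1) + 1) + 1, by omega,
      .seq h2 (.ite_false (.skip _) (.cons (.nil _) (.nil _)))⟩
  | succ n =>
    rw [hn] at h2
    exact ⟨s + (1 + 1 + 1) + 1, by omega, .seq h2 (.ite_true (.skip _) (.nil _))⟩

theorem and {f g : α → Bool} (hf : Comp D μ f) (hg : Comp D μ g) : Comp D μ fun x => f x && g x :=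
  (hf.ite hg (const false)).congr fun x _ => by cases f x <;> simp

/-! ### Loops over lists -/

section foldl

variable {init : α → γ} {l : α → List β} {step : α → γ → β → γ}

/-- The loop runs on trees `(accumulator, (rest of the list, x))`, and `x` is kept because the step
may use it. The bound `B` cannot be dropped: iterating a polynomial step may blow up the
accumulator. The step is needed only at accumulators that occur, and `hstep` supplies the identity
on triples `(x, accumulator, element)`, so that callers can refer to all three by projections. -/
theorem foldl (hid : Comp D μ fun x => x) (hinit : Comp D μ init) (hl : Comp D μ l) {B : α → ℕ}
    (hB : Bdd D μ B)
    (hacc : ∀ x ∈ D, ∀ l₁, l₁ <+: l x → sz (l₁.foldl (step x) (init x)) ≤ B x)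
    (hstep : Comp {p : α × γ × β | p.1 ∈ D ∧ p.2.2 ∈ l p.1 ∧
        ∃ l₁, l₁ <+: l p.1 ∧ p.2.1 = l₁.foldl (step p.1) (init p.1)} (fun p => μ p.1) (fun p => p) →
      Comp {p : α × γ × β | p.1 ∈ D ∧ p.2.2 ∈ l p.1 ∧
        ∃ l₁, l₁ <+: l p.1 ∧ p.2.1 = l₁.foldl (step p.1) (init p.1)} (fun p => μ p.1)
        fun p => step p.1 p.2.1 p.2.2) :
    Comp D μ fun x => (l x).foldl (step x) (init x) := by
  have hlen : Bdd D μ fun x => (l x).length := hl.bdd.mono fun x _ => (length_lt_sz _).le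
  have hsize := hid.bdd
  have hlsize := hl.bdd
  -- The triples have bounded size: the accumulator by `B`, the element by the list that contains
  -- it.
  replace hstep := hstep <| id_of_bdd <| by
    have h : Bdd D μ fun x => sz x + (B x + sz (l x) + 1) + 1 :=
      (hsize.add ((hB.add hlsize).add (Bdd.const 1))).add (Bdd.const 1)
    obtain ⟨k, hk⟩ := h
    refine ⟨k, ?_⟩
    rintro ⟨x, c, b⟩ ⟨h1, h2, l₁, h3, h4⟩
    refine le_trans ?_ (hk x h1)
    have h5 := hacc x h1 l₁ h3
    have h6 := sz_mem_lt h2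
    simp only at h4 h6
    rw [← h4] at h5
    simp only [sz_pair]
    omega
  obtain ⟨P, T, hT, -, hP⟩ := hinit
  obtain ⟨Q, S, hS, -, hQ⟩ := hl
  obtain ⟨R, U, ⟨k, hU⟩, -, hR⟩ := hstep
  -- From `(acc, ((b, rest), x))` the first component rebuilds the input `(x, (acc, b))` of the step
  -- and runs `R`; the second keeps `(rest, x)`.
  let body : Prog := .cons (.seq (.cons (.seq .tl .tl) (.cons .hd (.seq .tl (.seq .hd .hd)))) R)
    (.cons (.seq .tl (.seq .hd .tl)) (.seq .tl .tl))
  have hloop : ∀ x ∈ D, ∀ l₂ l₁, l₁ ++ l₂ = l x → ∃ s ≤ l₂.length * ((μ x + 2) ^ k + 30) + 4,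
      Eval (.loop (.seq .tl .hd) body)
        (.cons (enc (l₁.foldl (step x) (init x))) (.cons (enc l₂) (enc x)))
        (.cons (enc ((l x).foldl (step x) (init x))) (.cons .nil (enc x))) s := by
    intro x hx l₂
    induction l₂ with
    | nil =>
      intro l₁ h
      rw [List.append_nil] at h
      rw [h]
      refine ⟨1 + 1 + 1 + 1, by omega, ?_⟩
      constructor
      exact .seq (.tl_cons _ _) (.hd_cons _ _)
    | cons b l₂ ih =>
      intro l₁ h
      obtain ⟨r, hr, hr'⟩ := ih (l₁ ++ [b]) (by simpa using h)
      have hb : (x, l₁.foldl (step x) (init x), b) ∈ {p : α × γ × β | p.1 ∈ D ∧ p.2.2 ∈ l p.1 ∧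
          ∃ l₁, l₁ <+: l p.1 ∧ p.2.1 = l₁.foldl (step p.1) (init p.1)} :=
        ⟨hx, by simp [← h], l₁, ⟨_, h⟩, rfl⟩
      obtain ⟨s, hs, hs'⟩ := hR _ hb
      have := hU _ hb
      simp only at this
      rw [List.foldl_append] at hr'
      have h1 : ∃ s ≤ 11, ∀ u v w y : Data, Eval (.cons (.seq .tl .tl) (.cons .hd (.seq .tl
          (.seq .hd .hd)))) (.cons u (.cons (.cons v w) y)) (.cons y (.cons u v)) s := by
        refine ⟨_, ?_, fun _ _ _ _ => .cons (.seq (.tl_cons _ _) (.tl_cons _ _))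
          (.cons (.hd_cons _ _) (.seq (.tl_cons _ _) (.seq (.hd_cons _ _) (.hd_cons _ _))))⟩
        norm_num
      have h2 : ∃ s ≤ 9, ∀ u v w y : Data, Eval (.cons (.seq .tl (.seq .hd .tl)) (.seq .tl .tl))
          (.cons u (.cons (.cons v w) y)) (.cons w y) s := by
        refine ⟨_, ?_, fun _ _ _ _ => .cons (.seq (.tl_cons _ _) (.seq (.hd_cons _ _)
          (.tl_cons _ _))) (.seq (.tl_cons _ _) (.tl_cons _ _))⟩
        norm_num
      obtain ⟨u, hu, h1⟩ := h1
      obtain ⟨v, hv, h2⟩ := h2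
      refine ⟨(1 + 1 + 1) + ((u + s + 1) + v + 1) + r + 1, ?_, .loop_step
        (.seq (.tl_cons _ _) (.hd_cons _ _)) (.cons (.seq (h1 _ _ _ _) hs') (h2 _ _ _ _)) hr'⟩
      simp only [List.length_cons, Nat.add_mul] at *
      omega
  have hpow : Bdd D μ fun x => (μ x + 2) ^ k := (Bdd.self.add (Bdd.const 2)).pow k
  refine ⟨.seq (.cons P (.cons Q .skip)) (.seq (.loop (.seq .tl .hd) body) .hd),
    fun x => T x + S x + (l x).length * ((μ x + 2) ^ k + 30) + 20,
    ((hT.add hS).add (hlen.mul (hpow.add (Bdd.const 30)))).add (Bdd.const 20),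
    hB.mono fun x hx => hacc x hx _ (List.prefix_refl _), fun x hx => ?_⟩
  obtain ⟨s, hs, hs'⟩ := hP x hx
  obtain ⟨t, ht, ht'⟩ := hQ x hx
  obtain ⟨r, hr, hr'⟩ := hloop x hx (l x) [] rfl
  exact ⟨(s + (t + 1 + 1) + 1) + (r + 1 + 1) + 1, by beta_reduce; omega,
    .seq (.cons hs' (.cons ht' (.skip _))) (.seq hr' (.hd_cons _ _))⟩

/-- Describes the accumulators by an invariant instead of by reachability. This is convenient when
the cost of the step itself depends on a property of the accumulator. -/
theorem foldl_inv (hid : Comp D μ fun x => x) (hinit : Comp D μ init) (hl : Comp D μ l)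
    (Inv : α → γ → Prop) {B : α → ℕ} (hB : Bdd D μ B) (hsz : ∀ x ∈ D, ∀ c, Inv x c → sz c ≤ B x)
    (h0 : ∀ x ∈ D, Inv x (init x))
    (hs : ∀ x ∈ D, ∀ c, Inv x c → ∀ b ∈ l x, Inv x (step x c b))
    (hstep : Comp {p : α × γ × β | p.1 ∈ D ∧ Inv p.1 p.2.1 ∧ p.2.2 ∈ l p.1} (fun p => μ p.1)
        (fun p => p) →
      Comp {p : α × γ × β | p.1 ∈ D ∧ Inv p.1 p.2.1 ∧ p.2.2 ∈ l p.1} (fun p => μ p.1)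
        fun p => step p.1 p.2.1 p.2.2) :
    Comp D μ fun x => (l x).foldl (step x) (init x) := by
  have inv : ∀ x ∈ D, ∀ l₁ : List β, (∀ b ∈ l₁, b ∈ l x) → ∀ c, Inv x c → Inv x (l₁.foldl (step x) c) := by
    intro x hx l₁
    induction l₁ with
    | nil => exact fun _ c hc => hc
    | cons b l₁ ih =>
      intro h c hc
      exact ih (fun b hb => h b (by simp [hb])) _ (hs x hx c hc b (h b (by simp)))
  have inv' : ∀ x ∈ D, ∀ l₁ : List β, l₁ <+: l x →
      Inv x (l₁.foldl (step x) (init x)) := fun x hx l₁ h =>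
    inv x hx l₁ (fun b hb => h.subset hb) _ (h0 x hx)
  refine foldl hid hinit hl hB (fun x hx l₁ h => hsz x hx _ (inv' x hx l₁ h)) fun _ => ?_
  refine (hstep (id_of_bdd ?_)).mono_dom ?_
  · obtain ⟨k, hk⟩ := (hid.bdd.add ((hB.add hl.bdd).add (Bdd.const 1))).add (Bdd.const 1)
    refine ⟨k, ?_⟩
    rintro ⟨x, c, b⟩ ⟨h1, h2, h3⟩
    refine le_trans ?_ (hk x h1)
    have h5 := hsz x h1 _ h2
    have h6 := sz_mem_lt h3
    simp only at h6 h5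
    simp only [sz_pair]
    omega
  · rintro ⟨x, c, b⟩ ⟨h1, h2, l₁, h3, h4⟩
    exact ⟨h1, by simp only at h4; rw [h4]; exact inv' x h1 l₁ h3, h2⟩

end foldl

end Comp

end CoflowScheduling

/-! ### Computable list operations -/

namespace CoflowScheduling

open Enc (enc)

variable {α β γ δ : Type} [Enc α] [Enc β] [Enc γ] [Enc δ] {D : Set α} {μ : α → ℕ}

theorem Poly.id : Poly fun x : α => x := Comp.id_of_bdd Bdd.self

/-- Weakening: a function of the outer input stays available inside the body of a loop. -/
theorem Comp.lift {E : Set (α × β)} {f : α → γ} (hf : Comp D μ f)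
    (hid : Comp E (fun p => μ p.1) fun p => p) (h : ∀ p ∈ E, p.1 ∈ D) :
    Comp E (fun p => μ p.1) fun p => f p.1 :=
  hf.comp hid.fst h Bdd.self

theorem Poly.reverse : Poly fun l : List β => l.reverse := by
  have key : ∀ l : List β, l.foldl (fun acc b => b :: acc) [] = l.reverse := fun l => by simp
  refine Comp.congr (Comp.foldl (init := fun _ => []) (l := fun l : List β => l)
    (step := fun _ acc b => b :: acc) Poly.id (.const _) Poly.id (B := fun l => sz l) Bdd.self ?_ ?_)
    fun l _ => key l
  · intro l _ l₁ h
    rw [key, sz_reverse]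
    exact sz_prefix_le h
  · intro hid
    exact hid.snd.snd.cons hid.snd.fst

theorem Poly.append : Poly fun p : List β × List β => p.1 ++ p.2 := by
  have key : ∀ l l' : List β, l.foldl (fun acc b => b :: acc) l' = l.reverse ++ l' :=
    fun l l' => by simp
  refine Comp.congr (Comp.foldl (init := fun p : List β × List β => p.2) (l := fun p => p.1.reverse)
    (step := fun _ acc b => b :: acc) Poly.id Poly.id.snd (Poly.id.fst.poly Poly.reverse)
    (B := fun p => sz p) Bdd.self ?_ ?_) fun p _ => ?_
  · intro p _ l₁ h
    have h1 := sz_append l₁.reverse p.2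
    have h2 := sz_prefix_le h
    rw [sz_reverse] at h1 h2
    rw [key, sz_pair]
    omega
  · intro hid
    exact hid.snd.snd.cons hid.snd.fst
  · rw [key, List.reverse_reverse]

namespace Comp

theorem append {f g : α → List β} (hf : Comp D μ f) (hg : Comp D μ g) :
    Comp D μ fun x => f x ++ g x := poly₂ Poly.append hf hg

/-- A right fold is a left fold over the reversed list; suffixes of the list turn into prefixes of
its reverse. -/
theorem foldr {init : α → γ} {l : α → List β} {step : α → β → γ → γ} (hid : Comp D μ fun x => x)
    (hinit : Comp D μ init) (hl : Comp D μ l) {B : α → ℕ} (hB : Bdd D μ B)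
    (hacc : ∀ x ∈ D, ∀ l₁, l₁ <:+ l x → sz (l₁.foldr (step x) (init x)) ≤ B x)
    (hstep : Comp {p : α × γ × β | p.1 ∈ D ∧ p.2.2 ∈ l p.1 ∧
        ∃ l₁, l₁ <:+ l p.1 ∧ p.2.1 = l₁.foldr (step p.1) (init p.1)} (fun p => μ p.1) (fun p => p) →
      Comp {p : α × γ × β | p.1 ∈ D ∧ p.2.2 ∈ l p.1 ∧
        ∃ l₁, l₁ <:+ l p.1 ∧ p.2.1 = l₁.foldr (step p.1) (init p.1)} (fun p => μ p.1)
        fun p => step p.1 p.2.2 p.2.1) :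
    Comp D μ fun x => (l x).foldr (step x) (init x) := by
  have hdom : {p : α × γ × β | p.1 ∈ D ∧ p.2.2 ∈ (l p.1).reverse ∧ ∃ l₁ : List β,
      l₁ <+: (l p.1).reverse ∧ p.2.1 = l₁.foldl (fun c b => step p.1 b c) (init p.1)} =
      {p : α × γ × β | p.1 ∈ D ∧ p.2.2 ∈ l p.1 ∧
        ∃ l₁, l₁ <:+ l p.1 ∧ p.2.1 = l₁.foldr (step p.1) (init p.1)} := by
    ext p
    simp only [Set.mem_ofPred_eq, List.mem_reverse]
    refine and_congr_right fun _ => and_congr_right fun _ => ⟨?_, ?_⟩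
    · rintro ⟨l₁, h1, h2⟩
      exact ⟨l₁.reverse, by rw [← List.reverse_prefix, List.reverse_reverse]; exact h1, by
        rw [h2, List.foldr_reverse]⟩
    · rintro ⟨l₁, h1, h2⟩
      exact ⟨l₁.reverse, List.reverse_prefix.2 h1, by rw [h2, List.foldl_reverse]⟩
  refine (foldl (init := init) (l := fun x => (l x).reverse) (step := fun x c b => step x b c) hid
    hinit (hl.poly Poly.reverse) hB (fun x hx l₁ h => ?_) ?_).congr fun x _ => List.foldl_reverse
  · have := hacc x hx l₁.reverse (by rw [← List.reverse_prefix, List.reverse_reverse]; exact h)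
    rwa [List.foldr_reverse] at this
  · rw [hdom]
    exact hstep

theorem id_mem {l : α → List β} (hid : Comp D μ fun x => x) (hl : Comp D μ l) :
    Comp {p : α × β | p.1 ∈ D ∧ p.2 ∈ l p.1} (fun p => μ p.1) fun p => p := by
  refine id_of_bdd ?_
  obtain ⟨k, hk⟩ := (hid.bdd.add hl.bdd).add (Bdd.const 1)
  refine ⟨k, fun p hp => le_trans ?_ (hk p.1 hp.1)⟩
  have := sz_mem_lt hp.2
  rw [sz_pair]
  beta_reduce
  omega

theorem flatMap {l : α → List β} {g : α → β → List γ} (hid : Comp D μ fun x => x) (hl : Comp D μ l)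
    (hg : Comp {p : α × β | p.1 ∈ D ∧ p.2 ∈ l p.1} (fun p => μ p.1) (fun p => p) →
      Comp {p : α × β | p.1 ∈ D ∧ p.2 ∈ l p.1} (fun p => μ p.1) fun p => g p.1 p.2) :
    Comp D μ fun x => (l x).flatMap (g x) := by
  replace hg := hg (id_mem hid hl)
  obtain ⟨k, hk⟩ := hg.bdd
  have hB : Bdd D μ fun x => sz (l x) * (μ x + 2) ^ k + 1 :=
    (hl.bdd.mul ((Bdd.self.add (Bdd.const 2)).pow k)).add (Bdd.const 1)
  have key : ∀ (x : α) (l : List β), l.foldr (fun b acc => g x b ++ acc) [] = l.flatMap (g x) := by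
    intro x l
    induction l with
    | nil => rfl
    | cons b l ih => rw [List.foldr_cons, ih, List.flatMap_cons]
  have key2 : ∀ (x : α) (M : ℕ) (l : List β), (∀ b ∈ l, sz (g x b) ≤ M) →
      sz (l.flatMap (g x)) ≤ l.length * M + 1 := by
    intro x M l
    induction l with
    | nil => simp
    | cons b l ih =>
      intro h
      have h1 := sz_append (g x b) (l.flatMap (g x))
      have h2 := h b (by simp)
      have h3 := ih fun b hb => h b (by simp [hb])
      rw [List.flatMap_cons, List.length_cons, Nat.add_mul]
      omega
  refine (foldr (init := fun _ => []) (l := l) (step := fun x b acc => g x b ++ acc) hid (const [])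
    hl hB (fun x hx l₁ h => ?_) fun hid' => ?_).congr fun x _ => key x _
  · rw [key]
    refine (key2 x ((μ x + 2) ^ k) l₁ fun b hb => hk (x, b) ⟨hx, h.subset hb⟩).trans ?_
    have := (h.length_le.trans (length_lt_sz (l x)).le)
    exact Nat.add_le_add_right (Nat.mul_le_mul_right _ this) 1
  · refine append ?_ hid'.snd.fst
    exact hg.comp (hid'.fst.pair hid'.snd.snd) (fun p hp => ⟨hp.1, hp.2.1⟩) Bdd.self

theorem map {l : α → List β} {g : α → β → γ} (hid : Comp D μ fun x => x) (hl : Comp D μ l)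
    (hg : Comp {p : α × β | p.1 ∈ D ∧ p.2 ∈ l p.1} (fun p => μ p.1) (fun p => p) →
      Comp {p : α × β | p.1 ∈ D ∧ p.2 ∈ l p.1} (fun p => μ p.1) fun p => g p.1 p.2) :
    Comp D μ fun x => (l x).map (g x) :=
  (flatMap (g := fun x b => [g x b]) hid hl fun h => (hg h).cons (const [])).congr fun x _ => by
    rw [← List.map_eq_flatMap]

theorem all {l : α → List β} {g : α → β → Bool} (hid : Comp D μ fun x => x) (hl : Comp D μ l)
    (hg : Comp {p : α × β | p.1 ∈ D ∧ p.2 ∈ l p.1} (fun p => μ p.1) (fun p => p) →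
      Comp {p : α × β | p.1 ∈ D ∧ p.2 ∈ l p.1} (fun p => μ p.1) fun p => g p.1 p.2) :
    Comp D μ fun x => (l x).all (g x) := by
  replace hg := hg (id_mem hid hl)
  refine (foldr (init := fun _ => true) (l := l) (step := fun x b acc => g x b && acc) hid
    (const true) hl (Bdd.const 3) (fun x _ l₁ _ => sz_bool_le _) fun hid' => ?_).congr fun x _ => ?_
  · refine and ?_ hid'.snd.fst
    exact hg.comp (hid'.fst.pair hid'.snd.snd) (fun p hp => ⟨hp.1, hp.2.1⟩) Bdd.self
  · induction l x with
    | nil => rfl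
    | cons b l ih => rw [List.foldr_cons, ih, List.all_cons]

end Comp

/-! ### Arithmetic in unary -/

theorem foldl_ticks {β : Type} {f : β → β} (n : ℕ) (b : β) :
    (List.replicate n ()).foldl (fun c _ => f c) b = f^[n] b := by
  induction n generalizing b with
  | zero => rfl
  | succ n ih => rw [List.replicate_succ, List.foldl_cons, ih, Function.iterate_succ_apply]

theorem Poly.add : Poly fun p : ℕ × ℕ => p.1 + p.2 := by
  have key : ∀ (l : List Unit) (n : ℕ), l.foldl (fun acc _ => acc + 1) n = n + l.length := by
    intro l
    induction l with
    | nil => simp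
    | cons b l ih => intro n; rw [List.foldl_cons, ih, List.length_cons]; omega
  refine Comp.congr (Comp.foldl (init := fun p : ℕ × ℕ => p.1)
    (l := fun p => List.replicate p.2 ()) (step := fun _ acc _ => acc + 1) Poly.id Poly.id.fst
    Poly.id.snd.ticks (B := fun p => sz p) Bdd.self ?_ ?_) fun p _ => ?_
  · intro p _ l₁ h
    have := h.length_le
    rw [List.length_replicate] at this
    rw [key]
    simp only [sz_pair, sz_nat]
    omega
  · exact fun hid => hid.snd.fst.succ
  · rw [key, List.length_replicate]

theorem Poly.sub : Poly fun p : ℕ × ℕ => p.1 - p.2 := by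
  have key : ∀ (l : List Unit) (n : ℕ), l.foldl (fun acc _ => acc - 1) n = n - l.length := by
    intro l
    induction l with
    | nil => simp
    | cons b l ih => intro n; rw [List.foldl_cons, ih, List.length_cons]; omega
  refine Comp.congr (Comp.foldl (init := fun p : ℕ × ℕ => p.1)
    (l := fun p => List.replicate p.2 ()) (step := fun _ acc _ => acc - 1) Poly.id Poly.id.fst
    Poly.id.snd.ticks (B := fun p => sz p) Bdd.self ?_ ?_) fun p _ => ?_
  · intro p _ l₁ h
    rw [key]
    simp only [sz_pair, sz_nat]
    omega
  · exact fun hid => hid.snd.fst.pred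
  · rw [key, List.length_replicate]

namespace Comp

variable {f g : α → ℕ}

theorem add (hf : Comp D μ f) (hg : Comp D μ g) : Comp D μ fun x => f x + g x :=
  poly₂ Poly.add hf hg

theorem sub (hf : Comp D μ f) (hg : Comp D μ g) : Comp D μ fun x => f x - g x :=
  poly₂ Poly.sub hf hg

theorem le (hf : Comp D μ f) (hg : Comp D μ g) : Comp D μ fun x => decide (f x ≤ g x) :=
  (hf.sub hg).isZero.congr fun x _ => by simp only [Nat.sub_eq_zero_iff_le]

theorem eq (hf : Comp D μ f) (hg : Comp D μ g) : Comp D μ fun x => decide (f x = g x) :=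
  ((hf.le hg).and (hg.le hf)).congr fun x _ => by
    rw [← Bool.decide_and]; simp only [le_antisymm_iff]

end Comp

theorem Poly.mul : Poly fun p : ℕ × ℕ => p.1 * p.2 := by
  have key : ∀ (m : ℕ) (l : List Unit) (n : ℕ),
      l.foldl (fun acc _ => acc + m) n = n + m * l.length := by
    intro m l
    induction l with
    | nil => simp
    | cons b l ih => intro n; rw [List.foldl_cons, ih, List.length_cons]; ring
  refine Comp.congr (Comp.foldl (init := fun p : ℕ × ℕ => 0)
    (l := fun p => List.replicate p.2 ()) (step := fun p acc _ => acc + p.1) Poly.id (.const 0)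
    Poly.id.snd.ticks (B := fun p => 2 * (sz p * sz p) + 1)
    (((Bdd.const 2).mul (Bdd.self.mul Bdd.self)).add (Bdd.const 1)) ?_ ?_) fun p _ => ?_
  · intro p _ l₁ h
    have := h.length_le
    rw [List.length_replicate] at this
    rw [key, zero_add]
    simp only [sz_pair, sz_nat]
    have : p.1 * l₁.length ≤ (2 * p.1 + 1 + (2 * p.2 + 1) + 1) * (2 * p.1 + 1 + (2 * p.2 + 1) + 1) :=
      Nat.mul_le_mul (by omega) (by omega)
    omega
  · exact fun hid => hid.snd.fst.add hid.fst.fst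
  · rw [key, List.length_replicate, zero_add]

theorem Comp.mul {f g : α → ℕ} (hf : Comp D μ f) (hg : Comp D μ g) : Comp D μ fun x => f x * g x :=
  poly₂ Poly.mul hf hg

theorem two_mul_sum_lt_sz (l : List ℕ) : 2 * l.sum < sz l := by
  induction l with
  | nil => simp
  | cons b l ih => simp only [List.sum_cons, sz_cons, sz_nat]; omega

theorem Poly.sum : Poly fun l : List ℕ => l.sum := by
  refine Comp.foldr (init := fun _ => 0) (l := fun l : List ℕ => l) (step := fun _ b acc => b + acc)
    Poly.id (.const 0) Poly.id (B := fun l => sz l) Bdd.self ?_ ?_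
  · intro l _ l₁ h
    have h1 := two_mul_sum_lt_sz l₁
    have h2 := sz_suffix_le h
    have h3 : l₁.foldr (fun b acc => b + acc) 0 = l₁.sum := rfl
    rw [h3, sz_nat]
    omega
  · exact fun hid => hid.snd.snd.add hid.snd.fst

theorem Poly.length : Poly fun l : List β => l.length := by
  have key : ∀ l : List β, l.foldr (fun _ acc => acc + 1) 0 = l.length := by
    intro l
    induction l with
    | nil => rfl
    | cons b l ih => rw [List.foldr_cons, ih, List.length_cons]
  refine Comp.congr (Comp.foldr (init := fun _ => 0) (l := fun l : List β => l)
    (step := fun _ _ acc => acc + 1) Poly.id (.const 0) Poly.id (B := fun l => 2 * sz l + 1)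
    (((Bdd.const 2).mul Bdd.self).add (Bdd.const 1)) ?_ ?_) fun l _ => key l
  · intro l _ l₁ h
    have := h.length_le
    have := length_lt_sz l
    rw [key, sz_nat]
    omega
  · exact fun hid => hid.snd.fst.succ

/-! ### Binary numbers -/

/-- The value of a list of binary digits, least significant first. -/
def ofBits (l : List Bool) : ℕ := l.foldr (fun b acc => acc + acc + if b = true then 1 else 0) 0

theorem ofBits_cons (b : Bool) (l : List Bool) :
    ofBits (b :: l) = ofBits l + ofBits l + if b = true then 1 else 0 := rfl

theorem ofBits_bits (n : ℕ) : ofBits n.bits = n := by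
  induction n using Nat.strongRecOn with
  | ind n ih =>
    rcases Nat.even_or_odd' n with ⟨k, rfl | rfl⟩
    · rcases Nat.eq_zero_or_pos k with rfl | hk
      · simp [ofBits]
      · rw [Nat.bit0_bits k (by omega), ofBits_cons, ih k (by omega)]
        simp; omega
    · rw [Nat.bit1_bits k, ofBits_cons, ih k (by omega)]
      simp; omega

theorem ofBits_lt (l : List Bool) : ofBits l < 2 ^ l.length := by
  induction l with
  | nil => simp [ofBits]
  | cons b l ih =>
    rw [ofBits_cons, List.length_cons, pow_succ]
    split <;> omega

/-- Passing from binary to unary takes exponential space, which is why `hB` asks that `μ` dominate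
`2 ^ length` up to a polynomial. -/
theorem Comp.ofBits {l : α → List Bool} (hid : Comp D μ fun x => x) (hl : Comp D μ l)
    (hB : Bdd D μ fun x => 2 ^ (l x).length) : Comp D μ fun x => ofBits (l x) := by
  refine Comp.foldr (init := fun _ => 0) (l := l)
    (step := fun _ b acc => acc + acc + if b = true then 1 else 0) hid (.const 0) hl
    (B := fun x => 2 * 2 ^ (l x).length + 1) (((Bdd.const 2).mul hB).add (Bdd.const 1)) ?_ ?_
  · intro x _ l₁ h
    have h1 := ofBits_lt l₁
    have h2 : 2 ^ l₁.length ≤ 2 ^ (l x).length := Nat.pow_le_pow_right (by omega) h.length_le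
    change sz (CoflowScheduling.ofBits l₁) ≤ _
    rw [sz_nat]
    omega
  · exact fun hid => (hid.snd.fst.add hid.snd.fst).add (hid.snd.snd.ite (.const 1) (.const 0))

theorem Comp.two_pow_length {l : α → List β} (hid : Comp D μ fun x => x) (hl : Comp D μ l)
    (hB : Bdd D μ fun x => 2 ^ (l x).length) : Comp D μ fun x => 2 ^ (l x).length := by
  have key : ∀ l : List β, l.foldr (fun _ acc => acc + acc) 1 = 2 ^ l.length := by
    intro l
    induction l with
    | nil => rfl
    | cons b l ih => rw [List.foldr_cons, ih, List.length_cons, pow_succ]; omega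
  refine Comp.congr (Comp.foldr (init := fun _ => 1) (l := l) (step := fun _ _ acc => acc + acc) hid
    (.const 1) hl (B := fun x => 2 * 2 ^ (l x).length + 1) (((Bdd.const 2).mul hB).add (Bdd.const 1))
    ?_ ?_) fun x _ => key _
  · intro x _ l₁ h
    have h2 : 2 ^ l₁.length ≤ 2 ^ (l x).length := Nat.pow_le_pow_right (by omega) h.length_le
    rw [key, sz_nat]
    omega
  · exact fun hid => hid.snd.fst.add hid.snd.fst

/-- One step of incrementing a binary number; the first component remembers the digits read. -/
def incStep (b : Bool) (acc : List Bool × List Bool) : List Bool × List Bool :=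
  (b :: acc.1, if b = true then false :: acc.2 else true :: acc.1)

/-- Increment of a binary number. -/
def inc (l : List Bool) : List Bool := (l.foldr incStep ([], [true])).2

theorem foldr_incStep (l : List Bool) : l.foldr incStep ([], [true]) = (l, inc l) := by
  refine Prod.ext ?_ rfl
  induction l with
  | nil => rfl
  | cons b l ih => rw [List.foldr_cons]; exact congrArg (b :: ·) ih

theorem inc_cons (b : Bool) (l : List Bool) :
    inc (b :: l) = if b = true then false :: inc l else true :: l := by
  rw [inc, List.foldr_cons, foldr_incStep, incStep]

theorem inc_bits (n : ℕ) : inc n.bits = (n + 1).bits := by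
  induction n using Nat.strongRecOn with
  | ind n ih =>
    rcases Nat.even_or_odd' n with ⟨k, rfl | rfl⟩
    · rcases Nat.eq_zero_or_pos k with rfl | hk
      · simp [inc]
      · rw [Nat.bit0_bits k (by omega), inc_cons, Nat.bit1_bits]
        simp
    · rw [Nat.bit1_bits k, inc_cons, ih k (by omega), show 2 * k + 1 + 1 = 2 * (k + 1) by ring,
        Nat.bit0_bits (k + 1) (by omega)]
      simp

theorem length_inc_le (l : List Bool) : (inc l).length ≤ l.length + 1 := by
  induction l with
  | nil => simp [inc]
  | cons b l ih =>
    rw [inc_cons]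
    split <;> simp only [List.length_cons] <;> omega

theorem sz_bits_le (l : List Bool) : sz l ≤ 4 * l.length + 1 := by
  have := sz_list_le (l := l) (B := 3) fun a _ => sz_bool_le a
  omega

theorem Poly.inc : Poly inc := by
  refine Comp.snd (f := fun l : List Bool => l.foldr incStep ([], [true])) ?_
  refine Comp.foldr (init := fun _ => ([], [true])) (l := fun l : List Bool => l)
    (step := fun _ b acc => incStep b acc) Poly.id (.const _) Poly.id (B := fun l => 8 * sz l + 8)
    (((Bdd.const 8).mul Bdd.self).add (Bdd.const 8)) ?_ ?_
  · intro l _ l₁ h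
    have h1 := h.length_le
    have h2 := sz_bits_le (CoflowScheduling.inc l₁)
    have h3 := sz_bits_le l₁
    have h4 := length_inc_le l₁
    have h5 := length_lt_sz l
    change sz (l₁.foldr incStep ([], [true])) ≤ _
    rw [foldr_incStep, sz_pair]
    dsimp only
    omega
  · intro hid
    exact (hid.snd.snd.cons hid.snd.fst.fst).pair (hid.snd.snd.ite ((Comp.const false).cons
      hid.snd.fst.snd) ((Comp.const true).cons hid.snd.fst.fst))

theorem iterate_inc (n : ℕ) : inc^[n] [] = n.bits := by
  induction n with
  | zero => simp
  | succ n ih => rw [Function.iterate_succ_apply', ih, inc_bits]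

theorem length_bits_le (n : ℕ) : n.bits.length ≤ n := by
  induction n with
  | zero => simp
  | succ n ih =>
    rw [← inc_bits]
    exact (length_inc_le _).trans (by omega)

theorem Poly.bits : Poly Nat.bits := by
  refine Comp.congr (Comp.foldl (init := fun _ => ([] : List Bool))
    (l := fun n : ℕ => List.replicate n ()) (step := fun _ acc _ => CoflowScheduling.inc acc) Poly.id (.const [])
    Poly.id.ticks (B := fun n => 2 * sz n + 1) (((Bdd.const 2).mul Bdd.self).add (Bdd.const 1)) ?_ ?_)
    fun n _ => ?_
  · intro n _ l₁ h
    obtain ⟨m, hm⟩ : ∃ m, l₁ = List.replicate m () := ⟨l₁.length, List.eq_replicate_length.2 (by simp)⟩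
    have h1 := h.length_le
    subst hm
    simp only [List.length_replicate] at h1
    rw [foldl_ticks, iterate_inc, sz_nat]
    have := sz_bits_le m.bits
    have := length_bits_le m
    omega
  · exact fun hid => hid.snd.fst.poly Poly.inc
  · rw [foldl_ticks, iterate_inc]

/-! ### Indexing and enumerating choices -/

/-- The elements of a list with their positions, in reverse order. -/
def indexed {β : Type} (l : List β) : List (β × ℕ) := l.foldl (fun acc b => (b, acc.length) :: acc) []

theorem indexed_concat {β : Type} (l : List β) (b : β) :
    indexed (l ++ [b]) = (b, (indexed l).length) :: indexed l := by
  rw [indexed, List.foldl_append]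
  rfl

theorem length_indexed {β : Type} (l : List β) : (indexed l).length = l.length := by
  induction l using List.reverseRecOn with
  | nil => rfl
  | append_singleton l b ih => simp [indexed_concat, ih]

theorem mem_indexed {β : Type} {l : List β} {b : β} {n : ℕ} : (b, n) ∈ indexed l ↔ l[n]? = some b := by
  induction l using List.reverseRecOn with
  | nil => simp [indexed]
  | append_singleton l c ih =>
    rw [indexed_concat, List.mem_cons, length_indexed, ih, Prod.mk.injEq]
    rcases lt_trichotomy n l.length with h | h | h
    · rw [List.getElem?_append_left h]
      simp [h.ne]
    · subst h
      simp [eq_comm]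
    · rw [List.getElem?_append_right h.le, List.getElem?_eq_none (by omega),
        List.getElem?_eq_none (by simp; omega)]
      simp; omega

theorem sz_indexed_le (l : List β) : sz (indexed l) ≤ sz l + l.length * (2 * l.length + 3) := by
  induction l using List.reverseRecOn with
  | nil => simp [indexed]
  | append_singleton l b ih =>
    have := sz_append l [b]
    rw [indexed_concat]
    simp only [sz_cons, sz_pair, sz_nat, length_indexed, List.length_append, List.length_singleton,
      sz_nil] at *
    nlinarith

theorem Poly.indexed : Poly (indexed : List β → List (β × ℕ)) := by
  refine Comp.foldl (init := fun _ => []) (l := fun l : List β => l)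
    (step := fun _ acc b => (b, acc.length) :: acc) Poly.id (.const _) Poly.id
    (B := fun l => sz l + sz l * (2 * sz l + 3))
    (Bdd.self.add (Bdd.self.mul (((Bdd.const 2).mul Bdd.self).add (Bdd.const 3)))) ?_ ?_
  · intro l _ l₁ h
    have h1 := sz_indexed_le l₁
    have h2 : l₁.length ≤ sz l := h.length_le.trans (length_lt_sz l).le
    have h3 : l₁.length * (2 * l₁.length + 3) ≤ sz l * (2 * sz l + 3) :=
      Nat.mul_le_mul h2 (by omega)
    have h4 := sz_prefix_le h
    change sz (CoflowScheduling.indexed l₁) ≤ _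
    omega
  · exact fun hid => (hid.snd.snd.pair (hid.snd.fst.poly Poly.length)).cons hid.snd.fst

/-- All ways to mark some of the elements of a list. -/
def markings {β : Type} (l : List β) : List (List (Bool × β)) :=
  l.foldr (fun b acc => acc.map (fun a => (false, b) :: a) ++ acc.map (fun a => (true, b) :: a)) [[]]

theorem markings_cons {β : Type} (b : β) (l : List β) : markings (b :: l) =
    (markings l).map (fun a => (false, b) :: a) ++ (markings l).map (fun a => (true, b) :: a) := rfl

theorem mem_markings {β : Type} {l : List β} {a : List (Bool × β)} :
    a ∈ markings l ↔ a.map Prod.snd = l := by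
  induction l generalizing a with
  | nil => simp [markings]
  | cons b l ih =>
    rw [markings_cons]
    simp only [List.mem_append, List.mem_map, ih, List.map_eq_cons_iff]
    constructor
    · rintro (⟨a, h, rfl⟩ | ⟨a, h, rfl⟩)
      · exact ⟨_, _, rfl, rfl, h⟩
      · exact ⟨_, _, rfl, rfl, h⟩
    · rintro ⟨⟨c, d⟩, t, rfl, rfl, h⟩
      cases c
      · exact Or.inl ⟨t, h, rfl⟩
      · exact Or.inr ⟨t, h, rfl⟩

theorem length_markings {β : Type} (l : List β) : (markings l).length = 2 ^ l.length := by
  induction l with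
  | nil => rfl
  | cons b l ih =>
    rw [markings_cons, List.length_append, List.length_map, List.length_map, ih, List.length_cons,
      pow_succ]
    omega

theorem sz_marking_le {l : List β} {a : List (Bool × β)} (h : a ∈ markings l) :
    sz a ≤ sz l + 4 * l.length := by
  rw [mem_markings] at h
  subst h
  induction a with
  | nil => simp
  | cons p a ih =>
    have := sz_bool_le p.1
    simp only [List.map_cons, sz_cons, sz_pair, List.length_cons] at *
    omega

theorem Comp.markings {l : α → List β} (hid : Comp D μ fun x => x) (hl : Comp D μ l)
    (hB : Bdd D μ fun x => 2 ^ (l x).length) : Comp D μ fun x => markings (l x) := by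
  refine Comp.foldr (init := fun _ => [[]]) (l := l)
    (step := fun _ b acc => acc.map (fun a => (false, b) :: a) ++ acc.map (fun a => (true, b) :: a))
    hid (.const _) hl (B := fun x => 2 ^ (l x).length * (sz (l x) * 5 + 1) + 1)
    ((hB.mul ((hl.bdd.mul (Bdd.const 5)).add (Bdd.const 1))).add (Bdd.const 1)) ?_ ?_
  · intro x _ l₁ h
    have h1 := sz_suffix_le h
    have h2 := (length_lt_sz l₁).le
    have h3 : 2 ^ l₁.length ≤ 2 ^ (l x).length := Nat.pow_le_pow_right (by omega) h.length_le
    refine (sz_list_le (l := CoflowScheduling.markings l₁) (B := sz (l x) * 5)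
      fun a ha => ?_).trans ?_
    · have := sz_marking_le ha
      omega
    · rw [length_markings]
      exact Nat.add_le_add_right (Nat.mul_le_mul_right _ h3) 1
  · intro hid
    have h : ∀ c : Bool, _ := fun c => Comp.map (l := fun p => p.2.1)
      (g := fun p a => (c, p.2.2) :: a) hid hid.snd.fst fun hid' =>
        ((Comp.const c).pair hid'.fst.snd.snd).cons hid'.snd
    exact (h false).append (h true)

end CoflowScheduling

namespace CoflowScheduling

open Enc (enc)

/-! ### The algorithm -/

/-- A coflow number, an input port, an output port, and an amount of data. -/
abbrev Entry : Type := ℕ × ℕ × ℕ × ℕ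

/-- The encoding of a coflow, with lists in place of trees. -/
abbrev RawCoflow : Type := List (List (List Bool)) × (List Bool × List Bool) × List Bool × List Bool

/-- The input of an online algorithm, with lists in place of trees. -/
abbrev RawInput : Type := List Bool × List Bool × List RawCoflow

/-- The demands of a coflow, and the numerator and the denominator of its weight. -/
abbrev Candidate : Type := List Entry × ℕ × ℕ

def loadIn (es : List Entry) (i : ℕ) : ℕ :=
  (es.map fun e => if decide (e.2.1 = i) = true then e.2.2.2 else 0).sum

def loadOut (es : List Entry) (o : ℕ) : ℕ :=
  (es.map fun e => if decide (e.2.2.1 = o) = true then e.2.2.2 else 0).sum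

/-- No port has load more than `d`. -/
def fits (d : ℕ) (es : List Entry) : Bool :=
  es.all fun e => decide (loadIn es e.2.1 ≤ d) && decide (loadOut es e.2.2.1 ≤ d)

def demandEntries (M : List (List (List Bool))) (j : ℕ) : List Entry :=
  (indexed M).flatMap fun row => (indexed row.1).map fun cell => (j, row.2, cell.2, ofBits cell.1)

/-- The coflows released by time `d`. -/
def candidates (d : ℕ) (cs : List RawCoflow) : List Candidate :=
  (indexed cs).flatMap fun c =>
    if decide (ofBits c.1.2.2.1 ≤ ofBits c.1.2.2.2 * d) = true then
      [(demandEntries c.1.1 c.2, ofBits c.1.2.1.1, ofBits c.1.2.1.2)]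
    else []

/-- The demands of the marked coflows. -/
def selected (a : List (Bool × Candidate)) : List Entry :=
  a.flatMap fun p => if p.1 = true then p.2.1 else []

/-- The total weight of the marked coflows, as a fraction. -/
def selectedWeight (a : List (Bool × Candidate)) : ℕ × ℕ :=
  a.foldr (fun p acc => if p.1 = true then
    (acc.1 * p.2.2.2 + p.2.2.1 * acc.2, acc.2 * p.2.2.2) else acc) (0, 1)

/-- A set of coflows of maximum weight among those without port of load more than `d`. -/
def bestSelection (d : ℕ) (js : List Candidate) : List (Bool × Candidate) :=
  -- Fractions are compared by cross-multiplication. The comparison is not strict, so the last of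
  -- several optimal markings wins; `bestSelection_eq_all` relies on this. The initial value `[]`
  -- selects nothing.
  (markings js).foldl (fun best a => if (fits d (selected a) &&
    decide ((selectedWeight best).1 * (selectedWeight a).2 ≤
      (selectedWeight a).1 * (selectedWeight best).2)) = true then a else best) []

/-- What is sent in a slot. -/
def sent (a : List (Bool × Entry)) : List Entry :=
  a.map fun p => (p.2.1, p.2.2.1, p.2.2.2.1, if p.1 = true then 1 else 0)

/-- What remains to be sent after a slot. -/
def remaining (a : List (Bool × Entry)) : List Entry :=
  a.map fun p => (p.2.1, p.2.2.1, p.2.2.2.1, p.2.2.2.2 - if p.1 = true then 1 else 0)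

/-- A matching that brings all loads below `d`. -/
def slotMarking (d : ℕ) (es : List Entry) : List (Bool × Entry) :=
  -- If no marking qualifies, the result is `[]` and nothing is sent.
  (markings es).foldl (fun best a =>
    if (fits 1 (sent a) && fits (d - 1) (remaining a)) = true then a else best) []

def advance (s : List Entry × ℕ) : List Entry × ℕ := (remaining (slotMarking s.2 s.1), s.2 - 1)

/-- The data not yet sent after `n` slots, when the coflows in `js` are processed in `d` slots. -/
def residual (d n : ℕ) (js : List Candidate) : List Entry × ℕ :=
  advance^[n] (selected (bestSelection d js), d)

def sentTriples (a : List (Bool × Entry)) : List (ℕ × ℕ × ℕ) :=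
  a.flatMap fun p => if p.1 = true then [(p.2.1, p.2.2.1, p.2.2.2.1)] else []

/-- The decision for slot `n` in a phase of `d` slots. -/
def phaseDecision (d n : ℕ) (js : List Candidate) : List (ℕ × ℕ × ℕ) :=
  sentTriples (slotMarking (residual d n js).2 (residual d n js).1)

/-- The decision at a time in `[d, 2d)`, where `d` is a power of two, is part of a schedule of a
heaviest set of coflows that are released by time `d` and can be processed in `d` slots. -/
def rawDecision (r : RawInput) : List (ℕ × ℕ × ℕ) :=
  if decide (ofBits r.1 = 0) = true then [] else
    phaseDecision (2 ^ r.1.tail.length) (ofBits r.1 - 2 ^ r.1.tail.length)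
      (candidates (2 ^ r.1.tail.length) r.2.2)

/-! ### Running time of the algorithm -/

theorem foldl_ite_mem {β : Type} (c : β → β → Bool) (l : List β) (b : β) :
    l.foldl (fun best a => if c best a = true then a else best) b = b ∨
      l.foldl (fun best a => if c best a = true then a else best) b ∈ l := by
  induction l generalizing b with
  | nil => exact Or.inl rfl
  | cons a l ih =>
    rw [List.foldl_cons]
    split
    · rcases ih a with h | h
      · rw [h]; simp
      · exact Or.inr (List.mem_cons_of_mem _ h)
    · rcases ih b with h | h
      · exact Or.inl h
      · exact Or.inr (List.mem_cons_of_mem _ h)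

theorem mem_of_mem_indexed {β : Type} {l : List β} {p : β × ℕ} (h : p ∈ indexed l) : p.1 ∈ l :=
  List.mem_of_getElem? (mem_indexed (b := p.1) (n := p.2).1 h)

theorem map_fst_indexed {β : Type} (l : List β) : (indexed l).map Prod.fst = l.reverse := by
  induction l using List.reverseRecOn with
  | nil => rfl
  | append_singleton l b ih => simp [indexed_concat, ih]

theorem sum_map_indexed {β : Type} (f : β → ℕ) (l : List β) :
    ((indexed l).map fun p => f p.1).sum = (l.map f).sum := by
  have : ((indexed l).map fun p => f p.1) = (l.map f).reverse := by
    rw [← List.map_reverse, ← map_fst_indexed, List.map_map]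
    rfl
  rw [this, List.sum_reverse]

theorem sum_sz_lt {β : Type} [Enc β] (l : List β) : (l.map sz).sum < sz l := by
  induction l with
  | nil => simp
  | cons b l ih => simp only [List.map_cons, List.sum_cons, sz_cons]; omega

theorem Poly.loadIn : Poly fun p : List Entry × ℕ => loadIn p.1 p.2 :=
  (Comp.map (g := fun (p : List Entry × ℕ) (e : Entry) => if decide (e.2.1 = p.2) = true then e.2.2.2 else 0) Poly.id Poly.id.fst
    fun h => (h.snd.snd.fst.eq h.fst.snd).ite h.snd.snd.snd.snd (.const 0)).poly Poly.sum

theorem Poly.loadOut : Poly fun p : List Entry × ℕ => loadOut p.1 p.2 :=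
  (Comp.map (g := fun (p : List Entry × ℕ) (e : Entry) => if decide (e.2.2.1 = p.2) = true then e.2.2.2 else 0) Poly.id
    Poly.id.fst fun h => (h.snd.snd.snd.fst.eq h.fst.snd).ite h.snd.snd.snd.snd (.const 0)).poly
    Poly.sum

theorem Poly.fits : Poly fun p : ℕ × List Entry => fits p.1 p.2 :=
  Comp.all (g := fun (p : ℕ × List Entry) (e : Entry) => decide (CoflowScheduling.loadIn p.2 e.2.1 ≤ p.1) &&
      decide (CoflowScheduling.loadOut p.2 e.2.2.1 ≤ p.1)) Poly.id Poly.id.snd fun h =>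
    ((Comp.poly₂ Poly.loadIn h.fst.snd h.snd.snd.fst).le h.fst.fst).and
      ((Comp.poly₂ Poly.loadOut h.fst.snd h.snd.snd.snd.fst).le h.fst.fst)

theorem Poly.selected : Poly selected :=
  Comp.flatMap (l := fun a => a) (g := fun (_ : List (Bool × Candidate)) (p : Bool × Candidate) =>
    if p.1 = true then p.2.1 else []) Poly.id Poly.id
    fun h => h.snd.fst.ite h.snd.snd.fst (.const [])

theorem Poly.sent : Poly sent :=
  Comp.map (l := fun a => a)
    (g := fun (_ : List (Bool × Entry)) (p : Bool × Entry) => (p.2.1, p.2.2.1, p.2.2.2.1, if p.1 = true then 1 else 0)) Poly.id Poly.id fun h =>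
    h.snd.snd.fst.pair (h.snd.snd.snd.fst.pair (h.snd.snd.snd.snd.fst.pair
      (h.snd.fst.ite (.const 1) (.const 0))))

theorem Poly.remaining : Poly remaining :=
  Comp.map (l := fun a => a)
    (g := fun (_ : List (Bool × Entry)) (p : Bool × Entry) => (p.2.1, p.2.2.1, p.2.2.2.1, p.2.2.2.2 - if p.1 = true then 1 else 0)) Poly.id
    Poly.id fun h => h.snd.snd.fst.pair (h.snd.snd.snd.fst.pair (h.snd.snd.snd.snd.fst.pair
      (h.snd.snd.snd.snd.snd.sub (h.snd.fst.ite (.const 1) (.const 0)))))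

theorem Poly.sentTriples : Poly sentTriples :=
  Comp.flatMap (l := fun a => a)
    (g := fun (_ : List (Bool × Entry)) (p : Bool × Entry) => if p.1 = true then [(p.2.1, p.2.2.1, p.2.2.2.1)] else []) Poly.id Poly.id fun h =>
    h.snd.fst.ite ((h.snd.snd.fst.pair (h.snd.snd.snd.fst.pair h.snd.snd.snd.snd.fst)).cons
      (.const [])) (.const [])

theorem sz_remaining_le (a : List (Bool × Entry)) : sz (remaining a) ≤ sz (a.map Prod.snd) := by
  induction a with
  | nil => exact le_rfl
  | cons p a ih =>
    have : remaining (p :: a) =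
      (p.2.1, p.2.2.1, p.2.2.2.1, p.2.2.2.2 - if p.1 = true then 1 else 0) :: remaining a := rfl
    rw [this]
    simp only [List.map_cons, sz_cons, sz_pair, sz_nat]
    omega

theorem slotMarking_eq_nil_or (d : ℕ) (es : List Entry) :
    slotMarking d es = [] ∨ slotMarking d es ∈ markings es :=
  foldl_ite_mem (fun _ a => fits 1 (sent a) && fits (d - 1) (remaining a)) _ _

theorem sz_remaining_slotMarking_le (d : ℕ) (es : List Entry) :
    sz (remaining (slotMarking d es)) ≤ sz es := by
  refine (sz_remaining_le _).trans ?_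
  rcases slotMarking_eq_nil_or d es with h | h
  · rw [h]
    exact sz_pos es
  · rw [mem_markings.1 h]

theorem length_remaining_slotMarking_le (d : ℕ) (es : List Entry) :
    (remaining (slotMarking d es)).length ≤ es.length := by
  rw [remaining, List.length_map]
  rcases slotMarking_eq_nil_or d es with h | h
  · rw [h]
    exact Nat.zero_le _
  · rw [← List.length_map (f := Prod.snd), mem_markings.1 h]

/-- A bound on the numerator and the denominator of a sum of weights of candidates. -/
def weightBound (js : List Candidate) : ℕ := (js.map fun c => c.2.1 + c.2.2 + 1).prod

theorem weightBound_pos (js : List Candidate) : 0 < weightBound js := by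
  induction js with
  | nil => exact Nat.one_pos
  | cons c js ih =>
    rw [weightBound, List.map_cons, List.prod_cons]
    exact Nat.mul_pos (by omega) ih

theorem weightBound_suffix_le {l₁ l₂ : List Candidate} (h : l₁ <:+ l₂) :
    weightBound l₁ ≤ weightBound l₂ := by
  obtain ⟨l, rfl⟩ := h
  rw [weightBound, weightBound, List.map_append, List.prod_append]
  exact Nat.le_mul_of_pos_left _ (weightBound_pos l)

theorem selectedWeight_le (a : List (Bool × Candidate)) :
    (selectedWeight a).1 ≤ weightBound (a.map Prod.snd) ∧
      (selectedWeight a).2 ≤ weightBound (a.map Prod.snd) := by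
  induction a with
  | nil => simp [selectedWeight, weightBound]
  | cons p a ih =>
    obtain ⟨h1, h2⟩ := ih
    have h3 : weightBound ((p :: a).map Prod.snd) =
      (p.2.2.1 + p.2.2.2 + 1) * weightBound (a.map Prod.snd) := rfl
    have h4 : selectedWeight (p :: a) = if p.1 = true then ((selectedWeight a).1 * p.2.2.2 +
      p.2.2.1 * (selectedWeight a).2, (selectedWeight a).2 * p.2.2.2) else selectedWeight a := rfl
    rw [h3, h4]
    split
    · constructor <;> dsimp only <;> nlinarith
    · constructor <;> nlinarith

/-! ### Programs for the searches of the algorithm -/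

namespace Comp

variable {α : Type} [Enc α] {D : Set α} {μ : α → ℕ}

theorem demandEntries {M : α → List (List (List Bool))} {j : α → ℕ} (hid : Comp D μ fun x => x)
    (hM : Comp D μ M) (hj : Comp D μ j) (hB : Bdd D μ fun x => 2 ^ sz (M x)) :
    Comp D μ fun x => demandEntries (M x) (j x) := by
  refine flatMap (l := fun x => indexed (M x)) (g := fun x row => (indexed row.1).map fun cell =>
    (j x, row.2, cell.2, CoflowScheduling.ofBits cell.1)) hid (hM.poly Poly.indexed) fun h => ?_
  refine map (g := fun p cell => (j p.1, p.2.2, cell.2, CoflowScheduling.ofBits cell.1)) h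
    (h.snd.fst.poly Poly.indexed) fun h' => ?_
  refine ((hj.lift h fun p hp => hp.1).lift h' fun p hp => hp.1).pair
    (h'.fst.snd.snd.pair (h'.snd.snd.pair (ofBits h' h'.snd.fst ?_)))
  obtain ⟨k, hk⟩ := hB
  refine ⟨k, fun q hq => le_trans (Nat.pow_le_pow_right (by omega) ?_) (hk q.1.1 hq.1.1)⟩
  have h1 := sz_mem_lt (mem_of_mem_indexed hq.2)
  have h2 := sz_mem_lt (mem_of_mem_indexed hq.1.2)
  have h3 := length_lt_sz q.2.1
  omega

theorem candidates {d : α → ℕ} {cs : α → List RawCoflow} (hid : Comp D μ fun x => x)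
    (hd : Comp D μ d) (hcs : Comp D μ cs) (hB : Bdd D μ fun x => 2 ^ sz (cs x)) :
    Comp D μ fun x => candidates (d x) (cs x) := by
  refine flatMap (l := fun x => indexed (cs x)) (g := fun x c =>
    if decide (CoflowScheduling.ofBits c.1.2.2.1 ≤ CoflowScheduling.ofBits c.1.2.2.2 * d x) = true
    then [(CoflowScheduling.demandEntries c.1.1 c.2, CoflowScheduling.ofBits c.1.2.1.1,
      CoflowScheduling.ofBits c.1.2.1.2)] else []) hid (hcs.poly Poly.indexed) fun h => ?_
  obtain ⟨k, hk⟩ := hB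
  have key : ∀ f : RawCoflow → ℕ, (∀ c, f c ≤ sz c) →
      Bdd {p : α × RawCoflow × ℕ | p.1 ∈ D ∧ p.2 ∈ indexed (cs p.1)} (fun p => μ p.1)
        fun p => 2 ^ f p.2.1 := by
    refine fun f hf => ⟨k, fun p hp => le_trans (Nat.pow_le_pow_right (by omega) ?_) (hk p.1 hp.1)⟩
    have h1 := sz_mem_lt (mem_of_mem_indexed hp.2)
    have h2 := hf p.2.1
    omega
  refine ((ofBits h h.snd.fst.snd.snd.fst (key (fun c => c.2.2.1.length) fun c => ?_)).le
    ((ofBits h h.snd.fst.snd.snd.snd (key (fun c => c.2.2.2.length) fun c => ?_)).mul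
      (hd.lift h fun p hp => hp.1))).ite
    (((demandEntries h h.snd.fst.fst h.snd.snd (key (fun c => sz c.1) fun c => ?_)).pair
      ((ofBits h h.snd.fst.snd.fst.fst (key (fun c => c.2.1.1.length) fun c => ?_)).pair
      (ofBits h h.snd.fst.snd.fst.snd (key (fun c => c.2.1.2.length) fun c => ?_)))).cons (.const []))
    (.const [])
  · have := length_lt_sz c.2.2.1
    simp only [sz_pair]; omega
  · have := length_lt_sz c.2.2.2
    simp only [sz_pair]; omega
  · simp only [sz_pair]; omega
  · have := length_lt_sz c.2.1.1
    simp only [sz_pair]; omega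
  · have := length_lt_sz c.2.1.2
    simp only [sz_pair]; omega

theorem selectedWeight {a : α → List (Bool × Candidate)} (hid : Comp D μ fun x => x)
    (ha : Comp D μ a) (hB : Bdd D μ fun x => weightBound ((a x).map Prod.snd)) :
    Comp D μ fun x => selectedWeight (a x) := by
  refine foldr (init := fun _ => (0, 1)) (l := a) (step := fun _ p acc => if p.1 = true then
    (acc.1 * p.2.2.2 + p.2.2.1 * acc.2, acc.2 * p.2.2.2) else acc) hid (.const _) ha
    (B := fun x => 4 * weightBound ((a x).map Prod.snd) + 3)
    (((Bdd.const 4).mul hB).add (Bdd.const 3)) (fun x _ l h => ?_) fun h => ?_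
  · have h1 := selectedWeight_le l
    have h2 := weightBound_suffix_le (h.map Prod.snd)
    change sz (CoflowScheduling.selectedWeight l) ≤ _
    simp only [sz_pair, sz_nat]
    omega
  · exact h.snd.snd.fst.ite (((h.snd.fst.fst.mul h.snd.snd.snd.snd.snd).add
      (h.snd.snd.snd.snd.fst.mul h.snd.fst.snd)).pair (h.snd.fst.snd.mul h.snd.snd.snd.snd.snd))
      h.snd.fst

/-- The invariant that the current best is `[]` or a marking of the candidates bounds the unary
fractions in each comparison by `weightBound`. -/
theorem bestSelection {d : α → ℕ} {js : α → List Candidate} (hid : Comp D μ fun x => x)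
    (hd : Comp D μ d) (hjs : Comp D μ js) (hB : Bdd D μ fun x => 2 ^ (js x).length)
    (hW : Bdd D μ fun x => weightBound (js x)) :
    Comp D μ fun x => bestSelection (d x) (js x) := by
  obtain ⟨k, hk⟩ := hW
  have hW' : ∀ x ∈ D, ∀ c, c = [] ∨ c ∈ CoflowScheduling.markings (js x) →
      weightBound (c.map Prod.snd) ≤ (μ x + 2) ^ k := by
    rintro x hx c (rfl | h)
    · exact Nat.one_le_pow _ _ (by omega)
    · rw [mem_markings.1 h]
      exact hk x hx
  refine foldl_inv (init := fun _ => []) (l := fun x => CoflowScheduling.markings (js x))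
    (step := fun x best a => if (CoflowScheduling.fits (d x) (CoflowScheduling.selected a) &&
      decide ((CoflowScheduling.selectedWeight best).1 * (CoflowScheduling.selectedWeight a).2 ≤
      (CoflowScheduling.selectedWeight a).1 * (CoflowScheduling.selectedWeight best).2)) = true
      then a else best) hid (.const []) (markings hid hjs hB)
    (fun x c => c = [] ∨ c ∈ CoflowScheduling.markings (js x)) (B := fun x => sz (js x) * 5 + 1)
    ((hjs.bdd.mul (Bdd.const 5)).add (Bdd.const 1)) ?_ ?_ ?_ ?_
  · rintro x _ c (rfl | h)
    · simp
    · have h1 := sz_marking_le h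
      have h2 := length_lt_sz (js x)
      omega
  · exact fun x _ => Or.inl rfl
  · intro x _ c hc a ha
    split
    · exact Or.inr ha
    · exact hc
  · intro h
    have h1 := selectedWeight h h.snd.fst ⟨k, fun p hp => hW' p.1 hp.1 _ hp.2.1⟩
    have h2 := selectedWeight h h.snd.snd ⟨k, fun p hp => hW' p.1 hp.1 _ (Or.inr hp.2.2)⟩
    exact ((poly₂ Poly.fits (hd.lift h fun p hp => hp.1) (h.snd.snd.poly Poly.selected)).and
      ((h1.fst.mul h2.snd).le (h2.fst.mul h1.snd))).ite h.snd.snd h.snd.fst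

theorem slotMarking {d : α → ℕ} {es : α → List Entry} (hid : Comp D μ fun x => x)
    (hd : Comp D μ d) (hes : Comp D μ es) (hB : Bdd D μ fun x => 2 ^ (es x).length) :
    Comp D μ fun x => slotMarking (d x) (es x) := by
  refine foldl_inv (init := fun _ => []) (l := fun x => CoflowScheduling.markings (es x))
    (step := fun x best a => if (CoflowScheduling.fits 1 (CoflowScheduling.sent a) &&
      CoflowScheduling.fits (d x - 1) (CoflowScheduling.remaining a)) = true
      then a else best) hid (.const []) (markings hid hes hB)
    (fun x c => c = [] ∨ c ∈ CoflowScheduling.markings (es x)) (B := fun x => sz (es x) * 5 + 1)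
    ((hes.bdd.mul (Bdd.const 5)).add (Bdd.const 1)) ?_ ?_ ?_ ?_
  · rintro x _ c (rfl | h)
    · simp
    · have h1 := sz_marking_le h
      have h2 := length_lt_sz (es x)
      omega
  · exact fun x _ => Or.inl rfl
  · intro x _ c hc a ha
    split
    · exact Or.inr ha
    · exact hc
  · intro h
    exact ((poly₂ Poly.fits (.const 1) (h.snd.snd.poly Poly.sent)).and
      (poly₂ Poly.fits (hd.lift h fun p hp => hp.1).pred (h.snd.snd.poly Poly.remaining))).ite
      h.snd.snd h.snd.fst

/-- The list of entries gets neither longer nor larger during a phase, so the search in every slot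
obeys the bound for the first slot. -/
theorem residual {d n : α → ℕ} {js : α → List Candidate} (hid : Comp D μ fun x => x)
    (hd : Comp D μ d) (hn : Comp D μ n) (hb : Comp D μ fun x => CoflowScheduling.bestSelection (d x) (js x))
    (hB : Bdd D μ fun x => 2 ^ (selected (CoflowScheduling.bestSelection (d x) (js x))).length) :
    Comp D μ fun x => residual (d x) (n x) (js x) := by
  have hsel := hb.poly Poly.selected
  refine (foldl_inv (init := fun x => (selected (CoflowScheduling.bestSelection (d x) (js x)), d x))
    (l := fun x => List.replicate (n x) ()) (step := fun _ s _ => advance s) hid (hsel.pair hd)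
    hn.ticks (fun x s => sz s.1 ≤ sz (selected (CoflowScheduling.bestSelection (d x) (js x))) ∧
      s.1.length ≤ (selected (CoflowScheduling.bestSelection (d x) (js x))).length ∧ s.2 ≤ d x)
    ((hsel.bdd.add hd.bdd).add (Bdd.const 1)) ?_ ?_ ?_ ?_).congr fun x _ => foldl_ticks _ _
  · rintro x _ s ⟨h1, -, h2⟩
    simp only [sz_pair, sz_nat]
    omega
  · exact fun x _ => ⟨le_rfl, le_rfl, le_rfl⟩
  · rintro x _ s ⟨h1, h2, h3⟩ _ _
    exact ⟨(sz_remaining_slotMarking_le _ _).trans h1,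
      (length_remaining_slotMarking_le _ _).trans h2, (Nat.sub_le _ _).trans h3⟩
  · intro h
    obtain ⟨k, hk⟩ := hB
    refine Comp.pair (Comp.poly (slotMarking h h.snd.fst.snd h.snd.fst.fst ⟨k, fun p hp => ?_⟩)
      Poly.remaining) h.snd.fst.snd.pred
    exact (Nat.pow_le_pow_right (by omega) hp.2.1.2.1).trans (hk p.1 hp.1)

end Comp

theorem length_candidates_le (d : ℕ) (cs : List RawCoflow) : (candidates d cs).length ≤ sz cs := by
  have key : ∀ L : List (RawCoflow × ℕ), (L.flatMap fun c =>
      if decide (ofBits c.1.2.2.1 ≤ ofBits c.1.2.2.2 * d) = true then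
      [(demandEntries c.1.1 c.2, ofBits c.1.2.1.1, ofBits c.1.2.1.2)] else []).length ≤ L.length := by
    intro L
    induction L with
    | nil => simp
    | cons c L ih =>
      rw [List.flatMap_cons, List.length_append, List.length_cons]
      split <;> simp only [List.length_cons, List.length_nil] <;> omega
  refine (key _).trans ?_
  rw [length_indexed]
  exact (length_lt_sz cs).le

/-- Each factor is at most `2` to the size of the digits it comes from. The product adds these sizes
up, and their sum is below the size of the list. -/
theorem weightBound_candidates_le (d : ℕ) (cs : List RawCoflow) :
    weightBound (candidates d cs) ≤ 2 ^ sz cs := by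
  have h1 : ∀ u v : List Bool, ofBits u + ofBits v + 1 ≤ 2 ^ (sz u + sz v) := by
    intro u v
    have hu := ofBits_lt u
    have hv := ofBits_lt v
    have hu' : 2 ^ u.length ≤ 2 ^ sz u := Nat.pow_le_pow_right (by omega) (length_lt_sz u).le
    have hv' : 2 ^ v.length ≤ 2 ^ sz v := Nat.pow_le_pow_right (by omega) (length_lt_sz v).le
    rw [pow_add]
    nlinarith
  have key : ∀ L : List (RawCoflow × ℕ), weightBound (L.flatMap fun c =>
      if decide (ofBits c.1.2.2.1 ≤ ofBits c.1.2.2.2 * d) = true then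
      [(demandEntries c.1.1 c.2, ofBits c.1.2.1.1, ofBits c.1.2.1.2)] else []) ≤
      2 ^ (L.map fun c => sz c.1).sum := by
    intro L
    induction L with
    | nil => simp [weightBound]
    | cons c L ih =>
      rw [List.flatMap_cons, weightBound, List.map_append, List.prod_append, List.map_cons,
        List.sum_cons, pow_add]
      refine Nat.mul_le_mul ?_ ih
      split
      · simp only [List.map_cons, List.map_nil, List.prod_cons, List.prod_nil, mul_one]
        refine (h1 _ _).trans (Nat.pow_le_pow_right (by omega) ?_)
        simp only [sz_pair]
        omega
      · exact Nat.one_le_pow _ _ (by omega)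
  refine (key _).trans (Nat.pow_le_pow_right (by omega) ?_)
  rw [sum_map_indexed]
  exact (sum_sz_lt cs).le

theorem length_demandEntries_le (M : List (List (List Bool))) (j : ℕ) :
    (demandEntries M j).length ≤ sz M := by
  rw [demandEntries, List.length_flatMap]
  simp only [List.length_map, length_indexed]
  rw [sum_map_indexed]
  refine (List.sum_le_sum fun l _ => (length_lt_sz l).le).trans (sum_sz_lt M).le

theorem length_selected_le (a : List (Bool × Candidate)) :
    (selected a).length ≤ (a.map fun p => p.2.1.length).sum := by
  rw [selected, List.length_flatMap]
  refine List.sum_le_sum fun p _ => ?_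
  split <;> simp

theorem sum_length_candidates_le (d : ℕ) (cs : List RawCoflow) :
    ((candidates d cs).map fun c => c.1.length).sum ≤ sz cs := by
  have key : ∀ L : List (RawCoflow × ℕ), ((L.flatMap fun c =>
      if decide (ofBits c.1.2.2.1 ≤ ofBits c.1.2.2.2 * d) = true then
      [((demandEntries c.1.1 c.2, ofBits c.1.2.1.1, ofBits c.1.2.1.2) : Candidate)]
      else []).map fun c => c.1.length).sum ≤ (L.map fun c => sz c.1).sum := by
    intro L
    induction L with
    | nil => simp
    | cons c L ih =>
      rw [List.flatMap_cons, List.map_append, List.sum_append, List.map_cons, List.sum_cons]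
      refine Nat.add_le_add ?_ ih
      split
      · have := length_demandEntries_le c.1.1 c.2
        simp only [List.map_cons, List.map_nil, List.sum_cons, List.sum_nil, sz_pair]
        omega
      · simp
  refine (key _).trans ?_
  rw [sum_map_indexed]
  exact (sum_sz_lt cs).le

theorem bestSelection_eq_nil_or (d : ℕ) (js : List Candidate) :
    bestSelection d js = [] ∨ bestSelection d js ∈ markings js :=
  foldl_ite_mem (fun best a => fits d (selected a) && decide ((selectedWeight best).1 *
    (selectedWeight a).2 ≤ (selectedWeight a).1 * (selectedWeight best).2)) _ _

theorem length_selected_bestSelection_le (d e : ℕ) (cs : List RawCoflow) :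
    (selected (bestSelection d (candidates e cs))).length ≤ sz cs := by
  refine (length_selected_le _).trans ?_
  rcases bestSelection_eq_nil_or d (candidates e cs) with h | h
  · rw [h]
    simp
  · have := sum_length_candidates_le e cs
    rw [← mem_markings.1 h, List.map_map] at this
    exact this

/-- With the measure `2 ^ sz r`, every exponential quantity that occurs is bounded: numbers
converted to unary, the two kinds of markings, and common denominators all have logarithm at most
the size of the input. -/
theorem comp_rawDecision : Comp Set.univ (fun r : RawInput => 2 ^ sz r) rawDecision := by
  have key : ∀ f : RawInput → ℕ, (∀ r, f r ≤ sz r) →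
      Bdd Set.univ (fun r : RawInput => 2 ^ sz r) fun r => 2 ^ f r := fun f hf =>
    Bdd.self.mono fun r _ => Nat.pow_le_pow_right (by omega) (hf r)
  have hid : Comp Set.univ (fun r : RawInput => 2 ^ sz r) fun r => r :=
    Comp.id_of_bdd (Bdd.self.mono fun r _ => Nat.lt_two_pow_self.le)
  have ht := Comp.ofBits hid hid.fst <| key _ fun r => by
    have := length_lt_sz r.1
    rw [sz_pair]; omega
  have hd := Comp.two_pow_length hid hid.fst.tail <| key _ fun r => by
    have := length_lt_sz r.1
    rw [sz_pair, List.length_tail]; omega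
  have hjs := Comp.candidates hid hd hid.snd.snd <| key _ fun r => by
    simp only [sz_pair]; omega
  have hb := Comp.bestSelection hid hd hjs
    (key _ fun r => (length_candidates_le _ _).trans (by simp only [sz_pair]; omega))
    ((key (fun r => sz r.2.2) fun r => by simp only [sz_pair]; omega).mono fun r _ =>
      weightBound_candidates_le _ _)
  have hB := key (fun r => (selected (bestSelection (2 ^ r.1.tail.length)
    (candidates (2 ^ r.1.tail.length) r.2.2))).length) fun r =>
    (length_selected_bestSelection_le _ _ _).trans (by simp only [sz_pair]; omega)
  have hr := Comp.residual hid hd (ht.sub hd) hb hB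
  refine (ht.eq (.const 0)).ite (.const []) ((Comp.slotMarking hid hr.snd hr.fst ?_).poly
    Poly.sentTriples)
  refine hB.mono fun r _ => Nat.pow_le_pow_right (by omega) ?_
  generalize candidates (2 ^ r.1.tail.length) r.2.2 = js
  generalize ofBits r.1 - 2 ^ r.1.tail.length = n
  rw [residual]
  induction n with
  | zero => exact le_rfl
  | succ n ih =>
    rw [Function.iterate_succ_apply']
    exact (length_remaining_slotMarking_le _ _).trans ih

/-- The decision with indices in binary. -/
def binaryDecision (r : RawInput) : List (List Bool × List Bool × List Bool) :=
  (rawDecision r).map fun e => (e.1.bits, e.2.1.bits, e.2.2.bits)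

theorem exists_prog_binaryDecision : ∃ (P : Prog) (c : ℕ), ∀ r : RawInput,
    ∃ s ≤ 2 ^ (c * sz r), Eval P (enc r) (enc (binaryDecision r)) s := by
  have h : Poly fun l : List (ℕ × ℕ × ℕ) => l.map fun e => (e.1.bits, e.2.1.bits, e.2.2.bits) :=
    Comp.map (l := fun l => l) (g := fun (_ : List (ℕ × ℕ × ℕ)) (e : ℕ × ℕ × ℕ) =>
      (e.1.bits, e.2.1.bits, e.2.2.bits)) Poly.id Poly.id
      fun h => (h.snd.fst.poly Poly.bits).pair ((h.snd.snd.fst.poly Poly.bits).pair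
        (h.snd.snd.snd.poly Poly.bits))
  obtain ⟨P, T, ⟨k, hT⟩, -, hP⟩ := comp_rawDecision.poly h
  -- With `n = sz r ≥ 1`, the base `2^n + 2` of the polynomial bound is at most `2^(n+2) ≤ 2^(3n)`.
  refine ⟨P, 3 * k, fun r => ?_⟩
  obtain ⟨s, h1, h2⟩ := hP r (Set.mem_univ r)
  refine ⟨s, h1.trans ((hT r (Set.mem_univ r)).trans ?_), h2⟩
  have h3 : 2 ^ sz r + 2 ≤ 2 ^ (3 * sz r) := by
    have h4 : sz r + 2 ≤ 3 * sz r := by have := sz_pos r; omega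
    have h5 : 2 ^ (sz r + 2) ≤ 2 ^ (3 * sz r) := Nat.pow_le_pow_right (by omega) h4
    have h6 : 1 ≤ 2 ^ sz r := Nat.one_le_pow _ _ (by omega)
    rw [pow_add] at h5
    omega
  calc (2 ^ sz r + 2) ^ k ≤ (2 ^ (3 * sz r)) ^ k := Nat.pow_le_pow_left h3 k
    _ = 2 ^ (3 * k * sz r) := by rw [← pow_mul]; ring_nf

end CoflowScheduling

namespace CoflowScheduling

/-! ### Matchings that cover all ports of maximum load -/

/-- A matrix of natural numbers with constant row and column sums has a permutation in its
support. -/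
theorem exists_perm_of_regular {V : Type} [Fintype V] [DecidableEq V] (A : V → V → ℕ) {d : ℕ}
    (hd : 0 < d) (hrow : ∀ u, ∑ v, A u v = d) (hcol : ∀ v, ∑ u, A u v = d) :
    ∃ σ : Equiv.Perm V, ∀ u, A u (σ u) ≠ 0 := by
  let f (u : V) : Finset V := {v | A u v ≠ 0}
  -- Hall's condition by double counting: the rows in `S` have total mass `d * S.card`, all of it in
  -- columns of the neighbourhood, and each column holds only `d`.
  have hf (S : Finset V) : S.card ≤ (S.biUnion f).card := by
    have h1 : ∀ u, ∑ v ∈ f u, A u v = d := fun u => by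
      rw [← hrow u]
      exact Finset.sum_filter_ne_zero _
    refine Nat.le_of_mul_le_mul_right ?_ hd
    calc S.card * d = ∑ u ∈ S, ∑ v ∈ f u, A u v := by simp [h1]
      _ ≤ ∑ u ∈ S, ∑ v ∈ S.biUnion f, A u v := Finset.sum_le_sum fun u hu =>
        Finset.sum_le_sum_of_subset (Finset.subset_biUnion_of_mem f hu)
      _ = ∑ v ∈ S.biUnion f, ∑ u ∈ S, A u v := Finset.sum_comm
      _ ≤ ∑ v ∈ S.biUnion f, ∑ u, A u v := Finset.sum_le_sum fun v _ =>
        Finset.sum_le_sum_of_subset (Finset.subset_univ S)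
      _ = (S.biUnion f).card * d := by simp [hcol]
  obtain ⟨g, hg, hg'⟩ := (Finset.all_card_le_biUnion_card_iff_exists_injective f).1 hf
  rw [Finite.injective_iff_bijective] at hg
  exact ⟨Equiv.ofBijective g hg, fun u => by simpa [f] using hg' u⟩

/-- The weighted adjacency matrix is completed to a matrix on two copies of `V` with all row and
column sums `d`. A permutation in its support either uses a genuine edge at a port or uses the
port's slack; in the latter case the load is already below `d`. -/
theorem exists_matching_of_fintype {K V : Type} [Fintype K] [DecidableEq K] [Fintype V]
    [DecidableEq V] (src tgt : K → V) (w : K → ℕ) {d : ℕ} (hd : 0 < d)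
    (hin : ∀ v, ∑ k with src k = v, w k ≤ d) (hout : ∀ v, ∑ k with tgt k = v, w k ≤ d) :
    ∃ M : Finset K, (∀ k ∈ M, ∀ l ∈ M, src k = src l → k = l) ∧
      (∀ k ∈ M, ∀ l ∈ M, tgt k = tgt l → k = l) ∧
      (∀ v, ∑ k with src k = v, (w k - if k ∈ M then 1 else 0) ≤ d - 1) ∧
      ∀ v, ∑ k with tgt k = v, (w k - if k ∈ M then 1 else 0) ≤ d - 1 := by
  classical
  -- The diagonal blocks are the adjacency matrix and its transpose; the off-diagonal blocks are
  -- diagonal matrices of the slacks at the input and output ports.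
  let A : V ⊕ V → V ⊕ V → ℕ
    | .inl i, .inl o => ∑ k with src k = i, if tgt k = o then w k else 0
    | .inl i, .inr o => if i = o then d - ∑ k with src k = i, w k else 0
    | .inr i, .inl o => if i = o then d - ∑ k with tgt k = i, w k else 0
    | .inr i, .inr o => ∑ k with src k = o, if tgt k = i then w k else 0
  have hA1 : ∀ i, ∑ o, ∑ k with src k = i, (if tgt k = o then w k else 0) =
      ∑ k with src k = i, w k := fun i => by
    rw [Finset.sum_comm]
    simp
  have hA2 : ∀ o, ∑ i, ∑ k with src k = i, (if tgt k = o then w k else 0) =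
      ∑ k with tgt k = o, w k := fun o => by
    simp only [Finset.sum_filter]
    rw [Finset.sum_comm]
    simp
  obtain ⟨σ, hσ⟩ := exists_perm_of_regular A hd
    (by
      rintro (i | i)
      · have := hin i
        simp only [Fintype.sum_sum_type, A, hA1, Finset.sum_ite_eq, Finset.mem_univ, if_true]
        omega
      · have := hout i
        simp only [Fintype.sum_sum_type, A, hA2, Finset.sum_ite_eq, Finset.mem_univ, if_true]
        omega)
    (by
      rintro (i | i)
      · have := hout i
        simp only [Fintype.sum_sum_type, A, hA2, Finset.sum_ite_eq', Finset.mem_univ, if_true]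
        omega
      · have := hin i
        simp only [Fintype.sum_sum_type, A, hA1, Finset.sum_ite_eq', Finset.mem_univ, if_true]
        omega)
  -- Several edges may join the same two ports, for instance from different coflows. One of positive
  -- weight is chosen for each input port.
  let good (i : V) (k : K) : Prop := src k = i ∧ σ (.inl i) = .inl (tgt k) ∧ w k ≠ 0
  let M : Finset K := {k | ∃ i, ∃ h : ∃ k, good i k, k = h.choose}
  have hM : ∀ k ∈ M, σ (.inl (src k)) = .inl (tgt k) ∧ w k ≠ 0 := by
    intro k hk
    obtain ⟨i, h, rfl⟩ := (Finset.mem_filter.1 hk).2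
    obtain ⟨h1, h2⟩ := h.choose_spec
    exact ⟨(congrArg (fun i => σ (.inl i)) h1).trans h2.1, h2.2⟩
  have hsrc : ∀ k ∈ M, ∀ l ∈ M, src k = src l → k = l := by
    intro k hk l hl h
    obtain ⟨i, h1, rfl⟩ := (Finset.mem_filter.1 hk).2
    obtain ⟨j, h2, rfl⟩ := (Finset.mem_filter.1 hl).2
    have : i = j := by rw [← h1.choose_spec.1, ← h2.choose_spec.1, h]
    subst this
    rfl
  have hex : ∀ i o, σ (.inl i) = .inl o → ∃ k ∈ M, src k = i ∧ tgt k = o := by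
    intro i o h
    have h1 := hσ (.inl i)
    rw [h] at h1
    obtain ⟨k, hk, hk'⟩ := Finset.exists_ne_zero_of_sum_ne_zero h1
    have h2 : ∃ k, good i k := by
      refine ⟨k, (Finset.mem_filter.1 hk).2, ?_, ?_⟩
      · rw [h]
        by_contra h3
        exact hk' (if_neg fun h4 => h3 (by rw [h4]))
      · intro h3
        exact hk' (by rw [h3]; simp)
    obtain ⟨h3, h4, -⟩ := h2.choose_spec
    refine ⟨h2.choose, Finset.mem_filter.2 ⟨Finset.mem_univ _, i, h2, rfl⟩, h3, ?_⟩
    rw [h] at h4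
    exact (Sum.inl_injective h4).symm
  have hdec : ∀ (S : Finset K) (k : K), k ∈ S → k ∈ M → ∑ k ∈ S, w k ≤ d →
      ∑ k ∈ S, (w k - if k ∈ M then 1 else 0) ≤ d - 1 := by
    intro S k hk hkM h
    refine Nat.le_sub_one_of_lt (lt_of_lt_of_le (Finset.sum_lt_sum (fun _ _ => Nat.sub_le _ _)
      ⟨k, hk, ?_⟩) h)
    have := (hM k hkM).2
    rw [if_pos hkM]
    omega
  have hslack : ∀ S : Finset K, d - ∑ k ∈ S, w k ≠ 0 →
      ∑ k ∈ S, (w k - if k ∈ M then 1 else 0) ≤ d - 1 := by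
    intro S h
    have : ∑ k ∈ S, (w k - if k ∈ M then 1 else 0) ≤ ∑ k ∈ S, w k :=
      Finset.sum_le_sum fun _ _ => Nat.sub_le _ _
    omega
  refine ⟨M, hsrc, fun k hk l hl h => hsrc k hk l hl ?_, fun v => ?_, fun v => ?_⟩
  · have := (hM k hk).1.trans ((congrArg Sum.inl h).trans (hM l hl).1.symm)
    exact Sum.inl_injective (σ.injective this)
  · rcases h : σ (.inl v) with o | o
    · obtain ⟨k, hk, h1, -⟩ := hex v o h
      exact hdec _ k (by simp [h1]) hk (hin v)
    · have h1 := hσ (.inl v)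
      rw [h] at h1
      have h2 : (if v = o then d - ∑ k with src k = v, w k else 0) ≠ 0 := h1
      exact hslack _ fun h3 => h2 (by rw [h3]; simp)
  · obtain ⟨u, hu⟩ := σ.surjective (.inl v)
    rcases u with i | i
    · obtain ⟨k, hk, -, h1⟩ := hex i v hu
      exact hdec _ k (by simp [h1]) hk (hout v)
    · have h1 := hσ (.inr i)
      rw [hu] at h1
      have h2 : (if i = v then d - ∑ k with tgt k = i, w k else 0) ≠ 0 := h1
      by_cases hiv : i = v
      · subst hiv
        exact hslack _ fun h3 => h2 (by rw [h3]; simp)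
      · exact absurd (if_neg hiv) h2

/-- In a bipartite multigraph of maximum degree at most `d`, some matching covers all vertices of
degree `d`. -/
theorem exists_matching {K V : Type} [Fintype K] [DecidableEq K] [DecidableEq V] (src tgt : K → V)
    (w : K → ℕ) {d : ℕ} (hd : 0 < d) (hin : ∀ v, ∑ k with src k = v, w k ≤ d)
    (hout : ∀ v, ∑ k with tgt k = v, w k ≤ d) :
    ∃ M : Finset K, (∀ k ∈ M, ∀ l ∈ M, src k = src l → k = l) ∧
      (∀ k ∈ M, ∀ l ∈ M, tgt k = tgt l → k = l) ∧
      (∀ v, ∑ k with src k = v, (w k - if k ∈ M then 1 else 0) ≤ d - 1) ∧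
      ∀ v, ∑ k with tgt k = v, (w k - if k ∈ M then 1 else 0) ≤ d - 1 := by
  -- Only finitely many ports occur, so `V` need not be finite; here it will be `ℕ`.
  let P : Finset V := Finset.univ.image src ∪ Finset.univ.image tgt
  have hs : ∀ k, src k ∈ P := fun k => by simp [P]
  have ht : ∀ k, tgt k ∈ P := fun k => by simp [P]
  obtain ⟨M, h1, h2, h3, h4⟩ := exists_matching_of_fintype (V := P) (fun k => ⟨src k, hs k⟩)
    (fun k => ⟨tgt k, ht k⟩) w hd (fun v => by simpa [Subtype.ext_iff] using hin v)
    (fun v => by simpa [Subtype.ext_iff] using hout v)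
  simp only [Subtype.ext_iff] at h1 h2 h3 h4
  refine ⟨M, h1, h2, fun v => ?_, fun v => ?_⟩
  · by_cases hv : v ∈ P
    · exact h3 ⟨v, hv⟩
    · rw [Finset.filter_false_of_mem fun k _ (h : src k = v) => hv (h ▸ hs k)]
      simp
  · by_cases hv : v ∈ P
    · exact h4 ⟨v, hv⟩
    · rw [Finset.filter_false_of_mem fun k _ (h : tgt k = v) => hv (h ▸ ht k)]
      simp

/-! ### Correctness of a phase -/

theorem fits_iff {d : ℕ} {es : List Entry} :
    fits d es = true ↔ (∀ i, loadIn es i ≤ d) ∧ ∀ o, loadOut es o ≤ d := by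
  have hin : ∀ i, (∀ e ∈ es, e.2.1 ≠ i) → loadIn es i = 0 := fun i h =>
    List.sum_eq_zero fun x hx => by
      obtain ⟨e, he, rfl⟩ := List.mem_map.1 hx
      simp [h e he]
  have hout : ∀ o, (∀ e ∈ es, e.2.2.1 ≠ o) → loadOut es o = 0 := fun o h =>
    List.sum_eq_zero fun x hx => by
      obtain ⟨e, he, rfl⟩ := List.mem_map.1 hx
      simp [h e he]
  simp only [fits, List.all_eq_true, Bool.and_eq_true, decide_eq_true_eq]
  refine ⟨fun h => ⟨fun i => ?_, fun o => ?_⟩, fun h e _ => ⟨h.1 _, h.2 _⟩⟩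
  · by_cases hi : ∀ e ∈ es, e.2.1 ≠ i
    · rw [hin i hi]; exact Nat.zero_le _
    · push Not at hi
      obtain ⟨e, he, rfl⟩ := hi
      exact (h e he).1
  · by_cases ho : ∀ e ∈ es, e.2.2.1 ≠ o
    · rw [hout o ho]; exact Nat.zero_le _
    · push Not at ho
      obtain ⟨e, he, rfl⟩ := ho
      exact (h e he).2

/-- Entries are the edges of a bipartite multigraph from input to output ports, weighted by amount
and indexed by list position, so that equal entries remain distinct edges. -/
theorem exists_marking {d : ℕ} (hd : 0 < d) {es : List Entry} (h : fits d es = true) :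
    ∃ a ∈ markings es, fits 1 (sent a) = true ∧ fits (d - 1) (remaining a) = true := by
  rw [fits_iff] at h
  have hsum : ∀ f : Entry → ℕ, (es.map f).sum = ∑ k : Fin es.length, f es[k] := fun f => by
    conv_lhs => rw [← List.ofFn_getElem (xs := es)]
    rw [List.map_ofFn, List.sum_ofFn]
    rfl
  obtain ⟨M, h1, h2, h3, h4⟩ := exists_matching (K := Fin es.length) (fun k => es[k].2.1)
    (fun k => es[k].2.2.1) (fun k => es[k].2.2.2) hd
    (fun v => by
      have := h.1 v
      rw [loadIn, hsum] at this
      simpa [Finset.sum_filter] using this)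
    (fun v => by
      have := h.2 v
      rw [loadOut, hsum] at this
      simpa [Finset.sum_filter] using this)
  have hcard : ∀ f : Fin es.length → ℕ, (∀ k ∈ M, ∀ l ∈ M, f k = f l → k = l) →
      ∀ v, (∑ k, if f k = v then (if k ∈ M then 1 else 0) else 0) ≤ 1 := by
    intro f hf v
    have : (∑ k, if f k = v then (if k ∈ M then 1 else 0) else 0) = (M.filter fun k => f k = v).card := by
      rw [Finset.card_filter, ← Finset.sum_filter, ← Finset.sum_filter]
      simp only [Finset.sum_const, smul_eq_mul, mul_one, Finset.filter_filter]
      rw [← Finset.card_filter]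
      congr 1
      ext k
      simp [and_comm]
    rw [this, Finset.card_le_one]
    intro k hk l hl
    rw [Finset.mem_filter] at hk hl
    exact hf k hk.1 l hl.1 (hk.2.trans hl.2.symm)
  refine ⟨List.ofFn fun k : Fin es.length => (decide (k ∈ M), es[k]), ?_, ?_, ?_⟩
  · rw [mem_markings, List.map_ofFn]
    exact List.ofFn_getElem
  · rw [fits_iff]
    refine ⟨fun i => ?_, fun o => ?_⟩
    · rw [loadIn, sent, List.map_map, List.map_ofFn, List.sum_ofFn]
      simpa using hcard (fun k => es[k].2.1) h1 i
    · rw [loadOut, sent, List.map_map, List.map_ofFn, List.sum_ofFn]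
      simpa using hcard (fun k => es[k].2.2.1) h2 o
  · rw [fits_iff]
    refine ⟨fun i => ?_, fun o => ?_⟩
    · rw [loadIn, remaining, List.map_map, List.map_ofFn, List.sum_ofFn]
      simpa [Finset.sum_filter] using h3 i
    · rw [loadOut, remaining, List.map_map, List.map_ofFn, List.sum_ofFn]
      simpa [Finset.sum_filter] using h4 o

theorem foldl_ite_prop {β : Type} {c : β → Bool} {Q : β → Prop} {l : List β} {b : β}
    (hQ : ∀ a ∈ l, c a = true → Q a) (h : Q b ∨ ∃ a ∈ l, c a = true) :
    Q (l.foldl (fun best a => if c a = true then a else best) b) := by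
  induction l generalizing b with
  | nil => simpa using h
  | cons a l ih =>
    rw [List.foldl_cons]
    refine ih (fun a ha => hQ a (List.mem_cons_of_mem _ ha)) ?_
    split
    · next ha => exact Or.inl (hQ a List.mem_cons_self ha)
    · next ha =>
      rcases h with h | ⟨a', h1, h2⟩
      · exact Or.inl h
      · rcases List.mem_cons.1 h1 with rfl | h1
        · exact absurd h2 ha
        · exact Or.inr ⟨a', h1, h2⟩

theorem slotMarking_spec {d : ℕ} (hd : 0 < d) {es : List Entry} (h : fits d es = true) :
    (slotMarking d es).map Prod.snd = es ∧ fits (d - 1) (remaining (slotMarking d es)) = true := by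
  obtain ⟨a, ha, h1, h2⟩ := exists_marking hd h
  exact foldl_ite_prop (c := fun a => fits 1 (sent a) && fits (d - 1) (remaining a))
    (Q := fun a => a.map Prod.snd = es ∧ fits (d - 1) (remaining a) = true)
    (fun a ha hc => ⟨mem_markings.1 ha, (Bool.and_eq_true_iff.1 hc).2⟩)
    (Or.inr ⟨a, ha, by simp [h1, h2]⟩)

/-- No assumption on the loads is needed because the default `[]` respects all ports. The port
capacities of the schedule therefore never depend on the success of the search. -/
theorem fits_sent_slotMarking (d : ℕ) (es : List Entry) :
    fits 1 (sent (slotMarking d es)) = true :=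
  foldl_ite_prop (c := fun a => fits 1 (sent a) && fits (d - 1) (remaining a))
    (Q := fun a => fits 1 (sent a) = true) (fun _ _ hc => (Bool.and_eq_true_iff.1 hc).1)
    (Or.inl rfl)

theorem mem_sentTriples {a : List (Bool × Entry)} {j i o : ℕ} :
    (j, i, o) ∈ sentTriples a ↔ ∃ w, (true, j, i, o, w) ∈ a := by
  rw [sentTriples, List.mem_flatMap]
  constructor
  · rintro ⟨⟨b, j', i', o', w⟩, h1, h2⟩
    cases b
    · simp at h2
    · simp only [if_true, List.mem_singleton, Prod.mk.injEq] at h2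
      obtain ⟨rfl, rfl, rfl⟩ := h2
      exact ⟨w, h1⟩
  · rintro ⟨w, h⟩
    exact ⟨_, h, by simp⟩

/-- Everything is sent within `d` slots. -/
theorem le_sum_sentTriples {d : ℕ} {es : List Entry} (h : fits d es = true) {j i o w : ℕ}
    (he : (j, i, o, w) ∈ es) : w ≤ ∑ n ∈ Finset.range d, if (j, i, o) ∈ sentTriples
      (slotMarking (advance^[n] (es, d)).2 (advance^[n] (es, d)).1) then 1 else 0 := by
  -- For `d = 0` all loads vanish, hence so does `w`. Otherwise the first slot leaves entries that
  -- fit in `d - 1` slots and lowers `w` by one only if it sends the corresponding unit.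
  induction d generalizing es w with
  | zero =>
    have h1 := (fits_iff.1 h).1 i
    have h2 : (if decide (i = i) = true then w else 0) ≤ loadIn es i :=
      List.single_le_sum (fun _ _ => Nat.zero_le _) _ (List.mem_map.2 ⟨_, he, rfl⟩)
    simp only [decide_true, if_true] at h2
    omega
  | succ d ih =>
    obtain ⟨h1, h2⟩ := slotMarking_spec (d := d + 1) (by omega) h
    rw [Nat.add_sub_cancel] at h2
    rw [← h1] at he
    obtain ⟨⟨b, e⟩, hp, rfl : e = _⟩ := List.mem_map.1 he
    have h3 : (j, i, o, w - if b = true then 1 else 0) ∈ remaining (slotMarking (d + 1) es) :=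
      List.mem_map.2 ⟨_, hp, rfl⟩
    have h4 := ih h2 h3
    rw [Finset.sum_range_succ']
    have h5 : (if b = true then 1 else 0) ≤ if (j, i, o) ∈ sentTriples (slotMarking
        (advance^[0] (es, d + 1)).2 (advance^[0] (es, d + 1)).1) then 1 else 0 := by
      cases b
      · exact Nat.zero_le _
      · rw [if_pos (show (j, i, o) ∈ sentTriples (slotMarking (advance^[0] (es, d + 1)).2
          (advance^[0] (es, d + 1)).1) from mem_sentTriples.2 ⟨w, hp⟩)]
        simp
    have h6 : (remaining (slotMarking (d + 1) es), d) = advance (es, d + 1) := rfl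
    simp only [h6, ← Function.iterate_succ_apply, Nat.succ_eq_add_one] at h4
    omega

theorem length_filter_sentTriples_in (a : List (Bool × Entry)) (i : ℕ) :
    ((sentTriples a).filter fun e => e.2.1 = i).length = loadIn (sent a) i := by
  induction a with
  | nil => rfl
  | cons p a ih =>
    have h1 : sentTriples (p :: a) = (if p.1 = true then [(p.2.1, p.2.2.1, p.2.2.2.1)] else []) ++
      sentTriples a := rfl
    have h2 : loadIn (sent (p :: a)) i = (if decide (p.2.2.1 = i) = true then
      (if p.1 = true then 1 else 0) else 0) + loadIn (sent a) i := rfl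
    rw [h1, h2, List.filter_append, List.length_append, ih]
    congr 1
    cases p.1 <;> by_cases h : p.2.2.1 = i <;> simp [h]

theorem length_filter_sentTriples_out (a : List (Bool × Entry)) (o : ℕ) :
    ((sentTriples a).filter fun e => e.2.2 = o).length = loadOut (sent a) o := by
  induction a with
  | nil => rfl
  | cons p a ih =>
    have h1 : sentTriples (p :: a) = (if p.1 = true then [(p.2.1, p.2.2.1, p.2.2.2.1)] else []) ++
      sentTriples a := rfl
    have h2 : loadOut (sent (p :: a)) o = (if decide (p.2.2.2.1 = o) = true then
      (if p.1 = true then 1 else 0) else 0) + loadOut (sent a) o := rfl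
    rw [h1, h2, List.filter_append, List.length_append, ih]
    congr 1
    cases p.1 <;> by_cases h : p.2.2.2.1 = o <;> simp [h]

theorem length_filter_phaseDecision_in (d n : ℕ) (js : List Candidate) (i : ℕ) :
    ((phaseDecision d n js).filter fun e => e.2.1 = i).length ≤ 1 := by
  rw [phaseDecision, length_filter_sentTriples_in]
  exact (fits_iff.1 (fits_sent_slotMarking _ _)).1 i

theorem length_filter_phaseDecision_out (d n : ℕ) (js : List Candidate) (o : ℕ) :
    ((phaseDecision d n js).filter fun e => e.2.2 = o).length ≤ 1 := by
  rw [phaseDecision, length_filter_sentTriples_out]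
  exact (fits_iff.1 (fits_sent_slotMarking _ _)).2 o

theorem mem_of_mem_slotMarking {d : ℕ} {es : List Entry} {p : Bool × Entry}
    (h : p ∈ slotMarking d es) : p.2 ∈ es := by
  rcases slotMarking_eq_nil_or d es with h1 | h1
  · rw [h1] at h
    simp at h
  · rw [← mem_markings.1 h1]
    exact List.mem_map_of_mem h

theorem exists_mem_selected_of_mem_residual {d n : ℕ} {js : List Candidate} {j i o w : ℕ}
    (h : (j, i, o, w) ∈ (residual d n js).1) :
    ∃ w', (j, i, o, w') ∈ selected (bestSelection d js) := by
  induction n generalizing w with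
  | zero => exact ⟨w, h⟩
  | succ n ih =>
    rw [residual, Function.iterate_succ_apply'] at h
    obtain ⟨⟨b, j', i', o', w'⟩, hp, h1⟩ := List.mem_map.1 h
    simp only [Prod.mk.injEq] at h1
    obtain ⟨rfl, rfl, rfl, -⟩ := h1
    exact ih (mem_of_mem_slotMarking hp)

theorem exists_mem_selected_of_mem_phaseDecision {d n : ℕ} {js : List Candidate} {j i o : ℕ}
    (h : (j, i, o) ∈ phaseDecision d n js) :
    ∃ w, (j, i, o, w) ∈ selected (bestSelection d js) := by
  obtain ⟨w, hw⟩ := mem_sentTriples.1 h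
  exact exists_mem_selected_of_mem_residual (mem_of_mem_slotMarking hw)

theorem fits_bestSelection (d : ℕ) (js : List Candidate) :
    fits d (selected (bestSelection d js)) = true := by
  have key : ∀ (c : List (Bool × Candidate) → List (Bool × Candidate) → Bool)
      (l : List (List (Bool × Candidate))) b, fits d (selected b) = true →
      fits d (selected (l.foldl (fun best a =>
        if (fits d (selected a) && c best a) = true then a else best) b)) = true := by
    intro c l
    induction l with
    | nil => exact fun _ h => h
    | cons a l ih =>
      intro b hb
      rw [List.foldl_cons]
      refine ih _ ?_
      split
      · next h => exact (Bool.and_eq_true_iff.1 h).1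
      · exact hb
  exact key _ _ _ rfl

theorem le_sum_phaseDecision {d : ℕ} {js : List Candidate} {j i o w : ℕ}
    (h : (j, i, o, w) ∈ selected (bestSelection d js)) :
    w ≤ ∑ n ∈ Finset.range d, if (j, i, o) ∈ phaseDecision d n js then 1 else 0 :=
  le_sum_sentTriples (fits_bestSelection d js) h

/-! ### Optimality of the selection -/

/-- The value of a fraction. -/
def fractionValue (p : ℕ × ℕ) : ℚ := p.1 / p.2

theorem selectedWeight_den_pos {a : List (Bool × Candidate)} (h : ∀ p ∈ a, 0 < p.2.2.2) :
    0 < (selectedWeight a).2 := by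
  induction a with
  | nil => exact Nat.one_pos
  | cons p a ih =>
    have h1 : selectedWeight (p :: a) = if p.1 = true then ((selectedWeight a).1 * p.2.2.2 +
      p.2.2.1 * (selectedWeight a).2, (selectedWeight a).2 * p.2.2.2) else selectedWeight a := rfl
    have h2 := ih fun q hq => h q (List.mem_cons_of_mem _ hq)
    rw [h1]
    split
    · exact Nat.mul_pos h2 (h p List.mem_cons_self)
    · exact h2

theorem fractionValue_selectedWeight {a : List (Bool × Candidate)} (h : ∀ p ∈ a, 0 < p.2.2.2) :
    fractionValue (selectedWeight a) =
      (a.map fun p => if p.1 = true then fractionValue p.2.2 else 0).sum := by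
  induction a with
  | nil => simp [selectedWeight, fractionValue]
  | cons p a ih =>
    have h1 : selectedWeight (p :: a) = if p.1 = true then ((selectedWeight a).1 * p.2.2.2 +
      p.2.2.1 * (selectedWeight a).2, (selectedWeight a).2 * p.2.2.2) else selectedWeight a := rfl
    have h2 := ih fun q hq => h q (List.mem_cons_of_mem _ hq)
    have h3 : ((selectedWeight a).2 : ℚ) ≠ 0 := by
      have := selectedWeight_den_pos fun q hq => h q (List.mem_cons_of_mem _ hq)
      positivity
    have h4 : (p.2.2.2 : ℚ) ≠ 0 := by
      have := h p List.mem_cons_self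
      positivity
    rw [h1, List.map_cons, List.sum_cons, ← h2]
    split
    · simp only [fractionValue]
      push_cast
      field_simp
      ring
    · rw [zero_add]

theorem fractionValue_le_iff {p q : ℕ × ℕ} (hp : 0 < p.2) (hq : 0 < q.2) :
    fractionValue p ≤ fractionValue q ↔ p.1 * q.2 ≤ q.1 * p.2 := by
  rw [fractionValue, fractionValue, div_le_div_iff₀ (by positivity) (by positivity)]
  exact_mod_cast Iff.rfl

/-- The comparison has to agree with `v` only on the elements met by the search:
cross-multiplication is correct only for fractions with positive denominators. -/
theorem foldl_argmax {β : Type} {c : β → Bool} {le : β → β → Bool} {v : β → ℚ} {l : List β} {b : β}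
    (hle : ∀ x ∈ b :: l, ∀ y ∈ b :: l, le x y = true ↔ v x ≤ v y) :
    v b ≤ v (l.foldl (fun best a => if (c a && le best a) = true then a else best) b) ∧
      ∀ a ∈ l, c a = true →
        v a ≤ v (l.foldl (fun best a => if (c a && le best a) = true then a else best) b) := by
  induction l generalizing b with
  | nil => simp
  | cons a l ih =>
    rw [List.foldl_cons]
    have h1 : ∀ b', b' = a ∨ b' = b → ∀ x ∈ b' :: l, ∀ y ∈ b' :: l, le x y = true ↔ v x ≤ v y := by
      intro b' hb' x hx y hy
      refine hle x ?_ y ?_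
      · rcases List.mem_cons.1 hx with rfl | hx
        · rcases hb' with rfl | rfl <;> simp
        · simp [hx]
      · rcases List.mem_cons.1 hy with rfl | hy
        · rcases hb' with rfl | rfl <;> simp
        · simp [hy]
    have h2 := hle b (by simp) a (by simp)
    by_cases hc : (c a && le b a) = true
    · rw [if_pos hc]
      obtain ⟨h3, h4⟩ := ih (h1 a (Or.inl rfl))
      rw [Bool.and_eq_true, h2] at hc
      refine ⟨hc.2.trans h3, fun a' ha' hca' => ?_⟩
      rcases List.mem_cons.1 ha' with rfl | ha'
      · exact h3
      · exact h4 a' ha' hca'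
    · rw [if_neg hc]
      obtain ⟨h3, h4⟩ := ih (h1 b (Or.inr rfl))
      refine ⟨h3, fun a' ha' hca' => ?_⟩
      rcases List.mem_cons.1 ha' with rfl | ha'
      · rw [Bool.and_eq_true, h2, not_and] at hc
        exact (not_le.1 (hc hca')).le.trans h3
      · exact h4 a' ha' hca'

/-- The value of the marked candidates. -/
def markedValue (a : List (Bool × Candidate)) : ℚ :=
  (a.map fun p => if p.1 = true then fractionValue p.2.2 else 0).sum

theorem weight_le_iff {js : List Candidate} (hjs : ∀ c ∈ js, 0 < c.2.2)
    {a b : List (Bool × Candidate)} (ha : a = [] ∨ a ∈ markings js) (hb : b = [] ∨ b ∈ markings js) :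
    decide ((selectedWeight a).1 * (selectedWeight b).2 ≤
      (selectedWeight b).1 * (selectedWeight a).2) = true ↔ markedValue a ≤ markedValue b := by
  have key : ∀ a : List (Bool × Candidate), a = [] ∨ a ∈ markings js → ∀ p ∈ a, 0 < p.2.2.2 := by
    rintro a (rfl | h) p hp
    · simp at hp
    · rw [mem_markings] at h
      exact hjs _ (h ▸ List.mem_map_of_mem hp)
  rw [decide_eq_true_eq, ← fractionValue_le_iff (selectedWeight_den_pos (key a ha))
    (selectedWeight_den_pos (key b hb)), fractionValue_selectedWeight (key a ha),
    fractionValue_selectedWeight (key b hb), markedValue, markedValue]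

theorem markedValue_le_bestSelection {d : ℕ} {js : List Candidate} (hjs : ∀ c ∈ js, 0 < c.2.2)
    {a : List (Bool × Candidate)} (ha : a ∈ markings js) (h : fits d (selected a) = true) :
    markedValue a ≤ markedValue (bestSelection d js) := by
  refine (foldl_argmax (c := fun a => fits d (selected a)) (v := markedValue) (l := markings js)
    (b := []) (le := fun a b => decide ((selectedWeight a).1 * (selectedWeight b).2 ≤
      (selectedWeight b).1 * (selectedWeight a).2)) fun x hx y hy => weight_le_iff hjs ?_ ?_).2 a ha h
  · simpa using hx
  · simpa using hy

theorem exists_markings_eq_concat {β : Type} (l : List β) :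
    ∃ L, markings l = L ++ [l.map fun b => (true, b)] := by
  induction l with
  | nil => exact ⟨[], rfl⟩
  | cons b l ih =>
    obtain ⟨L, hL⟩ := ih
    rw [markings_cons, hL]
    exact ⟨_, by rw [List.map_append (l₁ := L) (f := fun a => (true, b) :: a), ← List.append_assoc]
                 rfl⟩

theorem markedValue_le_all {js : List Candidate} {a : List (Bool × Candidate)}
    (ha : a = [] ∨ a ∈ markings js) : markedValue a ≤ markedValue (js.map fun b => (true, b)) := by
  have h0 : ∀ p, 0 ≤ fractionValue p := fun p => by rw [fractionValue]; positivity
  rcases ha with rfl | ha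
  · refine List.sum_nonneg fun x hx => ?_
    obtain ⟨p, -, rfl⟩ := List.mem_map.1 hx
    split
    · exact h0 _
    · exact le_rfl
  · rw [mem_markings] at ha
    subst ha
    rw [markedValue, markedValue, List.map_map, List.map_map]
    refine List.sum_le_sum fun p _ => ?_
    dsimp only [Function.comp]
    split
    · simp
    · simpa using h0 _

/-- The marking of all candidates comes last in `markings` and has maximal value, so it wins every
tie. Maximality of the weight alone would allow coflows of weight zero to be left out forever, and
the schedule would not be feasible. -/
theorem bestSelection_eq_all {d : ℕ} {js : List Candidate} (hjs : ∀ c ∈ js, 0 < c.2.2)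
    (h : fits d (selected (js.map fun b => (true, b))) = true) :
    bestSelection d js = js.map fun b => (true, b) := by
  obtain ⟨L, hL⟩ := exists_markings_eq_concat js
  have h1 := foldl_ite_mem (fun best a => fits d (selected a) && decide ((selectedWeight best).1 *
    (selectedWeight a).2 ≤ (selectedWeight a).1 * (selectedWeight best).2)) L []
  rw [bestSelection, hL, List.foldl_append, List.foldl_cons, List.foldl_nil, if_pos]
  rw [Bool.and_eq_true]
  have h2 : L.foldl (fun best a => if (fits d (selected a) && decide ((selectedWeight best).1 *
      (selectedWeight a).2 ≤ (selectedWeight a).1 * (selectedWeight best).2)) = true then a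
      else best) [] = [] ∨ L.foldl (fun best a => if (fits d (selected a) &&
      decide ((selectedWeight best).1 * (selectedWeight a).2 ≤
      (selectedWeight a).1 * (selectedWeight best).2)) = true then a else best) [] ∈ markings js :=
    h1.imp_right fun h => by rw [hL]; exact List.mem_append_left _ h
  exact ⟨h, (weight_le_iff hjs h2 (Or.inr (by rw [hL]; simp))).2 (markedValue_le_all h2)⟩

end CoflowScheduling

namespace CoflowScheduling

open Enc (enc)

/-! ### The online algorithm on instances -/

def rawCoflow {m : ℕ} (c : Coflow m) : RawCoflow :=
  (List.ofFn fun i => List.ofFn fun o => (c.demand i o).bits,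
    (c.weight.num.bits, c.weight.den.bits), c.release.num.bits, c.release.den.bits)

def rawInput (t : ℕ) (I : Instance) : RawInput := (t.bits, I.m.bits, I.coflows.map rawCoflow)

theorem encodeList_eq_map {α β : Type} (f : β → Data) (g : α → β) (l : List α) :
    encodeList (fun a => f (g a)) l = encodeList f (l.map g) := by
  induction l with
  | nil => rfl
  | cons a l ih => exact congrArg (Data.cons _) ih

theorem enc_rawCoflow {m : ℕ} (c : Coflow m) : enc (rawCoflow c) = c.encode := by
  refine congrArg (fun d => Data.cons d _) ?_
  have h : (List.ofFn fun i => List.ofFn fun o => (c.demand i o).bits) =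
      (List.ofFn fun i => List.ofFn fun o => c.demand i o).map (List.map Nat.bits) := by
    rw [List.map_ofFn]
    congr 1
    ext1 i
    rw [Function.comp_apply, List.map_ofFn]
    rfl
  have h2 : (fun l : List ℕ => encodeList encodeNat l) = fun l => enc (l.map Nat.bits) := by
    ext1 l
    exact encodeList_eq_map enc Nat.bits l
  exact (congrArg enc h).trans ((encodeList_eq_map enc (List.map Nat.bits) _).symm.trans
    (congrArg (encodeList · _) h2.symm))

/-- The two trees are literally equal, so the program built for lists of digits runs on the
prescribed input without any parsing. -/
theorem enc_rawInput (t : ℕ) (I : Instance) :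
    enc (rawInput t I) = .cons (encodeNat t) I.encode := by
  refine congrArg (fun d => Data.cons (encodeNat t) (Data.cons (encodeNat I.m) d)) ?_
  refine (encodeList_eq_map enc rawCoflow I.coflows).symm.trans ?_
  congr 1
  ext1 c
  exact enc_rawCoflow c

/-- The online algorithm. -/
def algorithm : OnlineAlgorithm := fun t I => rawDecision (rawInput t I)

theorem exists_prog_algorithm : ∃ (P : Prog) (c : ℕ), ∀ (I : Instance) (t : ℕ),
    ∃ s ≤ 2 ^ (c * (I.onlineInput t).size),
      Eval P (I.onlineInput t) (algorithm.decisionAt I t).encode s := by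
  obtain ⟨P, c, h⟩ := exists_prog_binaryDecision
  refine ⟨P, c, fun I t => ?_⟩
  obtain ⟨s, h1, h2⟩ := h (rawInput t (I.revealed t))
  have h3 : enc (binaryDecision (rawInput t (I.revealed t))) =
      (algorithm.decisionAt I t).encode :=
    (encodeList_eq_map enc (fun e : ℕ × ℕ × ℕ => (e.1.bits, e.2.1.bits, e.2.2.bits)) _).symm
  rw [sz, enc_rawInput] at h1
  rw [enc_rawInput, h3] at h2
  exact ⟨s, h1, h2⟩

/-! ### Candidates of an instance -/

theorem indexed_eq_zipIdx {β : Type} (l : List β) : indexed l = l.zipIdx.reverse := by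
  induction l using List.reverseRecOn with
  | nil => rfl
  | append_singleton l b ih =>
    rw [indexed_concat, length_indexed, List.zipIdx_append, List.reverse_append, ih]
    simp

theorem indexed_ofFn {β : Type} {m : ℕ} (f : Fin m → β) :
    indexed (List.ofFn f) = (List.ofFn fun k => (f k, (k : ℕ))).reverse := by
  rw [indexed_eq_zipIdx]
  congr 1
  refine List.ext_getElem (by simp) fun n h1 h2 => ?_
  simp

theorem flatMap_ite {β γ : Type} (c : β → Bool) (f : β → γ) (l : List β) :
    (l.flatMap fun b => if c b = true then [f b] else []) = (l.filter c).map f := by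
  induction l with
  | nil => rfl
  | cons b l ih =>
    rw [List.flatMap_cons, ih]
    cases h : c b <;> simp [h]

variable {I : Instance}

/-- The jobs released by time `d`. -/
def releasedJobs (I : Instance) (d : ℕ) : List I.Job :=
  ((List.finRange I.coflows.length).filter fun j =>
    decide ((I.coflows.get j).release ≤ (d : ℚ≥0))).reverse

def jobCandidate (I : Instance) (j : I.Job) : Candidate :=
  (demandEntries (rawCoflow (I.coflows.get j)).1 j, (I.coflows.get j).weight.num,
    (I.coflows.get j).weight.den)

/-- The candidates offered to the phase starting at time `d`. -/
def instanceCandidates (I : Instance) (d : ℕ) : List Candidate :=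
  candidates d (I.coflows.map rawCoflow)

theorem nnrat_le_natCast_iff (q : ℚ≥0) (d : ℕ) : q ≤ (d : ℚ≥0) ↔ q.num ≤ q.den * d := by
  conv_lhs => rw [← NNRat.num_div_den q]
  have : (0 : ℚ≥0) < q.den := by exact_mod_cast q.den_pos
  rw [div_le_iff₀ this, mul_comm]
  exact_mod_cast Iff.rfl

theorem instanceCandidates_eq (d : ℕ) :
    instanceCandidates I d = (releasedJobs I d).map (jobCandidate I) := by
  have h : I.coflows.map rawCoflow = List.ofFn fun j : I.Job => rawCoflow (I.coflows.get j) := by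
    conv_lhs => rw [← List.ofFn_get I.coflows]
    rw [List.map_ofFn]
    rfl
  rw [instanceCandidates, candidates, h, indexed_ofFn, flatMap_ite, List.ofFn_eq_map,
    ← List.map_reverse, List.filter_map, List.map_map, releasedJobs, ← List.filter_reverse]
  congr 1
  · ext1 j
    simp only [Function.comp_apply, rawCoflow, ofBits_bits, jobCandidate]
  · congr 1
    ext1 j
    simp only [Function.comp_apply, rawCoflow, ofBits_bits, nnrat_le_natCast_iff]

theorem mem_releasedJobs {d : ℕ} {j : I.Job} :
    j ∈ releasedJobs I d ↔ (I.coflows.get j).release ≤ (d : ℚ≥0) := by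
  simp [releasedJobs]

theorem nodup_releasedJobs (d : ℕ) : (releasedJobs I d).Nodup :=
  List.nodup_reverse.2 ((List.nodup_finRange _).filter _)

/-- The marking of the released jobs given by a set of jobs. -/
def jobMarking (I : Instance) (d : ℕ) (S : Finset I.Job) : List (Bool × Candidate) :=
  (releasedJobs I d).map fun j => (decide (j ∈ S), jobCandidate I j)

theorem jobMarking_mem_markings (d : ℕ) (S : Finset I.Job) :
    jobMarking I d S ∈ markings (instanceCandidates I d) := by
  rw [mem_markings, instanceCandidates_eq, jobMarking, List.map_map]
  rfl

/-- Since `L` has no repetitions, marks attached to positions are marks attached to elements. This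
turns markings of candidates into sets of jobs. -/
theorem exists_marking_function {β γ : Type} [DecidableEq β] {L : List β} (hL : L.Nodup) {c : β → γ}
    {a : List (Bool × γ)} (ha : a.map Prod.snd = L.map c) :
    ∃ b : β → Bool, a = L.map fun j => (b j, c j) := by
  induction L generalizing a with
  | nil => exact ⟨fun _ => true, by simpa using ha⟩
  | cons j L ih =>
    rw [List.map_cons, List.map_eq_cons_iff] at ha
    obtain ⟨p, a, rfl, h1, h2⟩ := ha
    rw [List.nodup_cons] at hL
    obtain ⟨b, rfl⟩ := ih hL.2 h2
    refine ⟨Function.update b j p.1, ?_⟩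
    rw [List.map_cons, Function.update_self, ← h1]
    refine congrArg (p :: ·) (List.map_congr_left fun k hk => ?_)
    rw [Function.update_of_ne (fun h : k = j => hL.1 (h ▸ hk))]

theorem exists_jobMarking {d : ℕ} {a : List (Bool × Candidate)}
    (ha : a ∈ markings (instanceCandidates I d)) :
    ∃ S : Finset I.Job, (∀ j ∈ S, j ∈ releasedJobs I d) ∧ a = jobMarking I d S := by
  rw [mem_markings, instanceCandidates_eq] at ha
  obtain ⟨b, rfl⟩ := exists_marking_function (nodup_releasedJobs d) ha
  refine ⟨(releasedJobs I d).toFinset.filter fun j => b j = true, fun j hj => ?_, ?_⟩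
  · exact List.mem_toFinset.1 (Finset.mem_filter.1 hj).1
  · refine List.map_congr_left fun j hj => ?_
    simp [hj]

theorem loadIn_flatMap {β : Type} (f : β → List Entry) (l : List β) (i : ℕ) :
    loadIn (l.flatMap f) i = (l.map fun b => loadIn (f b) i).sum := by
  induction l with
  | nil => rfl
  | cons b l ih =>
    rw [List.flatMap_cons, List.map_cons, List.sum_cons, ← ih, loadIn, List.map_append,
      List.sum_append]
    rfl

theorem loadOut_flatMap {β : Type} (f : β → List Entry) (l : List β) (o : ℕ) :
    loadOut (l.flatMap f) o = (l.map fun b => loadOut (f b) o).sum := by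
  induction l with
  | nil => rfl
  | cons b l ih =>
    rw [List.flatMap_cons, List.map_cons, List.sum_cons, ← ih, loadOut, List.map_append,
      List.sum_append]
    rfl

theorem sum_map_indexed_ofFn {β : Type} {m : ℕ} (f : Fin m → β) (g : β × ℕ → ℕ) :
    ((indexed (List.ofFn f)).map g).sum = ∑ k, g (f k, k) := by
  rw [indexed_ofFn, List.map_reverse, List.sum_reverse, List.map_ofFn, List.sum_ofFn]
  rfl

theorem loadIn_demandEntries {m : ℕ} (c : Coflow m) (j i : ℕ) :
    loadIn (demandEntries (rawCoflow c).1 j) i =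
      ∑ r : Fin m, if (r : ℕ) = i then ∑ o, c.demand r o else 0 := by
  rw [demandEntries, loadIn_flatMap, rawCoflow, sum_map_indexed_ofFn]
  refine Finset.sum_congr rfl fun r _ => ?_
  rw [loadIn, List.map_map, sum_map_indexed_ofFn]
  simp only [Function.comp_apply, ofBits_bits, decide_eq_true_eq]
  split <;> simp

theorem loadOut_demandEntries {m : ℕ} (c : Coflow m) (j o : ℕ) :
    loadOut (demandEntries (rawCoflow c).1 j) o =
      ∑ s : Fin m, if (s : ℕ) = o then ∑ i, c.demand i s else 0 := by
  rw [demandEntries, loadOut_flatMap, rawCoflow, sum_map_indexed_ofFn]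
  simp only [loadOut, List.map_map, sum_map_indexed_ofFn,
    Function.comp_apply, ofBits_bits, decide_eq_true_eq]
  rw [Finset.sum_comm]
  refine Finset.sum_congr rfl fun s _ => ?_
  split <;> simp

theorem mem_demandEntries {m : ℕ} (c : Coflow m) {j : ℕ} {e : Entry} :
    e ∈ demandEntries (rawCoflow c).1 j ↔ ∃ i o : Fin m, e = (j, (i : ℕ), (o : ℕ), c.demand i o) := by
  simp only [demandEntries, rawCoflow, indexed_ofFn, List.mem_flatMap, List.mem_reverse,
    List.mem_ofFn, List.mem_map]
  constructor
  · rintro ⟨_, ⟨i, rfl⟩, h⟩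
    simp only [indexed_ofFn, List.mem_reverse, List.mem_ofFn] at h
    obtain ⟨_, ⟨o, rfl⟩, rfl⟩ := h
    exact ⟨i, o, by rw [ofBits_bits]⟩
  · rintro ⟨i, o, rfl⟩
    refine ⟨_, ⟨i, rfl⟩, ?_⟩
    simp only [indexed_ofFn, List.mem_reverse, List.mem_ofFn]
    exact ⟨_, ⟨o, rfl⟩, by rw [ofBits_bits]⟩

theorem sum_map_releasedJobs {M : Type} [AddCommMonoid M] {d : ℕ} {S : Finset I.Job}
    (hS : ∀ j ∈ S, j ∈ releasedJobs I d) (f : I.Job → M) :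
    ((releasedJobs I d).map fun j => if j ∈ S then f j else 0).sum = ∑ j ∈ S, f j := by
  rw [← List.sum_toFinset _ (nodup_releasedJobs d), ← Finset.sum_filter]
  congr 1
  ext j
  simpa using hS j

theorem loadIn_jobMarking {d : ℕ} {S : Finset I.Job} (hS : ∀ j ∈ S, j ∈ releasedJobs I d) (i : ℕ) :
    loadIn (selected (jobMarking I d S)) i =
      ∑ r : Fin I.m, if (r : ℕ) = i then ∑ j ∈ S, ∑ o, I.demand j r o else 0 := by
  have h : ∀ j : I.Job, loadIn (if decide (j ∈ S) = true then (jobCandidate I j).1 else []) i =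
      if j ∈ S then ∑ r : Fin I.m, (if (r : ℕ) = i then ∑ o, I.demand j r o else 0) else 0 := by
    intro j
    by_cases hj : j ∈ S
    · rw [if_pos hj, if_pos (by simpa using hj)]
      exact loadIn_demandEntries _ _ _
    · rw [if_neg hj, if_neg (by simpa using hj)]
      rfl
  rw [selected, loadIn_flatMap, jobMarking, List.map_map]
  refine (congrArg List.sum (List.map_congr_left fun j _ => h j)).trans ?_
  rw [sum_map_releasedJobs hS, Finset.sum_comm]
  refine Finset.sum_congr rfl fun r _ => ?_
  split <;> simp

theorem loadOut_jobMarking {d : ℕ} {S : Finset I.Job} (hS : ∀ j ∈ S, j ∈ releasedJobs I d) (o : ℕ) :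
    loadOut (selected (jobMarking I d S)) o =
      ∑ r : Fin I.m, if (r : ℕ) = o then ∑ j ∈ S, ∑ i, I.demand j i r else 0 := by
  have h : ∀ j : I.Job, loadOut (if decide (j ∈ S) = true then (jobCandidate I j).1 else []) o =
      if j ∈ S then ∑ r : Fin I.m, (if (r : ℕ) = o then ∑ i, I.demand j i r else 0) else 0 := by
    intro j
    by_cases hj : j ∈ S
    · rw [if_pos hj, if_pos (by simpa using hj)]
      exact loadOut_demandEntries _ _ _
    · rw [if_neg hj, if_neg (by simpa using hj)]
      rfl
  rw [selected, loadOut_flatMap, jobMarking, List.map_map]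
  refine (congrArg List.sum (List.map_congr_left fun j _ => h j)).trans ?_
  rw [sum_map_releasedJobs hS, Finset.sum_comm]
  refine Finset.sum_congr rfl fun r _ => ?_
  split <;> simp

theorem fits_jobMarking {d : ℕ} {S : Finset I.Job} (hS : ∀ j ∈ S, j ∈ releasedJobs I d)
    (hin : ∀ i, ∑ j ∈ S, ∑ o, I.demand j i o ≤ d) (hout : ∀ o, ∑ j ∈ S, ∑ i, I.demand j i o ≤ d) :
    fits d (selected (jobMarking I d S)) = true := by
  have key : ∀ (f : Fin I.m → ℕ), (∀ r, f r ≤ d) → ∀ i : ℕ,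
      (∑ r : Fin I.m, if r.val = i then f r else 0) ≤ d := by
    intro f hf i
    by_cases hi : i < I.m
    · have : ∀ r : Fin I.m, (r : ℕ) = i ↔ r = ⟨i, hi⟩ := fun r => by rw [Fin.ext_iff]
      simp only [this, Finset.sum_ite_eq', Finset.mem_univ, if_true]
      exact hf _
    · rw [Finset.sum_eq_zero fun (r : Fin I.m) _ => if_neg fun (h : r.val = i) => hi (h ▸ r.2)]
      exact Nat.zero_le d
  rw [fits_iff]
  refine ⟨fun i => ?_, fun o => ?_⟩
  · rw [loadIn_jobMarking hS]
    exact key _ hin i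
  · rw [loadOut_jobMarking hS]
    exact key _ hout o

theorem markedValue_jobMarking {d : ℕ} {S : Finset I.Job} (hS : ∀ j ∈ S, j ∈ releasedJobs I d) :
    ((markedValue (jobMarking I d S) : ℚ) : ℝ) = ∑ j ∈ S, I.weight j := by
  have h : ∀ j : I.Job, fractionValue (jobCandidate I j).2 = ((I.coflows.get j).weight : ℚ) := by
    intro j
    rw [← NNRat.num_div_den (I.coflows.get j).weight]
    rfl
  have h2 : markedValue (jobMarking I d S) = ∑ j ∈ S, ((I.coflows.get j).weight : ℚ) := by
    rw [← sum_map_releasedJobs hS, markedValue, jobMarking, List.map_map]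
    refine congrArg List.sum (List.map_congr_left fun j _ => ?_)
    simp only [Function.comp_apply, h, decide_eq_true_eq]
  rw [h2]
  push_cast
  rfl

theorem instanceCandidates_den_pos (d : ℕ) : ∀ c ∈ instanceCandidates I d, 0 < c.2.2 := by
  intro c hc
  rw [instanceCandidates_eq] at hc
  obtain ⟨j, -, rfl⟩ := List.mem_map.1 hc
  exact NNRat.den_pos _

theorem mem_selected_jobMarking {d : ℕ} {S : Finset I.Job} {e : Entry} :
    e ∈ selected (jobMarking I d S) ↔ ∃ j ∈ releasedJobs I d, j ∈ S ∧
      ∃ i o : Fin I.m, e = ((j : ℕ), (i : ℕ), (o : ℕ), I.demand j i o) := by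
  have h : ∀ j : I.Job, e ∈ (jobCandidate I j).1 ↔
      ∃ i o : Fin I.m, e = ((j : ℕ), (i : ℕ), (o : ℕ), I.demand j i o) := fun j => mem_demandEntries _
  simp only [selected, jobMarking, List.mem_flatMap, List.mem_map]
  constructor
  · rintro ⟨_, ⟨j, hj, rfl⟩, he⟩
    by_cases hjS : j ∈ S
    · rw [if_pos (by simpa using hjS), h] at he
      exact ⟨j, hj, hjS, he⟩
    · rw [if_neg (by simpa using hjS)] at he
      simp at he
  · rintro ⟨j, hj, hjS, he⟩
    refine ⟨_, ⟨j, hj, rfl⟩, ?_⟩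
    rw [if_pos (by simpa using hjS), h]
    exact he

/-- All that the analysis needs about a phase. In order: the batch is released; so is everything
that is sent; the batch is fully transferred in `d` slots; it is heaviest among admissible sets; and
it contains every job as soon as this is admissible. -/
theorem exists_batch (I : Instance) (d : ℕ) : ∃ B : Finset I.Job,
    (∀ j ∈ B, (I.coflows.get j).release ≤ (d : ℚ≥0)) ∧
    (∀ (j : I.Job) (i o n : ℕ), ((j : ℕ), i, o) ∈ phaseDecision d n (instanceCandidates I d) →
      (I.coflows.get j).release ≤ (d : ℚ≥0)) ∧
    (∀ j ∈ B, ∀ i o : Fin I.m, I.demand j i o ≤ ∑ n ∈ Finset.range d,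
      if ((j : ℕ), (i : ℕ), (o : ℕ)) ∈ phaseDecision d n (instanceCandidates I d) then 1 else 0) ∧
    (∀ S : Finset I.Job, (∀ j ∈ S, (I.coflows.get j).release ≤ (d : ℚ≥0)) →
      (∀ i, ∑ j ∈ S, ∑ o, I.demand j i o ≤ d) → (∀ o, ∑ j ∈ S, ∑ i, I.demand j i o ≤ d) →
      ∑ j ∈ S, I.weight j ≤ ∑ j ∈ B, I.weight j) ∧
    ((∀ j : I.Job, (I.coflows.get j).release ≤ (d : ℚ≥0)) →
      (∀ i, ∑ j, ∑ o, I.demand j i o ≤ d) → (∀ o, ∑ j, ∑ i, I.demand j i o ≤ d) →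
      B = Finset.univ) := by
  have hall : jobMarking I d Finset.univ = (instanceCandidates I d).map fun c => (true, c) := by
    rw [instanceCandidates_eq, jobMarking, List.map_map]
    simp [Function.comp_def]
  obtain ⟨B, hB, h1, h2, h3⟩ : ∃ B : Finset I.Job, (∀ j ∈ B, j ∈ releasedJobs I d) ∧
      selected (bestSelection d (instanceCandidates I d)) = selected (jobMarking I d B) ∧
      markedValue (bestSelection d (instanceCandidates I d)) = markedValue (jobMarking I d B) ∧
      ((∀ j : I.Job, j ∈ releasedJobs I d) → bestSelection d (instanceCandidates I d) =
        jobMarking I d Finset.univ → B = Finset.univ) := by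
    rcases bestSelection_eq_nil_or d (instanceCandidates I d) with h | h
    -- The default `[]` need not be the marking of the empty set, but both select nothing and have
    -- value zero.
    · refine ⟨∅, by simp, ?_, ?_, fun h1 h2 => ?_⟩
      · rw [h]
        symm
        refine List.flatMap_eq_nil_iff.2 ?_
        intro p hp
        obtain ⟨j, -, rfl⟩ := List.mem_map.1 hp
        simp
      · rw [h]
        symm
        refine List.sum_eq_zero fun x hx => ?_
        obtain ⟨p, hp, rfl⟩ := List.mem_map.1 hx
        obtain ⟨j, -, rfl⟩ := List.mem_map.1 hp
        simp
      · rw [h, eq_comm, jobMarking, List.map_eq_nil_iff] at h2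
        ext j
        have := h1 j
        rw [h2] at this
        simp at this
    · obtain ⟨B, hB, h1⟩ := exists_jobMarking h
      refine ⟨B, hB, by rw [h1], by rw [h1], fun h2 h3 => ?_⟩
      rw [h1] at h3
      ext j
      have := List.map_inj_left.1 h3 j (h2 j)
      simpa using this
  refine ⟨B, fun j hj => mem_releasedJobs.1 (hB j hj), fun j i o n h => ?_, fun j hj i o => ?_,
    fun S hS hin hout => ?_, fun hr hin hout => h3 (fun j => mem_releasedJobs.2 (hr j)) ?_⟩
  · obtain ⟨w, hw⟩ := exists_mem_selected_of_mem_phaseDecision h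
    rw [h1, mem_selected_jobMarking] at hw
    obtain ⟨j', hj', -, i', o', h4⟩ := hw
    have h5 : j = j' := Fin.ext (Prod.mk.inj h4).1
    rw [h5]
    exact mem_releasedJobs.1 hj'
  · refine le_sum_phaseDecision ?_
    rw [h1, mem_selected_jobMarking]
    exact ⟨j, hB j hj, hj, i, o, rfl⟩
  · have hS' : ∀ j ∈ S, j ∈ releasedJobs I d := fun j hj => mem_releasedJobs.2 (hS j hj)
    rw [← markedValue_jobMarking hS', ← markedValue_jobMarking hB, ← h2]
    exact_mod_cast markedValue_le_bestSelection (instanceCandidates_den_pos d)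
      (jobMarking_mem_markings d S) (fits_jobMarking hS' hin hout)
  · rw [hall]
    refine bestSelection_eq_all (instanceCandidates_den_pos d) ?_
    rw [← hall]
    exact fits_jobMarking (fun j _ => mem_releasedJobs.2 (hr j)) hin hout

/-! ### Decisions on an instance -/

theorem flatMap_indexed_append {β γ : Type} (f : β × ℕ → List γ) (l r : List β)
    (h : ∀ b ∈ r, ∀ n, f (b, n) = []) : (indexed (l ++ r)).flatMap f = (indexed l).flatMap f := by
  induction r using List.reverseRecOn with
  | nil => rw [List.append_nil]
  | append_singleton r b ih =>
    rw [← List.append_assoc, indexed_concat, List.flatMap_cons, h b (by simp), List.nil_append]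
    exact ih fun b hb => h b (by simp [hb])

theorem not_of_mem_filter_append {β : Type} {p : β → Bool} {l r : List β} (h : l.filter p ++ r = l) :
    ∀ b ∈ r, ¬ p b = true := by
  have h1 := congrArg (List.filter p) h
  rw [List.filter_append, List.filter_filter] at h1
  simp only [Bool.and_self, List.append_right_eq_self, List.filter_eq_nil_iff] at h1
  exact h1

/-- Coflows unknown at time `t` are released after `d` and come last in the list, so they are
filtered out without shifting any number. Hence all decisions within one phase are computed from the
same candidates, although more coflows become known meanwhile. -/
theorem instanceCandidates_revealed (I : Instance) {t d : ℕ} (h : d ≤ t) :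
    instanceCandidates (I.revealed t) d = instanceCandidates I d := by
  obtain ⟨r, hr⟩ := I.revealed_prefix t
  have h1 : ∀ c ∈ r, ¬ c.release ≤ (t : ℚ≥0) := fun c hc hct =>
    not_of_mem_filter_append hr c hc (decide_eq_true hct)
  have h5 : I.coflows.map rawCoflow =
      (I.revealed t).coflows.map rawCoflow ++ r.map rawCoflow := by
    rw [← List.map_append]
    exact congrArg (List.map rawCoflow) hr.symm
  rw [instanceCandidates, instanceCandidates, h5]
  symm
  refine flatMap_indexed_append _ _ _ fun b hb n => ?_
  obtain ⟨c, hc, rfl⟩ := List.mem_map.1 hb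
  refine if_neg ?_
  simp only [rawCoflow, ofBits_bits, decide_eq_true_eq, ← nnrat_le_natCast_iff]
  exact fun h6 => h1 c hc (h6.trans (by exact_mod_cast h))

theorem decisionAt_zero (I : Instance) : algorithm.decisionAt I 0 = [] := by
  have h : rawDecision (rawInput 0 (I.revealed 0)) = [] := if_pos (by simp [rawInput, ofBits])
  exact h

/-- The binary expansion of `2^k + n` has `k + 1` digits, so dropping one digit and counting the
rest recovers the start of the phase. -/
theorem decisionAt_eq (I : Instance) {k n : ℕ} (hn : n < 2 ^ k) :
    algorithm.decisionAt I (2 ^ k + n) = phaseDecision (2 ^ k) n (instanceCandidates I (2 ^ k)) := by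
  have hk : 0 < 2 ^ k := by positivity
  have h1 : (2 ^ k + n).bits.length = k + 1 := by
    rw [Nat.size_eq_bits_len]
    refine le_antisymm (Nat.size_le.2 (by rw [pow_succ]; omega)) (Nat.lt_size.2 (by omega))
  have h2 : ∀ t, algorithm.decisionAt I t = if decide (ofBits t.bits = 0) = true then [] else
    phaseDecision (2 ^ t.bits.tail.length) (ofBits t.bits - 2 ^ t.bits.tail.length)
      (instanceCandidates (I.revealed t) (2 ^ t.bits.tail.length)) := fun t => rfl
  rw [h2, ofBits_bits, List.length_tail, h1, Nat.add_sub_cancel, Nat.add_sub_cancel_left,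
    instanceCandidates_revealed I (by omega), if_neg]
  simp only [decide_eq_true_eq]
  omega

end CoflowScheduling

namespace CoflowScheduling

open MeasureTheory

/-! ### Comparison of weighted completion times -/

/-- If `k` is the last index with `2^k < c`, the left side is at most the full geometric sum
`2^(k+2) = 4 * 2^k`. Without such an index it is `2`, and `1 ≤ c` suffices. -/
theorem two_add_sum_le {c : ℝ} (hc : 1 ≤ c) (K : ℕ) :
    2 + ∑ k ∈ Finset.range K, (2 : ℝ) ^ (k + 1) * (if c ≤ 2 ^ k then 0 else 1) ≤ 4 * c := by
  have hgeom : ∀ K : ℕ, 2 + ∑ k ∈ Finset.range K, (2 : ℝ) ^ (k + 1) = 2 ^ (K + 1) := by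
    intro K
    induction K with
    | zero => norm_num
    | succ K ih => rw [Finset.sum_range_succ, ← add_assoc, ih]; ring
  induction K with
  | zero => simp; linarith
  | succ K ih =>
    by_cases h : c ≤ 2 ^ K
    · rw [Finset.sum_range_succ, if_pos h]
      linarith
    · calc 2 + ∑ k ∈ Finset.range (K + 1), (2 : ℝ) ^ (k + 1) * (if c ≤ 2 ^ k then 0 else 1)
          ≤ 2 + ∑ k ∈ Finset.range (K + 1), (2 : ℝ) ^ (k + 1) := by
            gcongr with k
            split
            · simp
            · simp
        _ = 4 * 2 ^ K := by rw [hgeom]; ring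
        _ ≤ 4 * c := by linarith [not_le.1 h]

/-- If `k` is the first index with `j ∈ B k`, the terms before it already give `2^(k+1)`. The
induction finds this index by shifting `B` and halving `a`. -/
theorem le_two_add_sum {J : Type} {B : ℕ → Finset J} [DecidableEq J] {j : J} {K : ℕ} (hK : j ∈ B K)
    {a : ℝ} (ha : ∀ k, j ∈ B k → a ≤ 2 ^ (k + 1)) :
    a ≤ 2 + ∑ k ∈ Finset.range K, (2 : ℝ) ^ (k + 1) * (if j ∈ B k then 0 else 1) := by
  induction K generalizing B a with
  | zero => simpa using ha 0 hK
  | succ K ih =>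
    by_cases h0 : j ∈ B 0
    · have h1 := ha 0 h0
      have : 0 ≤ ∑ k ∈ Finset.range (K + 1), (2 : ℝ) ^ (k + 1) * (if j ∈ B k then 0 else 1) :=
        Finset.sum_nonneg fun k _ => by split <;> positivity
      norm_num at h1
      linarith
    · have h1 := ih (B := fun k => B (k + 1)) (a := a / 2) hK fun k hk => by
        have := ha (k + 1) hk
        rw [pow_succ] at this
        linarith
      rw [Finset.sum_range_succ', if_neg h0]
      have h2 : ∑ k ∈ Finset.range K, (2 : ℝ) ^ (k + 1 + 1) * (if j ∈ B (k + 1) then 0 else 1) =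
          2 * ∑ k ∈ Finset.range K, (2 : ℝ) ^ (k + 1) * (if j ∈ B (k + 1) then 0 else 1) := by
        rw [Finset.mul_sum]
        exact Finset.sum_congr rfl fun k _ => by ring
      rw [h2, zero_add, pow_one, mul_one]
      linarith

/-- If for every `k` the jobs in `B k` are completed by time `2 ^ (k + 1)`, and they weigh at least
as much as those with `c j ≤ 2 ^ k`, then the weighted sum of completion times is at most four times
that of `c`. -/
theorem sum_weight_mul_le {J : Type} [DecidableEq J] (X : Finset J) (w a c : J → ℝ)
    (hw : ∀ j, 0 ≤ w j) (hc : ∀ j ∈ X, 1 ≤ c j) (B : ℕ → Finset J)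
    (ha : ∀ k, ∀ j ∈ B k, a j ≤ 2 ^ (k + 1)) {K : ℕ} (hK : ∀ j ∈ X, j ∈ B K)
    (hB : ∀ k, ∑ j ∈ X with c j ≤ 2 ^ k, w j ≤ ∑ j ∈ X with j ∈ B k, w j) :
    ∑ j ∈ X, w j * a j ≤ 4 * ∑ j ∈ X, w j * c j := by
  have h1 : ∀ (P : J → Prop) [DecidablePred P], ∑ j ∈ X, w j * (if P j then 0 else 1) =
      ∑ j ∈ X, w j - ∑ j ∈ X with P j, w j := by
    intro P _
    rw [Finset.sum_filter, ← Finset.sum_sub_distrib]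
    exact Finset.sum_congr rfl fun j _ => by split <;> simp
  have h2 : ∀ (P : ℕ → J → Prop) [∀ k, DecidablePred (P k)],
      ∑ j ∈ X, w j * (2 + ∑ k ∈ Finset.range K, (2 : ℝ) ^ (k + 1) * (if P k j then 0 else 1)) =
      2 * ∑ j ∈ X, w j + ∑ k ∈ Finset.range K, (2 : ℝ) ^ (k + 1) *
        (∑ j ∈ X, w j - ∑ j ∈ X with P k j, w j) := by
    intro P _
    simp only [mul_add, Finset.sum_add_distrib, Finset.mul_sum, ← h1]
    rw [Finset.sum_comm]
    congr 1
    · exact Finset.sum_congr rfl fun j _ => mul_comm _ _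
    · exact Finset.sum_congr rfl fun k _ => Finset.sum_congr rfl fun j _ => by ring
  calc ∑ j ∈ X, w j * a j
      ≤ ∑ j ∈ X, w j * (2 + ∑ k ∈ Finset.range K, (2 : ℝ) ^ (k + 1) *
          (if j ∈ B k then 0 else 1)) := Finset.sum_le_sum fun j hj =>
        mul_le_mul_of_nonneg_left (le_two_add_sum (hK j hj) fun k hk => ha k j hk) (hw j)
    _ ≤ ∑ j ∈ X, w j * (2 + ∑ k ∈ Finset.range K, (2 : ℝ) ^ (k + 1) *
          (if c j ≤ 2 ^ k then 0 else 1)) := by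
        -- After exchanging the sums, index `k` contributes `2^(k+1)` times the weight outside the
        -- respective set, and `hB` compares these weights for each `k`.
        rw [h2 fun k j => j ∈ B k, h2 fun k j => c j ≤ 2 ^ k]
        refine add_le_add_right (Finset.sum_le_sum fun k _ => mul_le_mul_of_nonneg_left
          (sub_le_sub_left (hB k) _) (by positivity)) _
    _ ≤ ∑ j ∈ X, w j * (4 * c j) := Finset.sum_le_sum fun j hj =>
        mul_le_mul_of_nonneg_left (two_add_sum_le (hc j hj) K) (hw j)
    _ = 4 * ∑ j ∈ X, w j * c j := by
        rw [Finset.mul_sum]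
        exact Finset.sum_congr rfl fun j _ => by ring

/-! ### Feasible schedules -/

section Feasible

variable {I : Instance} {x : I.Schedule}

theorem Instance.release_nonneg (I : Instance) (j : I.Job) : 0 ≤ I.release j := by
  rw [Instance.release]
  exact_mod_cast NNRat.coe_nonneg _

theorem Instance.weight_nonneg (I : Instance) (j : I.Job) : 0 ≤ I.weight j := by
  rw [Instance.weight]
  exact_mod_cast NNRat.coe_nonneg _

theorem Instance.Feasible.le_one (hx : I.Feasible x) (j : I.Job) (i o : Fin I.m) (s : ℝ) : x j i o s ≤ 1 :=
  calc x j i o s ≤ ∑ o, x j i o s :=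
        Finset.single_le_sum (f := fun o => x j i o s) (fun o _ => hx.nonneg j i o s) (Finset.mem_univ o)
    _ ≤ ∑ j, ∑ o, x j i o s := Finset.single_le_sum (f := fun j => ∑ o, x j i o s)
        (fun j _ => Finset.sum_nonneg fun o _ => hx.nonneg j i o s) (Finset.mem_univ j)
    _ ≤ 1 := hx.input_capacity i s

theorem Instance.Feasible.intervalIntegrable (hx : I.Feasible x) (j : I.Job) (i o : Fin I.m) (a b : ℝ) :
    IntervalIntegrable (x j i o) volume a b := by
  refine (intervalIntegrable_const (c := (1 : ℝ))).mono_fun (hx.measurable j i o).aestronglyMeasurable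
    (Filter.Eventually.of_forall fun s => ?_)
  beta_reduce
  rw [Real.norm_of_nonneg (hx.nonneg j i o s), norm_one]
  exact hx.le_one j i o s

theorem Instance.Feasible.doneBy_mono (hx : I.Feasible x) {j : I.Job} {s t : ℝ} (h : I.DoneBy x j s) (hst : s ≤ t) :
    I.DoneBy x j t := by
  intro i o
  refine (h i o).trans ?_
  rw [← intervalIntegral.integral_add_adjacent_intervals (hx.intervalIntegrable j i o 0 s)
    (hx.intervalIntegrable j i o s t)]
  have := intervalIntegral.integral_nonneg (μ := volume) hst fun u _ => hx.nonneg j i o u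
  linarith

/-- The infimum is attained: transferred amounts are continuous in time, so the set of admissible
times is closed. -/
theorem Instance.Feasible.completionTime_spec (hx : I.Feasible x) (j : I.Job) :
    I.release j ≤ I.completionTime x j ∧ I.DoneBy x j (I.completionTime x j) := by
  have hclosed : IsClosed {t | I.release j ≤ t ∧ I.DoneBy x j t} := by
    have h : {t | I.release j ≤ t ∧ I.DoneBy x j t} =
        Set.Ici (I.release j) ∩ ⋂ i, ⋂ o, {t | (I.demand j i o : ℝ) ≤ ∫ s in (0 : ℝ)..t, x j i o s} := by
      ext t
      simp [Instance.DoneBy]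
    rw [h]
    refine isClosed_Ici.inter (isClosed_iInter fun i => isClosed_iInter fun o =>
      isClosed_le continuous_const ?_)
    exact intervalIntegral.continuous_primitive (fun a b => hx.intervalIntegrable j i o a b) 0
  exact hclosed.csInf_mem (hx.completes j) ⟨I.release j, fun t ht => ht.1⟩

theorem Instance.completionTime_le {j : I.Job} {t : ℝ} (h1 : I.release j ≤ t)
    (h2 : I.DoneBy x j t) : I.completionTime x j ≤ t :=
  csInf_le ⟨I.release j, fun _ ht => ht.1⟩ ⟨h1, h2⟩

theorem Instance.Feasible.one_le_completionTime (hx : I.Feasible x) {j : I.Job} {i o : Fin I.m}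
    (h : I.demand j i o ≠ 0) : 1 ≤ I.completionTime x j := by
  obtain ⟨h1, h2⟩ := hx.completionTime_spec j
  have h0 := (I.release_nonneg j).trans h1
  calc (1 : ℝ) ≤ I.demand j i o := by exact_mod_cast Nat.one_le_iff_ne_zero.2 h
    _ ≤ ∫ s in (0 : ℝ)..I.completionTime x j, x j i o s := h2 i o
    _ ≤ ∫ s in (0 : ℝ)..I.completionTime x j, (1 : ℝ) :=
        intervalIntegral.integral_mono_on h0 (hx.intervalIntegrable j i o _ _)
          intervalIntegrable_const fun s _ => hx.le_one j i o s
    _ = I.completionTime x j := by simp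

theorem sum_integral_le {J O : Type} [Fintype O] (S : Finset J) {f : J → O → ℝ → ℝ}
    (hf : ∀ j o a b, IntervalIntegrable (f j o) volume a b) {d : ℝ} (hd : 0 ≤ d)
    (h : ∀ s, ∑ j ∈ S, ∑ o, f j o s ≤ 1) : ∑ j ∈ S, ∑ o, ∫ s in (0 : ℝ)..d, f j o s ≤ d := by
  have hint : IntervalIntegrable (fun s => ∑ p ∈ S ×ˢ Finset.univ, f p.1 p.2 s) volume 0 d := by
    have := IntervalIntegrable.sum (S ×ˢ (Finset.univ : Finset O)) (f := fun p => f p.1 p.2)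
      (μ := volume) (a := 0) (b := d) fun p _ => hf p.1 p.2 0 d
    rwa [Finset.sum_fn] at this
  calc ∑ j ∈ S, ∑ o, ∫ s in (0 : ℝ)..d, f j o s
      = ∫ s in (0 : ℝ)..d, ∑ p ∈ S ×ˢ Finset.univ, f p.1 p.2 s := by
        rw [intervalIntegral.integral_finsetSum fun p _ => hf p.1 p.2 0 d, Finset.sum_product]
    _ ≤ ∫ s in (0 : ℝ)..d, (1 : ℝ) :=
        intervalIntegral.integral_mono_on hd hint intervalIntegrable_const fun s _ => by
          rw [Finset.sum_product]
          exact h s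
    _ = d := by simp

/-- All data of `S` at port `i` passes at total rate at most one during `[0, d]`. This necessary
condition is exactly the admissibility condition of a phase. -/
theorem Instance.Feasible.input_load_le (hx : I.Feasible x) {S : Finset I.Job} {d : ℕ}
    (hS : ∀ j ∈ S, I.completionTime x j ≤ d) (i : Fin I.m) :
    ∑ j ∈ S, ∑ o, I.demand j i o ≤ d := by
  have key : ((∑ j ∈ S, ∑ o, I.demand j i o : ℕ) : ℝ) ≤ d := by
    push_cast
    refine (Finset.sum_le_sum fun j hj => Finset.sum_le_sum fun o _ =>
      hx.doneBy_mono (hx.completionTime_spec j).2 (hS j hj) i o).trans ?_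
    refine sum_integral_le S (fun j o a b => hx.intervalIntegrable j i o a b) d.cast_nonneg
      fun s => ?_
    exact (Finset.sum_le_sum_of_subset_of_nonneg (Finset.subset_univ S) fun j _ _ =>
      Finset.sum_nonneg fun o _ => hx.nonneg j i o s).trans (hx.input_capacity i s)
  exact_mod_cast key

theorem Instance.Feasible.output_load_le (hx : I.Feasible x) {S : Finset I.Job} {d : ℕ}
    (hS : ∀ j ∈ S, I.completionTime x j ≤ d) (o : Fin I.m) :
    ∑ j ∈ S, ∑ i, I.demand j i o ≤ d := by
  have key : ((∑ j ∈ S, ∑ i, I.demand j i o : ℕ) : ℝ) ≤ d := by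
    push_cast
    refine (Finset.sum_le_sum fun j hj => Finset.sum_le_sum fun i _ =>
      hx.doneBy_mono (hx.completionTime_spec j).2 (hS j hj) i o).trans ?_
    refine sum_integral_le S (fun j i a b => hx.intervalIntegrable j i o a b) d.cast_nonneg
      fun s => ?_
    exact (Finset.sum_le_sum_of_subset_of_nonneg (Finset.subset_univ S) fun j _ _ =>
      Finset.sum_nonneg fun i _ => hx.nonneg j i o s).trans (hx.output_capacity o s)
  exact_mod_cast key

end Feasible

/-! ### The schedule of the algorithm -/

theorem sum_eq_zero_or_one_le {J O : Type} [Fintype J] [Fintype O] {P : J → O → Prop}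
    [∀ j o, Decidable (P j o)] (h : ∀ j o j' o', P j o → P j' o' → j = j' ∧ o = o') :
    ∑ j, ∑ o, (if P j o then 1 else 0 : ℝ) ≤ 1 := by
  have h1 : ∑ j, ∑ o, (if P j o then 1 else 0 : ℝ) =
      ((Finset.univ.filter fun p : J × O => P p.1 p.2).card : ℝ) := by
    rw [← Fintype.sum_prod_type', Finset.sum_boole]
  rw [h1]
  norm_cast
  rw [Finset.card_le_one]
  rintro ⟨j, o⟩ hp ⟨j', o'⟩ hq
  simp only [Finset.mem_filter, Finset.mem_univ, true_and] at hp hq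
  obtain ⟨rfl, rfl⟩ := h _ _ _ _ hp hq
  rfl

theorem eq_of_length_le_one {β : Type} {l : List β} (h : l.length ≤ 1) {a b : β} (ha : a ∈ l)
    (hb : b ∈ l) : a = b := by
  match l, h with
  | [], _ => simp at ha
  | [c], _ => rw [List.mem_singleton.1 ha, List.mem_singleton.1 hb]

theorem exists_eq_two_pow_add {t : ℕ} (ht : t ≠ 0) : ∃ k n, n < 2 ^ k ∧ t = 2 ^ k + n := by
  refine ⟨Nat.log 2 t, t - 2 ^ Nat.log 2 t, ?_, ?_⟩
  · have := Nat.lt_pow_succ_log_self Nat.one_lt_two t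
    rw [pow_succ] at this
    omega
  · have := Nat.pow_log_le_self 2 ht
    omega

theorem length_filter_decisionAt_in (I : Instance) (t i : ℕ) :
    ((algorithm.decisionAt I t).filter fun e => e.2.1 = i).length ≤ 1 := by
  rcases eq_or_ne t 0 with rfl | ht
  · rw [decisionAt_zero]; simp
  · obtain ⟨k, n, hn, rfl⟩ := exists_eq_two_pow_add ht
    rw [decisionAt_eq I hn]
    exact length_filter_phaseDecision_in _ _ _ _

theorem length_filter_decisionAt_out (I : Instance) (t o : ℕ) :
    ((algorithm.decisionAt I t).filter fun e => e.2.2 = o).length ≤ 1 := by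
  rcases eq_or_ne t 0 with rfl | ht
  · rw [decisionAt_zero]; simp
  · obtain ⟨k, n, hn, rfl⟩ := exists_eq_two_pow_add ht
    rw [decisionAt_eq I hn]
    exact length_filter_phaseDecision_out _ _ _ _

theorem Instance.release_le_iff (I : Instance) (j : I.Job) (d : ℕ) :
    I.release j ≤ d ↔ (I.coflows.get j).release ≤ (d : ℚ≥0) := by
  rw [Instance.release]
  exact_mod_cast Iff.rfl

theorem release_le_of_mem_decisionAt {I : Instance} {t : ℕ} {j : I.Job} {i o : ℕ}
    (h : ((j : ℕ), i, o) ∈ algorithm.decisionAt I t) : I.release j ≤ t := by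
  rcases eq_or_ne t 0 with rfl | ht
  · rw [decisionAt_zero] at h
    simp at h
  · obtain ⟨k, n, hn, rfl⟩ := exists_eq_two_pow_add ht
    rw [decisionAt_eq I hn] at h
    obtain ⟨B, -, h1, -⟩ := exists_batch I (2 ^ k)
    refine ((I.release_le_iff j _).2 (h1 j i o n h)).trans ?_
    push_cast
    linarith [(Nat.cast_nonneg n : (0 : ℝ) ≤ n)]

open Classical in
theorem integral_slots {g : ℕ → Prop} (T : ℕ) :
    ∫ s in (0 : ℝ)..T, (if 0 ≤ s ∧ g ⌊s⌋₊ then 1 else 0 : ℝ) =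
      ∑ t ∈ Finset.range T, if g t then 1 else 0 := by
  have hmeas : Measurable fun s : ℝ => if 0 ≤ s ∧ g ⌊s⌋₊ then (1 : ℝ) else 0 :=
    Measurable.ite (measurableSet_Ici.inter (Nat.measurable_floor (MeasurableSet.of_discrete (s := {n | g n}))))
      measurable_const measurable_const
  have hint : ∀ a b : ℝ, IntervalIntegrable (fun s : ℝ => if 0 ≤ s ∧ g ⌊s⌋₊ then (1 : ℝ) else 0)
      volume a b := fun a b => by
    refine (intervalIntegrable_const (c := (1 : ℝ))).mono_fun hmeas.aestronglyMeasurable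
      (Filter.Eventually.of_forall fun s => ?_)
    dsimp only
    split <;> simp
  have h := intervalIntegral.sum_integral_adjacent_intervals (a := fun n : ℕ => (n : ℝ)) (n := T)
    fun k _ => hint (k : ℝ) ((k + 1 : ℕ) : ℝ)
  rw [Nat.cast_zero] at h
  rw [← h]
  refine Finset.sum_congr rfl fun t _ => ?_
  rw [intervalIntegral.integral_congr_Ioo_of_le (g := fun _ => if g t then (1 : ℝ) else 0)
    (by push_cast; linarith) fun s hs => ?_]
  · simp
  · have h0 : (0 : ℝ) ≤ s := (Nat.cast_nonneg t).trans hs.1.le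
    have h1 : ⌊s⌋₊ = t := (Nat.floor_eq_iff h0).2 ⟨hs.1.le, by have := hs.2; push_cast at this; exact this⟩
    simp only [h0, h1, true_and]

theorem doneBy_of_phase {I : Instance} {k : ℕ} {j : I.Job}
    (h : ∀ i o : Fin I.m, I.demand j i o ≤ ∑ n ∈ Finset.range (2 ^ k),
      if ((j : ℕ), (i : ℕ), (o : ℕ)) ∈ phaseDecision (2 ^ k) n (instanceCandidates I (2 ^ k))
      then 1 else 0) : I.DoneBy (algorithm.schedule I) j ((2 ^ (k + 1) : ℕ) : ℝ) := by
  intro i o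
  have h1 := integral_slots (g := fun t => ((j : ℕ), (i : ℕ), (o : ℕ)) ∈ algorithm.decisionAt I t)
    (2 ^ (k + 1))
  refine le_of_le_of_eq ?_ (h1.symm.trans (intervalIntegral.integral_congr fun s _ => ?_))
  swap
  · rw [OnlineAlgorithm.schedule]
    congr
  -- Earlier slots may have served `j` too; their contribution is nonnegative and is discarded.
  rw [show 2 ^ (k + 1) = 2 ^ k + 2 ^ k by rw [pow_succ]; omega, Finset.sum_range_add]
  refine le_add_of_nonneg_of_le (Finset.sum_nonneg fun t _ => by split <;> simp) ?_
  refine le_of_le_of_eq (Nat.cast_le.2 (h i o)) ?_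
  rw [Nat.cast_sum]
  refine Finset.sum_congr rfl fun n hn => ?_
  rw [decisionAt_eq I (Finset.mem_range.1 hn)]
  push_cast
  congr

/-! ### Size of an instance -/

theorem size_encode (I : Instance) :
    I.encode.size = sz I.m.bits + sz (I.coflows.map rawCoflow) + 1 := by
  have h : sz (rawInput 0 I) = sz (Nat.bits 0) + I.encode.size + 1 := by
    rw [sz, enc_rawInput]
    rfl
  have h2 : sz (rawInput 0 I) = sz (Nat.bits 0) + (sz I.m.bits + sz (I.coflows.map rawCoflow) + 1) + 1 :=
    rfl
  omega

/-- By `2^a + 2^b ≤ 2^(a+b+1)`, such a bound passes from elements to lists. Applied to digits, rows,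
matrices and coflows, it bounds the total demand. -/
theorem sum_le_two_pow_sz {β : Type} [Enc β] (f : β → ℕ) (h : ∀ b, f b ≤ 2 ^ sz b) (l : List β) :
    (l.map f).sum ≤ 2 ^ sz l := by
  induction l with
  | nil => simp
  | cons b l ih =>
    rw [List.map_cons, List.sum_cons, sz_cons]
    have h1 := h b
    have h2 : 2 ^ sz b ≤ 2 ^ (sz b + sz l) := Nat.pow_le_pow_right (by omega) (by omega)
    have h3 : 2 ^ sz l ≤ 2 ^ (sz b + sz l) := Nat.pow_le_pow_right (by omega) (by omega)
    rw [pow_succ]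
    omega

theorem ofBits_le_two_pow_sz (l : List Bool) : ofBits l ≤ 2 ^ sz l :=
  (ofBits_lt l).le.trans (Nat.pow_le_pow_right (by omega) (length_lt_sz l).le)

theorem total_demand_le (I : Instance) : ∑ j, ∑ i, ∑ o, I.demand j i o ≤ 2 ^ I.encode.size := by
  have h := sum_le_two_pow_sz (fun c : RawCoflow => (c.1.map fun r => (r.map ofBits).sum).sum)
    (fun c => (sum_le_two_pow_sz (fun r => (r.map ofBits).sum)
      (fun r => sum_le_two_pow_sz ofBits ofBits_le_two_pow_sz r) c.1).trans
      (Nat.pow_le_pow_right (by omega) (by rw [sz_pair]; omega))) (I.coflows.map rawCoflow)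
  have h1 : ((I.coflows.map rawCoflow).map
      fun c : RawCoflow => (c.1.map fun r => (r.map ofBits).sum).sum).sum =
      ∑ j, ∑ i, ∑ o, I.demand j i o := by
    have h2 : I.coflows.map rawCoflow = List.ofFn fun j : I.Job => rawCoflow (I.coflows.get j) := by
      conv_lhs => rw [← List.ofFn_get I.coflows]
      rw [List.map_ofFn]
      rfl
    rw [h2, List.map_ofFn, List.sum_ofFn]
    refine Finset.sum_congr rfl fun j _ => ?_
    simp only [Function.comp_apply, rawCoflow, List.map_ofFn, List.sum_ofFn, ofBits_bits]
    rfl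
  rw [h1] at h
  refine h.trans (Nat.pow_le_pow_right (by omega) ?_)
  rw [size_encode]
  omega

theorem release_le_two_pow_size (I : Instance) (j : I.Job) :
    (I.coflows.get j).release ≤ ((2 ^ I.encode.size : ℕ) : ℚ≥0) := by
  rw [nnrat_le_natCast_iff]
  have h1 := ofBits_le_two_pow_sz (I.coflows.get j).release.num.bits
  rw [ofBits_bits] at h1
  have h2 : sz (rawCoflow (I.coflows.get j)) < sz (I.coflows.map rawCoflow) :=
    sz_mem_lt (List.mem_map_of_mem (List.get_mem _ _))
  have h3 : sz (I.coflows.get j).release.num.bits ≤ I.encode.size := by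
    rw [size_encode]
    simp only [rawCoflow, sz_pair] at h2
    omega
  calc (I.coflows.get j).release.num ≤ 2 ^ I.encode.size :=
        h1.trans (Nat.pow_le_pow_right (by omega) h3)
    _ ≤ (I.coflows.get j).release.den * 2 ^ I.encode.size :=
        Nat.le_mul_of_pos_left _ (NNRat.den_pos _)

theorem input_load_le_total (I : Instance) (i : Fin I.m) :
    ∑ j, ∑ o, I.demand j i o ≤ 2 ^ I.encode.size :=
  (Finset.sum_le_sum fun j _ => Finset.single_le_sum (f := fun i => ∑ o, I.demand j i o)
    (fun _ _ => Nat.zero_le _) (Finset.mem_univ i)).trans (total_demand_le I)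

theorem output_load_le_total (I : Instance) (o : Fin I.m) :
    ∑ j, ∑ i, I.demand j i o ≤ 2 ^ I.encode.size :=
  (Finset.sum_le_sum fun j _ => Finset.sum_le_sum fun i _ => Finset.single_le_sum
    (f := fun o => I.demand j i o) (fun _ _ => Nat.zero_le _) (Finset.mem_univ o)).trans
    (total_demand_le I)

theorem size_onlineInput_le (I : Instance) (t : ℕ) :
    (I.onlineInput t).size ≤ 4 * t.size + 2 + I.encode.size := by
  have h : (I.onlineInput t).size = sz t.bits + (I.revealed t).encode.size + 1 := rfl
  have h1 : sz ((I.revealed t).coflows.map rawCoflow) ≤ sz (I.coflows.map rawCoflow) :=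
    sz_prefix_le ((I.revealed_prefix t).map rawCoflow)
  have h2 := sz_bits_le t.bits
  rw [Nat.size_eq_bits_len] at h2
  have h3 : sz (I.revealed t).m.bits = sz I.m.bits := rfl
  rw [h, size_encode, size_encode]
  omega

/-- All coflows are completed by this time. -/
theorem doneBy_horizon (I : Instance) (j : I.Job) :
    I.release j ≤ ((2 ^ (I.encode.size + 1) : ℕ) : ℝ) ∧
      I.DoneBy (algorithm.schedule I) j ((2 ^ (I.encode.size + 1) : ℕ) : ℝ) := by
  obtain ⟨B, -, -, h1, -, h2⟩ := exists_batch I (2 ^ I.encode.size)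
  have hB := h2 (release_le_two_pow_size I) (input_load_le_total I) (output_load_le_total I)
  refine ⟨((I.release_le_iff j _).2 (release_le_two_pow_size I j)).trans ?_,
    doneBy_of_phase (h1 j (by rw [hB]; exact Finset.mem_univ j))⟩
  exact Nat.cast_le.2 (Nat.pow_le_pow_right (by omega) (by omega))

theorem algorithm_runsInExponentialTime : algorithm.RunsInExponentialTime := by
  obtain ⟨P, c, h⟩ := exists_prog_algorithm
  -- With `N = I.encode.size ≥ 1` and `t < 2^(N+1)`, the online input has size at most `4(N+1) + 2 +
  -- N ≤ 11N`. The summand `2` pays for the `2^(N+1)` slots.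
  refine ⟨P, 11 * c + 2, fun I => ?_⟩
  choose steps hs hP using h I
  refine ⟨steps, hP, fun t => (hs t).trans (Nat.pow_le_pow_right (by omega)
    (Nat.mul_le_mul_right _ (by omega))), 2 ^ (I.encode.size + 1), doneBy_horizon I, ?_⟩
  have hN : 1 ≤ I.encode.size := Data.size_pos _
  have hstep : ∀ t ∈ Finset.range (2 ^ (I.encode.size + 1)), steps t ≤ 2 ^ (c * (11 * I.encode.size)) := by
    intro t ht
    refine (hs t).trans (Nat.pow_le_pow_right (by omega) (Nat.mul_le_mul_left _ ?_))
    have h1 := size_onlineInput_le I t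
    have h2 : t.size ≤ I.encode.size + 1 := Nat.size_le.2 (Finset.mem_range.1 ht)
    omega
  refine (Finset.sum_le_card_nsmul _ _ _ hstep).trans ?_
  rw [Finset.card_range, smul_eq_mul, ← pow_add]
  refine Nat.pow_le_pow_right (by omega) ?_
  rw [Nat.add_mul, mul_comm 11 c, mul_assoc]
  omega

theorem algorithm_feasible (I : Instance) : I.Feasible (algorithm.schedule I) where
  measurable j i o := by
    classical
    exact Measurable.ite (measurableSet_Ici.inter (Nat.measurable_floor (MeasurableSet.of_discrete
      (s := {t | ((j : ℕ), (i : ℕ), (o : ℕ)) ∈ algorithm.decisionAt I t}))))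
      measurable_const measurable_const
  nonneg j i o s := by
    rw [OnlineAlgorithm.schedule]
    split <;> simp
  released j i o s hs := by
    refine if_neg fun h => ?_
    have h1 := release_le_of_mem_decisionAt h.2
    have h2 := Nat.floor_le h.1
    linarith
  input_capacity i s := by
    classical
    refine sum_eq_zero_or_one_le fun j o j' o' h h' => ?_
    have := eq_of_length_le_one (length_filter_decisionAt_in I ⌊s⌋₊ i)
      (List.mem_filter.2 ⟨h.2, by simp⟩) (List.mem_filter.2 ⟨h'.2, by simp⟩)
    simp only [Prod.mk.injEq, true_and] at this
    exact ⟨Fin.ext this.1, Fin.ext this.2⟩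
  output_capacity o s := by
    classical
    refine sum_eq_zero_or_one_le fun j i j' i' h h' => ?_
    have := eq_of_length_le_one (length_filter_decisionAt_out I ⌊s⌋₊ o)
      (List.mem_filter.2 ⟨h.2, by simp⟩) (List.mem_filter.2 ⟨h'.2, by simp⟩)
    simp only [Prod.mk.injEq, and_true] at this
    exact ⟨Fin.ext this.1, Fin.ext this.2⟩
  completes j := ⟨_, doneBy_horizon I j⟩

/-! ### The competitive ratio -/

/-- Coflows without demand are split off because their completion times may be below 1, where the
geometric comparison fails. They complete at their release under the algorithm, hence no later than
in `x`. -/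
theorem cost_algorithm_le {I : Instance} {x : I.Schedule} (hx : I.Feasible x) :
    I.cost (algorithm.schedule I) ≤ 4 * I.cost x := by
  classical
  choose B hBr hB1 hBd hBopt hBall using fun k => exists_batch I (2 ^ k)
  let X : Finset I.Job := Finset.univ.filter fun j => ∃ i o, I.demand j i o ≠ 0
  have hzero : ∀ j ∉ X, ∀ i o, I.demand j i o = 0 := by
    intro j hj i o
    by_contra h
    exact hj (Finset.mem_filter.2 ⟨Finset.mem_univ j, i, o, h⟩)
  have hX : ∑ j ∈ X, I.weight j * I.completionTime (algorithm.schedule I) j ≤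
      4 * ∑ j ∈ X, I.weight j * I.completionTime x j := by
    refine sum_weight_mul_le X _ _ _ I.weight_nonneg (fun j hj => ?_) B (fun k j hj => ?_)
      (K := I.encode.size) (fun j _ => ?_) fun k => ?_
    · obtain ⟨i, o, h⟩ := (Finset.mem_filter.1 hj).2
      exact hx.one_le_completionTime h
    · have h1 : I.completionTime (algorithm.schedule I) j ≤ ((2 ^ (k + 1) : ℕ) : ℝ) := by
        refine Instance.completionTime_le ?_ (doneBy_of_phase (hBd k j hj))
        refine ((I.release_le_iff j _).2 (hBr k j hj)).trans ?_
        exact Nat.cast_le.2 (Nat.pow_le_pow_right (by omega) (by omega))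
      exact_mod_cast h1
    · rw [hBall _ (release_le_two_pow_size I) (input_load_le_total I) (output_load_le_total I)]
      exact Finset.mem_univ j
    -- The optimality of `B k` counts its demandless jobs as well. Adding those same jobs to the
    -- competing set costs no load, and their weight cancels, which leaves the comparison within
    -- `X`.
    · let S₁ : Finset I.Job := X.filter fun j => I.completionTime x j ≤ 2 ^ k
      let S₂ : Finset I.Job := (B k).filter fun j => j ∉ X
      have hdisj : Disjoint S₁ S₂ := Finset.disjoint_left.2 fun j h1 h2 =>
        (Finset.mem_filter.1 h2).2 (Finset.mem_filter.1 h1).1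
      have hS₁ : ∀ j ∈ S₁, I.completionTime x j ≤ ((2 ^ k : ℕ) : ℝ) := fun j hj => by
        push_cast
        exact (Finset.mem_filter.1 hj).2
      have h1 := hBopt k (S₁ ∪ S₂)
        (fun j hj => by
          rcases Finset.mem_union.1 hj with h | h
          · exact (I.release_le_iff j _).1 ((hx.completionTime_spec j).1.trans (hS₁ j h))
          · exact hBr k j (Finset.mem_filter.1 h).1)
        (fun i => by
          rw [Finset.sum_union hdisj, Finset.sum_eq_zero (s := S₂) fun j hj =>
            Finset.sum_eq_zero fun o _ => hzero j (Finset.mem_filter.1 hj).2 i o, add_zero]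
          exact hx.input_load_le hS₁ i)
        (fun o => by
          rw [Finset.sum_union hdisj, Finset.sum_eq_zero (s := S₂) fun j hj =>
            Finset.sum_eq_zero fun i _ => hzero j (Finset.mem_filter.1 hj).2 i o, add_zero]
          exact hx.output_load_le hS₁ o)
      rw [Finset.sum_union hdisj, ← Finset.sum_filter_add_sum_filter_not (B k) (fun j => j ∈ X)]
        at h1
      have h2 : (B k).filter (fun j => j ∈ X) = X.filter fun j => j ∈ B k := by
        ext j
        simp [and_comm]
      rw [h2] at h1
      exact le_of_add_le_add_right h1
  have hXc : ∑ j with j ∉ X, I.weight j * I.completionTime (algorithm.schedule I) j ≤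
      4 * ∑ j with j ∉ X, I.weight j * I.completionTime x j := by
    rw [Finset.mul_sum]
    refine Finset.sum_le_sum fun j hj => ?_
    have h1 : I.completionTime (algorithm.schedule I) j ≤ I.release j :=
      Instance.completionTime_le le_rfl fun i o => by
        rw [hzero j (Finset.mem_filter.1 hj).2 i o, Nat.cast_zero]
        exact intervalIntegral.integral_nonneg (I.release_nonneg j) fun s _ =>
          (algorithm_feasible I).nonneg j i o s
    have h2 := (hx.completionTime_spec j).1
    have h3 := I.release_nonneg j
    have h4 := I.weight_nonneg j
    have h5 := mul_le_mul_of_nonneg_left (h1.trans h2) h4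
    have h6 := mul_nonneg h4 (h3.trans h2)
    linarith
  have hsplit : ∀ f : I.Job → ℝ, ∑ j, f j = ∑ j ∈ X, f j + ∑ j with j ∉ X, f j := fun f => by
    rw [← Finset.sum_filter_add_sum_filter_not Finset.univ (fun j => j ∈ X)]
    simp
  rw [Instance.cost, Instance.cost, hsplit, hsplit fun j => I.weight j * I.completionTime x j]
  linarith

theorem cost_nonneg {I : Instance} {x : I.Schedule} (hx : I.Feasible x) : 0 ≤ I.cost x :=
  Finset.sum_nonneg fun j _ => mul_nonneg (I.weight_nonneg j)
    ((I.release_nonneg j).trans (hx.completionTime_spec j).1)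

theorem algorithm_isCompetitive : algorithm.IsCompetitive 6 := fun I =>
  -- The ratio proved is 4; nonnegativity of the cost relaxes it to 6.
  ⟨algorithm_feasible I, fun x hx => by linarith [cost_algorithm_le hx, cost_nonneg hx]⟩

end CoflowScheduling

theorem mainTheorem6 :
    ∃ A : CoflowScheduling.OnlineAlgorithm, A.RunsInExponentialTime ∧ A.IsCompetitive 6 :=
  ⟨CoflowScheduling.algorithm, CoflowScheduling.algorithm_runsInExponentialTime,
    CoflowScheduling.algorithm_isCompetitive⟩
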